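/- **Setting.** Let $\mathcal I=\{\mathtt j_1,\dots,\mathtt j_n\}\subset\mathbb Z$ be a finite set of $n$ distinct tangential sites with $\kappa:=\max_l|\mathtt j_l|\ge 1$, and let $a\ge0$, $p>1/2$, $0<b<L<1$, $\langle m\rangle:=\max\{1,|m|\}$. For sequences on $\mathbb Z\setminus\mathcal I$ put $\|z\|_{a,p}^2=\sum_m|z_m|^2e^{2a|m|}\langle m\rangle^{2p}$. Let $D(r)=\{(y,z,\bar z):|y|_1<r^2,\ \|z\|_{a,p}<r,\ \|\bar z\|_{a,p}<r\}$ and $D(s,r)=\{x\in\mathbb C^n:|\mathrm{Im}\,x_l|<s\ \forall l\}\times D(r)$ ($z$, $\bar z$ are independent variables), and $$\|(x,y,z,\bar z)\|_{E,s,r}=\frac{|x|_\infty}{s}+\frac{|y|_1}{r^2}+\frac{\|z\|_{a,p}}r+\frac{\|\bar z\|_{a,p}}r .$$ For a Taylor–Fourier series $f=\sum f_{k,i,\alpha,\beta}e^{\mathrm i k\cdot x}y^iz^\alpha\bar z^\beta$ let $X_f=(\partial_yf,-\partial_xf,-\mathrm i\partial_{\bar z}f,\mathrm i\partial_zf)$.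 The majorant norm of a vector field $X$ is $$\|X\|_{s,r}=\sup_{(y,z,\bar z)\in D(r)}\Big\|\Big(\sum_{k,i,\alpha,\beta}|X^{(h)}_{k,i,\alpha,\beta}|e^{|k|s}|y^i||z^\alpha||\bar z^\beta|\Big)_{h}\Big\|_{E,s,r},$$ where $h$ runs over the components. If $f$ depends on a parameter $\xi\in\mathcal O$, set $\|X_f\|_{s,r,\mathcal O}=\sup_{\xi\in\mathcal O}\|X_{f(\xi)}\|_{s,r}$. $\mathcal H_{s,r}$ is the set of $f$ for which this is finite, and $\mathcal H^{\rm null}_{s,r}$ the subset of those whose monomials all have zero momentum $\pi(k,\alpha,\beta)=\sum_l\mathtt j_lk_l+\sum_m m(\alpha_m-\beta_m)$. Write $z^+=z$, $z^-=\bar z$. For $N\in\mathbb N$, a monomial is $(N,\mu)$-low momentum if $\sum_m|m|(\alpha_m+\beta_m)<\mu N^L$ and $|k|_1<N^b$; $\mathcal L_{s,r}(N,\mu,h)\subset\mathcal H_{s,r}$ consists of the functions all of whose monomials are $(N,\mu)$-low momentum with $\pi=-h$. $\Pi_{N,\theta,\mu}f$ keeps exactly the monomials of $f$ of the form $\mathfrak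 m\,z_m^\sigma z_{m'}^{\sigma'}$ with $|m|,|m'|>\theta N$, $\sigma,\sigma'=\pm$, and $\mathfrak m$ an $(N,\mu)$-low momentum monomial of momentum $-(\sigma m+\sigma'm')$. $\mathcal T_{s,r}(N,\theta,\mu)$ is the set of $f\in\mathcal H^{\rm null}_{s,r}$ of the form $$f=\sum_{|m|,|m'|>\theta N,\ \sigma,\sigma'=\pm}f^{\sigma,\sigma'}(\mathrm{sign}(m),\sigma m+\sigma'm')\,z_m^\sigma z_{m'}^{\sigma'},\qquad f^{\sigma,\sigma'}(\varsigma,h)\in\mathcal L_{s,r}(N,\mu,h).$$ The quasi-Töplitz semi-norm is $$\|f\|^T_{s,r,N_0,\theta,\mu,\mathcal O}=\sup_{N\ge N_0}\ \inf_{\tilde f\in\mathcal T_{s,r}(N,\theta,\mu)}\max\big\{\|X_f\|_{s,r,\mathcal O},\ \|X_{\tilde f}\|_{s,r,\mathcal O},\ \|X_{\hat f}\|_{s,r,\mathcal O}\big\},\qquad \hat f:=N(\Pi_{N,\theta,\mu}f-\tilde f),$$ and $\mathcal Q^T_{s,r}(N_0,\theta,\mu)$ is the set of $f\in\mathcal H^{\rm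 null}_{s,r}$ for which it is finite. The same notions with $n=0$, $\mathcal I=\emptyset$ (no $x,y,s$), no parameters and variables $(u,\bar u)$ in place of $(z,\bar z)$ give $\mathcal Q^T_R(N_0,\theta,\mu)$ and $\|\cdot\|^T_{R,N_0,\theta,\mu}$ for functions on $B_R\times B_R$, where $B_R=\{\|u\|_{a,p}<R\}$ and sequences are indexed by $\mathbb Z$. There $\mathcal H^d_R$ is the set of $F=\sum F_{\alpha,\beta}u^\alpha\bar u^\beta\in\mathcal H_R$ in which only monomials with $\sum_{m\notin\mathcal I}(\alpha_m+\beta_m)\ge d$ occur. Let $\Phi(x,y,z,\bar z;\xi)=(u,\bar u)$ with $u_{\mathtt j_l}=\sqrt{\xi_l+y_l}\,e^{\mathrm ix_l}$, $\bar u_{\mathtt j_l}=\sqrt{\xi_l+y_l}\,e^{-\mathrm ix_l}$ for $1\le l\le n$, and $u_m=z_m$, $\bar u_m=\bar z_m$ for $m\notin\mathcal I$. Let $\mathcal O_\rho=\{\xi\in\mathbb R^n:\rho/2\le\xi_l\le\rho\ \forall l\}$. **Proposition 6.2.** There is a constant $c>0$, depending only on $n$ and $\kappa$, such that the following holds. Let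 $0<s<1$, let $r,R,\rho>0$ satisfy $$16r^2<\rho,\qquad \rho=C_*R^2,\qquad C_*^{-1}=48\,n\,\kappa^{2p}e^{2(s+a\kappa)},$$ and let $N_0\ge1$ be an integer and $1<\theta,\mu,\mu'<6$ be real with $$12N_0^{L-1}+2\kappa N_0^{b-1}<1,\qquad(\mu'-\mu)N_0^L>N_0^b,\qquad N_0\,2^{-\frac{N_0^b}{2\kappa}+1}<1.$$ Let $d\in\{0,1\}$ and $F\in\mathcal Q^T_{R/2}(N_0,\theta,\mu')\cap\mathcal H^d_{R/2}$. Then $f:=F\circ\Phi$, for $\xi\in\mathcal O_\rho$, belongs to $\mathcal Q^T_{s,r}(N_0,\theta,\mu)$: on $D(s,r)$ it is the sum of an absolutely convergent Taylor–Fourier series that satisfies the above definition. Moreover $$\|f\|^T_{s,r,N_0,\theta,\mu,\mathcal O_\rho}\le\frac cs\Big(\frac{8r}R\Big)^{d-2}\|F\|^T_{R/2,N_0,\theta,\mu'} .$$ -/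

import Mathlib

open scoped ENNReal

noncomputable section

namespace QuasiToplitz

/-! ### Indices, points, formal power series

`j : Fin n → ℤ` lists the tangential sites (it is assumed injective in the theorem), so that the
tangential set is `Set.range j`. For `n = 0` there are no `(x, y)`-variables and the normal sites
are all of `ℤ`; this is the case of the variables `(u, ū)`. -/

/-- The normal sites: the integers that are not tangential sites. -/
abbrev Site {n : ℕ} (j : Fin n → ℤ) : Type := {m : ℤ // ∀ l, j l ≠ m}

/-- The empty family of tangential sites. -/
abbrev noSites : Fin 0 → ℤ := Fin.elim0

/-- Multi-indices of the monomials `e^{i k·x} y^i z^α z̄^β`. -/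
@[ext] structure Index {n : ℕ} (j : Fin n → ℤ) where
  k : Fin n → ℤ
  i : Fin n → ℕ
  α : Site j →₀ ℕ
  β : Site j →₀ ℕ

/-- Points `v = (x, y, z, z̄)`; the sequences `z`, `z̄` are independent variables, and the
summability condition on them is part of the domains below. -/
@[ext] structure Pt {n : ℕ} (j : Fin n → ℤ) where
  x : Fin n → ℂ
  y : Fin n → ℂ
  z : Site j → ℂ
  zbar : Site j → ℂ

/-- Formal Taylor–Fourier series, given by their coefficients. -/
abbrev Coeff {n : ℕ} (j : Fin n → ℤ) : Type := Index j → ℂ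

/-- Formal vector fields: a formal series for each component. -/
structure VField {n : ℕ} (j : Fin n → ℤ) where
  x : Fin n → Coeff j
  y : Fin n → Coeff j
  z : Site j → Coeff j
  zbar : Site j → Coeff j

section basic

variable {n : ℕ} {j : Fin n → ℤ}

/-- The monomial `e^{i k·x} y^i z^α z̄^β` at the point `v`. -/
def monomial (ν : Index j) (v : Pt j) : ℂ :=
  Complex.exp (Complex.I * ∑ l, (ν.k l : ℂ) * v.x l) * (∏ l, v.y l ^ ν.i l) *
    (ν.α.prod fun m e => v.z m ^ e) * (ν.β.prod fun m e => v.zbar m ^ e)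

/-- `⟨m⟩ = max {1, |m|}`. -/
def bracket (m : ℤ) : ℝ := max 1 |(m : ℝ)|

/-- `‖w‖_{a,p} = (∑ |w_m|² e^{2a|m|} ⟨m⟩^{2p})^{1/2}` of a sequence of moduli, with value `∞`
if the sum diverges. -/
def seqNorm (a p : ℝ) (w : Site j → ℝ≥0∞) : ℝ≥0∞ :=
  (∑' m : Site j, w m ^ 2 *
    ENNReal.ofReal (Real.exp (2 * a * |((m : ℤ) : ℝ)|) * bracket m ^ (2 * p))) ^ (1 / 2 : ℝ)

/-- The weighted norm `|x|_∞ / s + |y|_1 / r² + ‖z‖_{a,p} / r + ‖z̄‖_{a,p} / r` of a vector whose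
components have the given moduli. -/
def weightedNorm (a p s r : ℝ) (X Y : Fin n → ℝ≥0∞) (Z W : Site j → ℝ≥0∞) : ℝ≥0∞ :=
  (⨆ l, X l) / ENNReal.ofReal s + (∑ l, Y l) / ENNReal.ofReal (r ^ 2) +
    seqNorm a p Z / ENNReal.ofReal r + seqNorm a p W / ENNReal.ofReal r

/-- `(y, z, z̄) ∈ D(r) = B_{r²} × B_r × B_r` (the coordinate `x` is unconstrained). -/
def InBall (a p r : ℝ) (v : Pt j) : Prop :=
  (∑ l, ‖v.y l‖) < r ^ 2 ∧
    seqNorm a p (fun m => ‖v.z m‖ₑ) < ENNReal.ofReal r ∧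
    seqNorm a p (fun m => ‖v.zbar m‖ₑ) < ENNReal.ofReal r

/-- `v ∈ D(s, r) = 𝕋ⁿ_s × D(r)`. -/
def InDomain (a p s r : ℝ) (v : Pt j) : Prop :=
  (∀ l, |(v.x l).im| < s) ∧ InBall a p r v

/-- The function `f` is, on `D(s, r)`, the sum of its absolutely convergent Taylor–Fourier series
with coefficients `c` (such `c` is unique). In `ℂ`, `HasSum` is absolute convergence. -/
def HasExpansion (a p s r : ℝ) (f : Pt j → ℂ) (c : Coeff j) : Prop :=
  ∀ v : Pt j, InDomain a p s r v → HasSum (fun ν => c ν * monomial ν v) (f v)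

/-- `∑_ν |c_ν| e^{|k| s} |y^i| |z^α| |z̄^β|`, with `|k| = |k_1| + … + |k_n|`. -/
def majorant (s : ℝ) (c : Coeff j) (v : Pt j) : ℝ≥0∞ :=
  ∑' ν : Index j, ‖c ν‖ₑ * ENNReal.ofReal (Real.exp (s * ∑ l, |(ν.k l : ℝ)|)) *
    (∏ l, ‖v.y l‖ₑ ^ ν.i l) * (ν.α.prod fun m e => ‖v.z m‖ₑ ^ e) *
    (ν.β.prod fun m e => ‖v.zbar m‖ₑ ^ e)

/-- The majorant norm `‖X‖_{s,r}` of a formal vector field: the supremum over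
`(y, z, z̄) ∈ D(r)` of the weighted norm of the vector of the majorants of the components. -/
def majorantNorm (a p s r : ℝ) (X : VField j) : ℝ≥0∞ :=
  ⨆ (v : Pt j) (_ : InBall a p r v),
    weightedNorm a p s r (fun l => majorant s (X.x l) v) (fun l => majorant s (X.y l) v)
      (fun m => majorant s (X.z m) v) (fun m => majorant s (X.zbar m) v)

/-! Partial derivatives of formal series. -/

def dx (c : Coeff j) (l : Fin n) : Coeff j := fun ν => Complex.I * (ν.k l : ℂ) * c ν

def dy (c : Coeff j) (l : Fin n) : Coeff j := fun ν =>
  ((ν.i l : ℂ) + 1) * c { ν with i := ν.i + Pi.single l 1 }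

def dz (c : Coeff j) (m : Site j) : Coeff j := fun ν =>
  ((ν.α m : ℂ) + 1) * c { ν with α := ν.α + Finsupp.single m 1 }

def dzbar (c : Coeff j) (m : Site j) : Coeff j := fun ν =>
  ((ν.β m : ℂ) + 1) * c { ν with β := ν.β + Finsupp.single m 1 }

/-- The Hamiltonian vector field `X_f = (∂_y f, -∂_x f, -i ∂_z̄ f, i ∂_z f)`. -/
def hamVF (c : Coeff j) : VField j where
  x l := dy c l
  y l := -dx c l
  z m := fun ν => -Complex.I * dzbar c m ν
  zbar m := fun ν => Complex.I * dz c m ν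

/-- The momentum `π(k, α, β) = ∑_l j_l k_l + ∑_m m (α_m - β_m)` of a monomial; the monomial is an
eigenvector, with this eigenvalue up to the factor `i`, of the Poisson bracket with
`∑_l j_l y_l + ∑_m m z_m z̄_m`. -/
def Index.momentum (ν : Index j) : ℤ :=
  (∑ l, j l * ν.k l) + (ν.α.sum fun m e => (m : ℤ) * e) - (ν.β.sum fun m e => (m : ℤ) * e)

/-! Families `f : P → Coeff j` depending on a parameter `ξ ∈ O`. -/

variable {P : Type}

/-- `‖X_f‖_{s,r,O} = sup_{ξ ∈ O} ‖X_{f(ξ)}‖_{s,r}`. -/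
def hamNorm (a p s r : ℝ) (O : Set P) (f : P → Coeff j) : ℝ≥0∞ :=
  ⨆ ξ ∈ O, majorantNorm a p s r (hamVF (f ξ))

/-- The space `H_{s,r}` of M-regular Hamiltonians. -/
def MRegular (a p s r : ℝ) (O : Set P) (f : P → Coeff j) : Prop :=
  hamNorm a p s r O f < ∞

/-- Momentum conservation: all monomials have zero momentum. -/
def ConservesMomentum (O : Set P) (f : P → Coeff j) : Prop :=
  ∀ ξ ∈ O, ∀ ν, f ξ ν ≠ 0 → ν.momentum = 0

/-- The space `H_{s,r}^null`. -/
def MRegularNull (a p s r : ℝ) (O : Set P) (f : P → Coeff j) : Prop :=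
  MRegular a p s r O f ∧ ConservesMomentum O f

/-! ### Töplitz and quasi-Töplitz functions -/

/-- The monomial is `(N, μ)`-low momentum: `∑_m |m| (α_m + β_m) < μ N^L` and `|k| < N^b`. -/
def Index.Low (b L : ℝ) (N : ℕ) (μ : ℝ) (ν : Index j) : Prop :=
  (ν.α.sum fun m e => |((m : ℤ) : ℝ)| * e) + (ν.β.sum fun m e => |((m : ℤ) : ℝ)| * e)
      < μ * (N : ℝ) ^ L ∧
    (∑ l, |(ν.k l : ℝ)|) < (N : ℝ) ^ b

/-- `(N, μ)`-low momentum monomials with `π(k, α, β) + h = 0`. -/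
def Index.LowWith (b L : ℝ) (N : ℕ) (μ : ℝ) (h : ℤ) (ν : Index j) : Prop :=
  ν.Low b L N μ ∧ ν.momentum + h = 0

/-- The space `L_{s,r}(N, μ, h)`. -/
def LowSpace (a p b L s r : ℝ) (N : ℕ) (μ : ℝ) (h : ℤ) (O : Set P) (f : P → Coeff j) : Prop :=
  MRegular a p s r O f ∧ ∀ ξ ∈ O, ∀ ν, f ξ ν ≠ 0 → ν.LowWith b L N μ h

/-- The index of `z_m^σ` times the monomial of index `ν`, where `z^+ = z` and `z^- = z̄`. -/
def Index.addZ (σ : ℤˣ) (m : Site j) (ν : Index j) : Index j :=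
  if σ = 1 then { ν with α := ν.α + Finsupp.single m 1 }
  else { ν with β := ν.β + Finsupp.single m 1 }

/-- The formal series `z_m^σ · g`. -/
def mulZ (σ : ℤˣ) (m : Site j) (g : Coeff j) : Coeff j := fun ν =>
  if σ = 1 then
    if ν.α m = 0 then 0 else g { ν with α := ν.α - Finsupp.single m 1 }
  else
    if ν.β m = 0 then 0 else g { ν with β := ν.β - Finsupp.single m 1 }

/-- The `(N, θ, μ)`-bilinear monomials: products `𝔪 z_m^σ z_n^σ'` with `|m|, |n| > θ N` and `𝔪`
of `(N, μ)`-low momentum with `π(𝔪) = -(σ m + σ' n)`. -/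
def Index.Bilinear (b L : ℝ) (N : ℕ) (θ μ : ℝ) (ν : Index j) : Prop :=
  ∃ (m m' : Site j) (σ σ' : ℤˣ) (ν₀ : Index j),
    θ * N < |((m : ℤ) : ℝ)| ∧ θ * N < |((m' : ℤ) : ℝ)| ∧
    ν₀.LowWith b L N μ ((σ : ℤ) * m + (σ' : ℤ) * m') ∧
    ν = (ν₀.addZ σ' m').addZ σ m

open Classical in
/-- The projection `Π_{N,θ,μ}` on the `(N, θ, μ)`-bilinear monomials. -/
def bilinearProj (b L : ℝ) (N : ℕ) (θ μ : ℝ) (c : Coeff j) : Coeff j := fun ν =>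
  if ν.Bilinear b L N θ μ then c ν else 0

/-- The sign `𝚜(m)` of a (nonzero) site. -/
def siteSign (m : Site j) : ℤˣ := if 0 < (m : ℤ) then 1 else -1

open Classical in
/-- `(N, θ, μ)`-Töplitz functions: the M-regular, momentum preserving
`f = ∑_{|m|,|n| > θN, σ,σ' = ±} f^{σ,σ'}(𝚜(m), σ m + σ' n) z_m^σ z_n^σ'` with
`f^{σ,σ'}(ς, h) ∈ L_{s,r}(N, μ, h)`. In each coefficient only finitely many terms of the sum are
nonzero. -/
def IsToplitz (a p b L s r : ℝ) (N : ℕ) (θ μ : ℝ) (O : Set P) (f : P → Coeff j) : Prop :=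
  MRegularNull a p s r O f ∧
  ∃ g : ℤˣ → ℤˣ → ℤˣ → ℤ → P → Coeff j,
    (∀ σ σ' ς h, LowSpace a p b L s r N μ h O (g σ σ' ς h)) ∧
    ∀ ξ ∈ O, ∀ ν : Index j, f ξ ν =
      ∑ᶠ q : (Site j × Site j) × (ℤˣ × ℤˣ),
        if θ * N < |((q.1.1 : ℤ) : ℝ)| ∧ θ * N < |((q.1.2 : ℤ) : ℝ)| then
          mulZ q.2.1 q.1.1 (mulZ q.2.2 q.1.2
            (g q.2.1 q.2.2 (siteSign q.1.1)
              ((q.2.1 : ℤ) * (q.1.1 : ℤ) + (q.2.2 : ℤ) * (q.1.2 : ℤ)) ξ)) ν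
        else 0

/-- The Töplitz defect `f̂ = N (Π_{N,θ,μ} f - f̃)`. -/
def defect (b L : ℝ) (N : ℕ) (θ μ : ℝ) (f ft : P → Coeff j) : P → Coeff j := fun ξ ν =>
  (N : ℂ) * (bilinearProj b L N θ μ (f ξ) ν - ft ξ ν)

/-- The quasi-Töplitz semi-norm
`sup_{N ≥ N₀} inf_{f̃ Töplitz} max {‖X_f‖, ‖X_f̃‖, ‖X_f̂‖}`. -/
def qtNorm (a p b L s r : ℝ) (N₀ : ℕ) (θ μ : ℝ) (O : Set P) (f : P → Coeff j) : ℝ≥0∞ :=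
  ⨆ (N : ℕ) (_ : N₀ ≤ N), ⨅ (ft : P → Coeff j) (_ : IsToplitz a p b L s r N θ μ O ft),
    max (hamNorm a p s r O f)
      (max (hamNorm a p s r O ft) (hamNorm a p s r O (defect b L N θ μ f ft)))

/-- The space `Q^T_{s,r}(N₀, θ, μ)` of quasi-Töplitz functions. -/
def IsQuasiToplitz (a p b L s r : ℝ) (N₀ : ℕ) (θ μ : ℝ) (O : Set P) (f : P → Coeff j) : Prop :=
  MRegularNull a p s r O f ∧ qtNorm a p b L s r N₀ θ μ O f < ∞

/-! ### Action-angle variables -/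

/-- `κ = max_l |j_l|`. -/
def kappa (j : Fin n → ℤ) : ℕ := Finset.univ.sup fun l => (j l).natAbs

/-- The parameter set `O_ρ = {ξ : ρ/2 ≤ ξ_l ≤ ρ for all l}`. -/
def paramSet (n : ℕ) (ρ : ℝ) : Set (Fin n → ℝ) := {ξ | ∀ l, ρ / 2 ≤ ξ l ∧ ξ l ≤ ρ}

open Classical in
/-- The action-angle map `Φ(x, y, z, z̄; ξ) = (u, ū)`: at the tangential sites
`u_{j_l} = √(ξ_l + y_l) e^{i x_l}` and `ū_{j_l} = √(ξ_l + y_l) e^{-i x_l}` (principal square root),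
at the normal sites `u_m = z_m` and `ū_m = z̄_m`. -/
def actionAngle (j : Fin n → ℤ) (ξ : Fin n → ℝ) (v : Pt j) : Pt noSites where
  x := Fin.elim0
  y := Fin.elim0
  z m :=
    if h : ∃ l, j l = (m : ℤ) then
      ((ξ h.choose : ℂ) + v.y h.choose) ^ (1 / 2 : ℂ) * Complex.exp (Complex.I * v.x h.choose)
    else v.z ⟨m, fun l hl => h ⟨l, hl⟩⟩
  zbar m :=
    if h : ∃ l, j l = (m : ℤ) then
      ((ξ h.choose : ℂ) + v.y h.choose) ^ (1 / 2 : ℂ) * Complex.exp (-(Complex.I * v.x h.choose))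
    else v.zbar ⟨m, fun l hl => h ⟨l, hl⟩⟩

open Classical in
/-- The degree `|α⁽²⁾ + β⁽²⁾|` of a monomial `u^α ū^β` in the normal variables
`u_m, ū_m`, `m ∉ {j_1, …, j_n}`. -/
def normalDegree (j : Fin n → ℤ) (ν : Index noSites) : ℕ :=
  (ν.α.sum fun m e => if ∃ l, j l = (m : ℤ) then 0 else e) +
    (ν.β.sum fun m e => if ∃ l, j l = (m : ℤ) then 0 else e)

/-- `F = ∑_{|α⁽²⁾ + β⁽²⁾| ≥ d} F_{α,β} u^α ū^β`. -/
def NormalDegreeGE (j : Fin n → ℤ) (d : ℕ) (F : Coeff noSites) : Prop :=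
  ∀ ν, F ν ≠ 0 → d ≤ normalDegree j ν

end basic

end QuasiToplitz

end

noncomputable section

namespace QuasiToplitz

theorem hasSum_of_eq {ι E : Type*} [AddCommMonoid E] [TopologicalSpace E] {f g : ι → E} {a : E}
    (h : HasSum f a) (hfg : ∀ i, f i = g i) : HasSum g a :=
  (funext hfg : f = g) ▸ h

section binomial

/-- The coefficients of the Taylor expansion of `(x + y) ^ (m / 2)` in powers of `y`. -/
def halfPowCoeff (m : ℕ) (x : ℝ) (i : ℕ) : ℝ :=
  Ring.choose ((m : ℝ) / 2) i * x ^ ((m : ℝ) / 2 - i)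

theorem succ_mul_choose_succ (q : ℝ) (i : ℕ) :
    ((i : ℝ) + 1) * Ring.choose q (i + 1) = (q - i) * Ring.choose q i := by
  have h : ((i.factorial : ℕ) : ℝ) ≠ 0 := by exact_mod_cast i.factorial_ne_zero
  simp only [Ring.choose_eq_smul, descPochhammer_succ_right, Polynomial.smeval_mul,
    Polynomial.smeval_sub, Polynomial.smeval_X, Polynomial.smeval_natCast, smul_eq_mul,
    Nat.factorial_succ]
  push_cast
  field_simp
  simp

theorem multichoose_eq_eval (q : ℝ) (i : ℕ) :
    Ring.multichoose q i = (i.factorial : ℝ)⁻¹ * (ascPochhammer ℝ i).eval q := by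
  have h : ((i.factorial : ℕ) : ℝ) ≠ 0 := by exact_mod_cast i.factorial_ne_zero
  have := Ring.factorial_nsmul_multichoose_eq_ascPochhammer q i
  rw [Polynomial.ascPochhammer_smeval_eq_eval, nsmul_eq_mul] at this
  rw [← this]
  field_simp

theorem succ_mul_multichoose_succ (q : ℝ) (i : ℕ) :
    ((i : ℝ) + 1) * Ring.multichoose q (i + 1) = (q + i) * Ring.multichoose q i := by
  have h : ((i.factorial : ℕ) : ℝ) ≠ 0 := by exact_mod_cast i.factorial_ne_zero
  simp only [multichoose_eq_eval, ascPochhammer_succ_eval, Nat.factorial_succ]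
  push_cast
  field_simp

theorem succ_mul_multichoose_succ' (q : ℝ) (i : ℕ) :
    ((i : ℝ) + 1) * Ring.multichoose q (i + 1) = q * Ring.multichoose (q + 1) i := by
  have h : ((i.factorial : ℕ) : ℝ) ≠ 0 := by exact_mod_cast i.factorial_ne_zero
  simp only [multichoose_eq_eval, ascPochhammer_succ_left, Nat.factorial_succ]
  simp
  field_simp

theorem abs_choose_le_multichoose {q : ℝ} (hq : 0 ≤ q) (i : ℕ) :
    |Ring.choose q i| ≤ Ring.multichoose q i := by
  induction i with
  | zero => simp
  | succ i ih =>
    have h := congrArg abs (succ_mul_choose_succ q i)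
    rw [abs_mul, abs_mul, abs_of_pos (by positivity : (0 : ℝ) < (i : ℝ) + 1)] at h
    have h' := succ_mul_multichoose_succ q i
    have hb : |q - i| ≤ q + i := by
      rw [abs_le]; constructor <;> linarith [(Nat.cast_nonneg i : (0 : ℝ) ≤ i)]
    have : ((i : ℝ) + 1) * |Ring.choose q (i + 1)| ≤ ((i : ℝ) + 1) * Ring.multichoose q (i + 1) := by
      rw [h, h']
      exact mul_le_mul hb ih (abs_nonneg _) (by positivity)
    exact le_of_mul_le_mul_left this (by positivity)

theorem succ_mul_abs_choose_succ_le {q : ℝ} (hq : 0 ≤ q) (i : ℕ) :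
    ((i : ℝ) + 1) * |Ring.choose q (i + 1)| ≤ q * Ring.multichoose (q + 1) i := by
  rw [← succ_mul_multichoose_succ']
  exact mul_le_mul_of_nonneg_left (abs_choose_le_multichoose hq _) (by positivity)

theorem hasSum_multichoose (q : ℝ) {t : ℝ} (ht : 0 ≤ t) (ht1 : t < 1) :
    HasSum (fun i => Ring.multichoose q i * t ^ i) ((1 - t) ^ (-q)) := by
  have h := (Complex.one_div_one_sub_cpow_hasFPowerSeriesOnBall_zero (q : ℂ)).hasSum
    (y := (t : ℂ)) (by simp [abs_of_nonneg ht, enorm_eq_nnnorm, ← NNReal.coe_lt_coe, ht1])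
  simp only [FormalMultilinearSeries.ofScalars_apply_eq, zero_add, smul_eq_mul] at h
  have e : ((1 : ℂ) / (1 - t) ^ (q : ℂ)) = (((1 - t) ^ (-q) : ℝ) : ℂ) := by
    rw [Real.rpow_neg (by linarith), Complex.ofReal_inv, Complex.ofReal_cpow (by linarith)]
    simp
  rw [e] at h
  rw [← Complex.hasSum_ofReal]
  refine hasSum_of_eq h fun i => ?_
  have hc : (Ring.choose ((q : ℂ) + i - 1) i) = ((Ring.multichoose q i : ℝ) : ℂ) := by
    rw [Ring.multichoose_eq, Complex.ofReal_choose]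
    push_cast
    rfl
  rw [hc]
  push_cast
  rfl

theorem hasSum_halfPowCoeff (m : ℕ) {x : ℝ} (hx : 0 < x) {y : ℂ} (hy : ‖y‖ < x) :
    HasSum (fun i => (halfPowCoeff m x i : ℂ) * y ^ i) ((((x : ℂ) + y) ^ (1 / 2 : ℂ)) ^ m) := by
  have hx' : (x : ℂ) ≠ 0 := by exact_mod_cast hx.ne'
  have hn : ‖y / x‖ < 1 := by
    rw [norm_div, Complex.norm_real, Real.norm_of_nonneg hx.le, div_lt_one hx]; exact hy
  have h := (Complex.one_add_cpow_hasFPowerSeriesOnBall_zero (a := (m : ℂ) / 2)).hasSum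
    (y := y / x) (by
      rw [Metric.mem_eball, edist_zero_right, enorm_eq_nnnorm]
      exact_mod_cast hn)
  simp only [binomialSeries, FormalMultilinearSeries.ofScalars_apply_eq, zero_add,
    smul_eq_mul] at h
  have h1 : (1 : ℂ) + y / x ≠ 0 := by
    intro h0
    have : y / x = -1 := by linear_combination h0
    rw [this] at hn
    simp at hn
  have e : (((x : ℂ) + y) ^ (1 / 2 : ℂ)) ^ m
      = (x : ℂ) ^ ((m : ℂ) / 2) * (1 + y / x) ^ ((m : ℂ) / 2) := by
    have hxy : (x : ℂ) + y = x * (1 + y / x) := by field_simp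
    rw [← Complex.cpow_nat_mul, hxy, Complex.cpow_def_of_ne_zero (mul_ne_zero hx' h1),
      Complex.cpow_def_of_ne_zero hx', Complex.cpow_def_of_ne_zero h1,
      Complex.log_ofReal_mul hx h1, ← Complex.exp_add, Complex.ofReal_log hx.le]
    congr 1
    ring
  rw [e]
  refine hasSum_of_eq (h.mul_left ((x : ℂ) ^ ((m : ℂ) / 2))) fun i => ?_
  rw [halfPowCoeff, Real.rpow_sub hx, Real.rpow_natCast, Complex.ofReal_mul, Complex.ofReal_div,
    Complex.ofReal_cpow hx.le, Complex.ofReal_choose]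
  push_cast
  rw [div_pow]
  ring

theorem tsum_ofReal_le {f : ℕ → ℝ} {g : ℕ → ℝ} {A : ℝ} (hf : ∀ i, 0 ≤ f i) (hfg : ∀ i, f i ≤ g i)
    (hg : HasSum g A) : ∑' i, ENNReal.ofReal (f i) ≤ ENNReal.ofReal A := by
  rw [← ENNReal.ofReal_tsum_of_nonneg hf (Summable.of_nonneg_of_le hf hfg hg.summable)]
  exact ENNReal.ofReal_le_ofReal
    (((Summable.of_nonneg_of_le hf hfg hg.summable).tsum_le_tsum hfg hg.summable).trans hg.tsum_eq.le)

/-- The majorant of `(x + y) ^ (m / 2)` is at most `V ^ m`, if `V² = 8 ρ / 7`. -/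
theorem tsum_halfPowCoeff_le (m : ℕ) {x ρ V : ℝ} {y : ℂ} (hx : 0 < x) (hxρ : x ≤ ρ)
    (hy : ‖y‖ ≤ x / 8) (hV : 0 ≤ V) (hV2 : V ^ 2 = 8 * ρ / 7) :
    ∑' i, ‖(halfPowCoeff m x i : ℂ)‖ₑ * ‖y‖ₑ ^ i ≤ ENNReal.ofReal V ^ m := by
  have hq : (0 : ℝ) ≤ (m : ℝ) / 2 := by positivity
  have ht0 : 0 ≤ ‖y‖ / x := by positivity
  have ht : ‖y‖ / x ≤ 1 / 8 := by rw [div_le_iff₀ hx]; linarith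
  have hs := (hasSum_multichoose ((m : ℝ) / 2) ht0 (by linarith)).mul_left (x ^ ((m : ℝ) / 2))
  have e : ∀ i, ‖(halfPowCoeff m x i : ℂ)‖ₑ * ‖y‖ₑ ^ i
      = ENNReal.ofReal (|halfPowCoeff m x i| * ‖y‖ ^ i) := by
    intro i
    rw [ENNReal.ofReal_mul (abs_nonneg _), ENNReal.ofReal_pow (norm_nonneg _), ofReal_norm,
      ← Real.norm_eq_abs, ← Complex.norm_real, ofReal_norm]
  simp_rw [e]
  refine (tsum_ofReal_le (fun i => by positivity) (fun i => ?_) hs).trans ?_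
  · rw [halfPowCoeff, abs_mul, abs_of_pos (Real.rpow_pos_of_pos hx _), Real.rpow_sub hx,
      Real.rpow_natCast, div_pow]
    calc _ = x ^ ((m : ℝ) / 2) * (|Ring.choose ((m : ℝ) / 2) i| * (‖y‖ ^ i / x ^ i)) := by ring
      _ ≤ _ := by
        gcongr
        exact abs_choose_le_multichoose hq i
  · rw [← ENNReal.ofReal_pow hV]
    apply ENNReal.ofReal_le_ofReal
    have h1 : V ^ m = (8 * ρ / 7) ^ ((m : ℝ) / 2) := by
      rw [← hV2, ← Real.rpow_natCast V 2, ← Real.rpow_mul hV, ← Real.rpow_natCast]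
      congr 1; push_cast; ring
    rw [h1, Real.rpow_neg (by linarith), ← Real.inv_rpow (by linarith),
      ← Real.mul_rpow hx.le (by rw [inv_nonneg]; linarith)]
    apply Real.rpow_le_rpow (mul_nonneg hx.le (by rw [inv_nonneg]; linarith)) _ hq
    have : (1 - ‖y‖ / x)⁻¹ ≤ 8 / 7 := by
      rw [inv_le_comm₀ (by linarith) (by norm_num)]; linarith
    calc _ ≤ ρ * (8 / 7) := mul_le_mul hxρ this (by rw [inv_nonneg]; linarith) (by linarith)
      _ = _ := by ring

/-- The majorant of the derivative of `(x + y) ^ (m / 2)`. -/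
theorem tsum_succ_mul_halfPowCoeff_le (m : ℕ) {x ρ V : ℝ} {y : ℂ} (hρ : 0 < ρ) (hρx : ρ / 2 ≤ x)
    (hxρ : x ≤ ρ) (hy : ‖y‖ ≤ x / 8) (hV : 0 ≤ V) (hV2 : V ^ 2 = 8 * ρ / 7) :
    ∑' i : ℕ, ((i : ℝ≥0∞) + 1) * ‖(halfPowCoeff m x (i + 1) : ℂ)‖ₑ * ‖y‖ₑ ^ i
      ≤ ENNReal.ofReal (2 / ρ) * (m * ENNReal.ofReal V ^ m) := by
  have hx : 0 < x := by linarith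
  have hq : (0 : ℝ) ≤ (m : ℝ) / 2 := by positivity
  have ht0 : 0 ≤ ‖y‖ / x := by positivity
  have ht : ‖y‖ / x ≤ 1 / 8 := by rw [div_le_iff₀ hx]; linarith
  have hs := (hasSum_multichoose ((m : ℝ) / 2 + 1) ht0 (by linarith)).mul_left
    (((m : ℝ) / 2) * (x ^ ((m : ℝ) / 2) / x))
  have e : ∀ i : ℕ, ((i : ℝ≥0∞) + 1) * ‖(halfPowCoeff m x (i + 1) : ℂ)‖ₑ * ‖y‖ₑ ^ i
      = ENNReal.ofReal (((i : ℝ) + 1) * |halfPowCoeff m x (i + 1)| * ‖y‖ ^ i) := by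
    intro i
    rw [ENNReal.ofReal_mul (by positivity), ENNReal.ofReal_mul (by positivity),
      ENNReal.ofReal_pow (norm_nonneg _), ofReal_norm,
      ← Real.norm_eq_abs, ← Complex.norm_real, ofReal_norm,
      ENNReal.ofReal_add (by positivity) zero_le_one]
    simp
  simp_rw [e]
  refine (tsum_ofReal_le (fun i => by positivity) (fun i => ?_) hs).trans ?_
  · rw [halfPowCoeff, abs_mul, abs_of_pos (Real.rpow_pos_of_pos hx _), Real.rpow_sub hx,
      Real.rpow_natCast, div_pow]
    calc _ = (x ^ ((m : ℝ) / 2) / x) *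
          ((((i : ℝ) + 1) * |Ring.choose ((m : ℝ) / 2) (i + 1)|) * (‖y‖ ^ i / x ^ i)) := by
            rw [pow_succ]; field_simp
      _ ≤ (x ^ ((m : ℝ) / 2) / x) *
          (((m : ℝ) / 2 * Ring.multichoose ((m : ℝ) / 2 + 1) i) * (‖y‖ ^ i / x ^ i)) := by
        refine mul_le_mul_of_nonneg_left (mul_le_mul_of_nonneg_right
          (succ_mul_abs_choose_succ_le hq i) (by positivity)) (by positivity)
      _ = _ := by ring
  · have h0 : (m : ℝ≥0∞) = ENNReal.ofReal m := by simp
    rw [← ENNReal.ofReal_pow hV, h0, ← ENNReal.ofReal_mul (by positivity),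
      ← ENNReal.ofReal_mul (by positivity)]
    apply ENNReal.ofReal_le_ofReal
    have h1 : V ^ m = (8 * ρ / 7) ^ ((m : ℝ) / 2) := by
      rw [← hV2, ← Real.rpow_natCast V 2, ← Real.rpow_mul hV, ← Real.rpow_natCast]
      congr 1; push_cast; ring
    have h2 : (1 - ‖y‖ / x)⁻¹ ≤ 8 / 7 := by
      rw [inv_le_comm₀ (by linarith) (by norm_num)]; linarith
    have h3 : 0 ≤ (1 - ‖y‖ / x)⁻¹ := by rw [inv_nonneg]; linarith
    have h4 : x ^ ((m : ℝ) / 2) * ((1 - ‖y‖ / x)⁻¹) ^ ((m : ℝ) / 2) ≤ V ^ m := by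
      rw [h1, ← Real.mul_rpow hx.le h3]
      apply Real.rpow_le_rpow (mul_nonneg hx.le h3) _ hq
      calc _ ≤ ρ * (8 / 7) := by gcongr
        _ = _ := by ring
    have h5 : x⁻¹ ≤ 2 / ρ := by
      rw [inv_le_comm₀ hx (by positivity), inv_div]; exact hρx
    rw [Real.rpow_neg (by linarith), ← Real.inv_rpow (by linarith),
      Real.rpow_add_one (by have : (0 : ℝ) < (1 - ‖y‖ / x)⁻¹ := by
                              rw [inv_pos]; linarith
                            exact this.ne')]
    calc _ = (x⁻¹ * ((m : ℝ) / 2 * (1 - ‖y‖ / x)⁻¹)) *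
            (x ^ ((m : ℝ) / 2) * ((1 - ‖y‖ / x)⁻¹) ^ ((m : ℝ) / 2)) := by ring
      _ ≤ ((2 / ρ) * ((m : ℝ) / 2 * (8 / 7))) * V ^ m := by gcongr
      _ ≤ ((2 / ρ) * m) * V ^ m := by
        have hm : (m : ℝ) / 2 * (8 / 7) ≤ m := by linarith [(Nat.cast_nonneg m : (0 : ℝ) ≤ m)]
        gcongr
      _ = _ := by ring

end binomial

section products

theorem tsum_pi_prod : ∀ {n : ℕ} (f : Fin n → ℕ → ℝ≥0∞),
    ∑' i : Fin n → ℕ, ∏ l, f l (i l) = ∏ l, ∑' k, f l k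
  | 0, f => by simp
  | n + 1, f => by
    rw [← (Fin.consEquiv fun _ : Fin (n + 1) => ℕ).tsum_eq, ENNReal.tsum_prod',
      Fin.prod_univ_succ, ← tsum_pi_prod fun l : Fin n => f l.succ, ← ENNReal.tsum_mul_right]
    refine tsum_congr fun k => ?_
    rw [← ENNReal.tsum_mul_left]
    refine tsum_congr fun i => ?_
    simp [Fin.consEquiv, Fin.prod_univ_succ]

theorem HasSum.mul_norm_complex {ι : Type*} {f : ℕ → ℂ} {g : ι → ℂ} {a b : ℂ} (hf : HasSum f a)
    (hg : Summable fun i => ‖g i‖) (hb : HasSum g b) :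
    Summable (fun x : ℕ × ι => ‖f x.1 * g x.2‖) ∧
      HasSum (fun x : ℕ × ι => f x.1 * g x.2) (a * b) :=
  have hs := Summable.mul_norm (f := f) (g := g) hf.summable.norm hg
  ⟨hs, hf.mul hb (Summable.of_norm hs)⟩

theorem hasSum_pi_prod_aux {n : ℕ} (f : Fin n → ℕ → ℂ) (A : Fin n → ℂ)
    (h : ∀ l, HasSum (f l) (A l)) :
      Summable (fun i : Fin n → ℕ => ‖∏ l, f l (i l)‖) ∧
      HasSum (fun i : Fin n → ℕ => ∏ l, f l (i l)) (∏ l, A l) := by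
  induction n with
  | zero =>
    have h1 := hasSum_unique (fun i : Fin 0 → ℕ => ∏ l, f l (i l))
    refine ⟨h1.summable.norm, ?_⟩
    simpa only [Finset.univ_eq_empty, Finset.prod_empty] using h1
  | succ n ih =>
    obtain ⟨h1, h2⟩ := ih (fun l : Fin n => f l.succ) (fun l => A l.succ) fun l => h l.succ
    generalize hG : (fun i : Fin n → ℕ => ∏ l, f l.succ (i l)) = G at h2
    have hG' : ∀ i : Fin n → ℕ, ∏ l, f l.succ (i l) = G i := fun i => congrFun hG i
    simp only [hG'] at h1
    obtain ⟨hs, hh⟩ := HasSum.mul_norm_complex (h 0) h1 h2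
    constructor
    · rw [← (Fin.consEquiv fun _ : Fin (n + 1) => ℕ).summable_iff]
      refine (summable_congr fun x => ?_).mp hs
      simp [Fin.consEquiv, Fin.prod_univ_succ, ← hG']
    · rw [← (Fin.consEquiv fun _ : Fin (n + 1) => ℕ).hasSum_iff, Fin.prod_univ_succ]
      refine hasSum_of_eq hh fun x => ?_
      simp [Fin.consEquiv, Fin.prod_univ_succ, ← hG']

theorem hasSum_pi_prod {n : ℕ} {f : Fin n → ℕ → ℂ} {A : Fin n → ℂ}
    (h : ∀ l, HasSum (f l) (A l)) :
    HasSum (fun i : Fin n → ℕ => ∏ l, f l (i l)) (∏ l, A l) :=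
  (hasSum_pi_prod_aux f A h).2

end products

section sites

variable {n : ℕ} (j : Fin n → ℤ)

/-- The site of a tangential variable among all the sites. -/
def tanSite (l : Fin n) : Site noSites := ⟨j l, fun l => l.elim0⟩

/-- The site of a normal variable among all the sites. -/
def norSite (m : Site j) : Site noSites := ⟨(m : ℤ), fun l => l.elim0⟩

@[simp] theorem coe_tanSite (l : Fin n) : ((tanSite j l : Site noSites) : ℤ) = j l := rfl

@[simp] theorem coe_norSite (m : Site j) : ((norSite j m : Site noSites) : ℤ) = m := rfl

theorem norSite_injective : Function.Injective (norSite j) := fun _ _ h =>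
  Subtype.ext (congrArg (fun s : Site noSites => (s : ℤ)) h)

variable {j}

@[simp] theorem norSite_inj {m m' : Site j} : norSite j m = norSite j m' ↔ m = m' :=
  (norSite_injective j).eq_iff

theorem tanSite_injective (hj : Function.Injective j) : Function.Injective (tanSite j) :=
  fun _ _ h => hj (congrArg (fun s : Site noSites => (s : ℤ)) h)

@[simp] theorem tanSite_ne_norSite (l : Fin n) (m : Site j) : tanSite j l ≠ norSite j m :=
  fun h => m.2 l (congrArg (fun s : Site noSites => (s : ℤ)) h)

@[simp] theorem norSite_ne_tanSite (l : Fin n) (m : Site j) : norSite j m ≠ tanSite j l :=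
  (tanSite_ne_norSite l m).symm

theorem site_cases (s : Site noSites) : (∃ l, s = tanSite j l) ∨ ∃ m, s = norSite j m := by
  by_cases h : ∃ l, j l = (s : ℤ)
  · obtain ⟨l, hl⟩ := h
    exact Or.inl ⟨l, Subtype.ext hl.symm⟩
  · push Not at h
    exact Or.inr ⟨⟨s, h⟩, rfl⟩

/-- A site is either tangential or normal. -/
def siteEquiv (hj : Function.Injective j) : Fin n ⊕ Site j ≃ Site noSites :=
  Equiv.ofBijective (Sum.elim (tanSite j) (norSite j)) <| by
    constructor
    · rintro (l | m) (l' | m') h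
      · exact congrArg Sum.inl (tanSite_injective hj h)
      · exact absurd h (tanSite_ne_norSite l m')
      · exact absurd h (norSite_ne_tanSite l' m)
      · exact congrArg Sum.inr (norSite_injective j h)
    · intro s
      rcases site_cases (j := j) s with ⟨l, rfl⟩ | ⟨m, rfl⟩
      · exact ⟨Sum.inl l, rfl⟩
      · exact ⟨Sum.inr m, rfl⟩

theorem tsum_site (hj : Function.Injective j) (f : Site noSites → ℝ≥0∞) :
    ∑' s, f s = (∑ l, f (tanSite j l)) + ∑' m, f (norSite j m) := by
  rw [← (siteEquiv hj).tsum_eq, Summable.tsum_sum ENNReal.summable ENNReal.summable,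
    ← tsum_fintype (L := .unconditional _)]
  rfl

variable (j) in
/-- The restriction of an exponent to the normal sites. -/
def restrict (A : Site noSites →₀ ℕ) : Site j →₀ ℕ :=
  A.comapDomain (norSite j) (norSite_injective j).injOn

@[simp] theorem restrict_apply (A : Site noSites →₀ ℕ) (m : Site j) :
    restrict j A m = A (norSite j m) := rfl

@[simp] theorem restrict_add (A B : Site noSites →₀ ℕ) :
    restrict j (A + B) = restrict j A + restrict j B := by ext; simp

@[simp] theorem restrict_single_norSite (m : Site j) (e : ℕ) :
    restrict j (Finsupp.single (norSite j m) e) = Finsupp.single m e := by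
  ext m'
  simp [Finsupp.single_apply]

@[simp] theorem restrict_single_tanSite (l : Fin n) (e : ℕ) :
    restrict j (Finsupp.single (tanSite j l) e) = 0 := by
  ext m'
  simp

@[to_additive]
theorem prod_site {N : Type*} [CommMonoid N] (hj : Function.Injective j) (A : Site noSites →₀ ℕ)
    (f : Site noSites → ℕ → N) (hf : ∀ s, f s 0 = 1) :
    A.prod f = (∏ l, f (tanSite j l) (A (tanSite j l))) *
      (restrict j A).prod fun m e => f (norSite j m) e := by
  classical
  rw [Finsupp.prod_of_support_subset A (s := Finset.univ.image (tanSite j) ∪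
      (restrict j A).support.image (norSite j)) _ f fun s _ => hf s, Finset.prod_union,
    Finset.prod_image fun _ _ _ _ h => tanSite_injective hj h,
    Finset.prod_image fun _ _ _ _ h => norSite_injective j h]
  · rfl
  · rw [Finset.disjoint_left]
    simp
  · intro s hs
    rcases site_cases (j := j) s with ⟨l, rfl⟩ | ⟨m, rfl⟩
    · simp
    · simpa using hs

variable (j) in
/-- The index of the monomials of the pull-back of `u^α ū^β`, given the exponent `i` of `y`. -/
def res (M : Index noSites) (i : Fin n → ℕ) : Index j where
  k l := (M.α (tanSite j l) : ℤ) - M.β (tanSite j l)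
  i := i
  α := restrict j M.α
  β := restrict j M.β

@[simp] theorem res_i (M : Index noSites) (i : Fin n → ℕ) : (res j M i).i = i := rfl
@[simp] theorem res_k (M : Index noSites) (i : Fin n → ℕ) (l : Fin n) :
    (res j M i).k l = (M.α (tanSite j l) : ℤ) - M.β (tanSite j l) := rfl
@[simp] theorem res_α (M : Index noSites) (i : Fin n → ℕ) :
    (res j M i).α = restrict j M.α := rfl
@[simp] theorem res_β (M : Index noSites) (i : Fin n → ℕ) :
    (res j M i).β = restrict j M.β := rfl

theorem res_injective (M : Index noSites) : Function.Injective (res j M) := fun _ _ h =>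
  congrArg Index.i h

theorem momentum_res (hj : Function.Injective j) (M : Index noSites) (i : Fin n → ℕ) :
    (res j M i).momentum = M.momentum := by
  simp only [Index.momentum, res_k, res_α, res_β, Finset.univ_eq_empty, Finset.sum_empty,
    sum_site hj M.α (fun m e => (m : ℤ) * e) (by simp),
    sum_site hj M.β (fun m e => (m : ℤ) * e) (by simp), coe_tanSite, coe_norSite, mul_sub,
    Finset.sum_sub_distrib]
  ring

variable (j) in
/-- The degree in `u_{j_l}, ū_{j_l}`. -/
def tanDeg (M : Index noSites) (l : Fin n) : ℕ := M.α (tanSite j l) + M.β (tanSite j l)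

theorem normalDegree_eq (hj : Function.Injective j) (M : Index noSites) :
    normalDegree j M = (restrict j M.α).degree + (restrict j M.β).degree := by
  have h : ∀ A : Site noSites →₀ ℕ, (A.sum fun m e => if ∃ l, j l = (m : ℤ) then 0 else e)
      = (restrict j A).degree := by
    intro A
    rw [sum_site hj A _ (by simp)]
    have : ∀ m : Site j, ¬ ∃ l, j l = (m : ℤ) := fun ⟨m, hm⟩ ⟨l, hl⟩ => hm l hl
    simp [this, Finsupp.degree_apply, Finsupp.sum]
  rw [← h, ← h, normalDegree]

open Classical in
variable (j) in
/-- The point of `u`-space with value `U` at the tangential sites and `t z`, `t z̄` at the normal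
sites. -/
def liftPt (U t : ℝ) (v : Pt j) : Pt noSites where
  x := Fin.elim0
  y := Fin.elim0
  z s := if h : ∃ l, j l = (s : ℤ) then U else t * v.z ⟨s, fun l hl => h ⟨l, hl⟩⟩
  zbar s := if h : ∃ l, j l = (s : ℤ) then U else t * v.zbar ⟨s, fun l hl => h ⟨l, hl⟩⟩

variable (U t : ℝ) (v : Pt j)

@[simp] theorem liftPt_z_tanSite (l : Fin n) : (liftPt j U t v).z (tanSite j l) = U := by
  have : ∃ l', j l' = ((tanSite j l : Site noSites) : ℤ) := ⟨l, rfl⟩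
  simp [liftPt]

@[simp] theorem liftPt_zbar_tanSite (l : Fin n) : (liftPt j U t v).zbar (tanSite j l) = U := by
  simp [liftPt]

theorem not_exists_eq_normal (m : Site j) : ¬ ∃ l, j l = (m : ℤ) := fun ⟨l, hl⟩ => m.2 l hl

@[simp] theorem liftPt_z_norSite (m : Site j) : (liftPt j U t v).z (norSite j m) = t * v.z m := by
  have := not_exists_eq_normal m
  simp [liftPt, this]

@[simp] theorem liftPt_zbar_norSite (m : Site j) :
    (liftPt j U t v).zbar (norSite j m) = t * v.zbar m := by
  have := not_exists_eq_normal m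
  simp [liftPt, this]

end sites

section weights

variable {n : ℕ} {j : Fin n → ℤ}

/-- The modulus `e^{|k| s} |y^i| |z^α| |z̄^β|` that the majorants are built from. -/
def weight (s : ℝ) (v : Pt j) (ν : Index j) : ℝ≥0∞ :=
  ENNReal.ofReal (Real.exp (s * ∑ l, |(ν.k l : ℝ)|)) *
    (∏ l, ‖v.y l‖ₑ ^ ν.i l) * (ν.α.prod fun m e => ‖v.z m‖ₑ ^ e) *
    (ν.β.prod fun m e => ‖v.zbar m‖ₑ ^ e)

theorem majorant_eq (s : ℝ) (c : Coeff j) (v : Pt j) :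
    majorant s c v = ∑' ν, ‖c ν‖ₑ * weight s v ν := by
  simp only [majorant, weight, mul_assoc]

/-- The part of the weight of `u^α ū^β` due to the normal variables. -/
def norWeight (v : Pt j) (M : Index noSites) : ℝ≥0∞ :=
  ((restrict j M.α).prod fun m e => ‖v.z m‖ₑ ^ e) *
    ((restrict j M.β).prod fun m e => ‖v.zbar m‖ₑ ^ e)

theorem weight_res_le {s : ℝ} (hs : 0 ≤ s) (v : Pt j) (M : Index noSites) (i : Fin n → ℕ) :
    weight s v (res j M i) ≤
      (∏ l, ‖v.y l‖ₑ ^ i l) * ((∏ l, ENNReal.ofReal (Real.exp s) ^ tanDeg j M l) *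
        norWeight v M) := by
  have h : ENNReal.ofReal (Real.exp (s * ∑ l, |((res j M i).k l : ℝ)|))
      ≤ ∏ l, ENNReal.ofReal (Real.exp s) ^ tanDeg j M l := by
    rw [Finset.prod_pow_eq_pow_sum, ← ENNReal.ofReal_pow (Real.exp_pos _).le, ← Real.exp_nat_mul]
    apply ENNReal.ofReal_le_ofReal
    apply Real.exp_le_exp.2
    rw [mul_comm]
    push_cast
    gcongr with l
    rw [res_k, tanDeg, abs_le]
    push_cast
    constructor <;> linarith [(Nat.cast_nonneg (M.α (tanSite j l)) : (0 : ℝ) ≤ _),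
      (Nat.cast_nonneg (M.β (tanSite j l)) : (0 : ℝ) ≤ _)]
  calc _ = ENNReal.ofReal (Real.exp (s * ∑ l, |((res j M i).k l : ℝ)|)) *
        ((∏ l, ‖v.y l‖ₑ ^ i l) * norWeight v M) := by
        simp only [weight, norWeight, res_i, res_α, res_β]; ring
    _ ≤ (∏ l, ENNReal.ofReal (Real.exp s) ^ tanDeg j M l) *
        ((∏ l, ‖v.y l‖ₑ ^ i l) * norWeight v M) := by gcongr
    _ = _ := by ring

theorem prod_const_mul_pow {σ : Type*} (A : σ →₀ ℕ) (c : ℝ≥0∞) (f : σ → ℝ≥0∞) :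
    (A.prod fun m e => (c * f m) ^ e) = c ^ A.degree * A.prod fun m e => f m ^ e := by
  simp only [Finsupp.prod, mul_pow, Finset.prod_mul_distrib, Finset.prod_pow_eq_pow_sum,
    Finsupp.degree_apply]

theorem weight_liftPt (hj : Function.Injective j) (s : ℝ) {U t : ℝ} (hU : 0 ≤ U) (ht : 0 ≤ t)
    (v : Pt j) (M : Index noSites) :
    weight s (liftPt j U t v) M = (∏ l, ENNReal.ofReal U ^ tanDeg j M l) *
      (ENNReal.ofReal t ^ normalDegree j M * norWeight v M) := by
  have hU' : ‖(U : ℂ)‖ₑ = ENNReal.ofReal U := by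
    rw [← ofReal_norm, Complex.norm_real, Real.norm_of_nonneg hU]
  have ht' : ‖(t : ℂ)‖ₑ = ENNReal.ofReal t := by
    rw [← ofReal_norm, Complex.norm_real, Real.norm_of_nonneg ht]
  rw [normalDegree_eq hj]
  simp only [weight, Finset.univ_eq_empty, Finset.sum_empty, mul_zero, Real.exp_zero,
    ENNReal.ofReal_one, one_mul, Finset.prod_empty, norWeight, tanDeg, pow_add,
    Finset.prod_mul_distrib,
    prod_site hj M.α (fun m e => ‖(liftPt j U t v).z m‖ₑ ^ e) (by simp),
    prod_site hj M.β (fun m e => ‖(liftPt j U t v).zbar m‖ₑ ^ e) (by simp),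
    liftPt_z_tanSite, liftPt_zbar_tanSite, liftPt_z_norSite, liftPt_zbar_norSite, enorm_mul,
    prod_const_mul_pow, hU', ht']
  ring

end weights

section substitution

variable {n : ℕ} (j : Fin n → ℤ)

open Classical in
/-- The formal series `∑_{M, i} w(M, i) e^{i k(M)·x} y^i z^{α(M)} z̄^{β(M)}`. -/
def collect (w : Index noSites → (Fin n → ℕ) → ℂ) : Coeff j := fun ν =>
  ∑' M, if res j M ν.i = ν then w M ν.i else 0

/-- The Taylor coefficients of `∏_l (ξ_l + y_l)^{(α_l + β_l) / 2}`. -/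
def actionCoeff (ξ : Fin n → ℝ) (M : Index noSites) (i : Fin n → ℕ) : ℂ :=
  ∏ l, (halfPowCoeff (tanDeg j M l) (ξ l) (i l) : ℂ)

/-- The Taylor–Fourier coefficients of the composition with the action-angle map. -/
def subst (ξ : Fin n → ℝ) (F : Coeff noSites) : Coeff j :=
  collect j fun M i => F M * actionCoeff j ξ M i

variable {j}

theorem tsum_res_eq (φ : Index noSites → (Fin n → ℕ) → ℝ≥0∞) (ψ : Index j → ℝ≥0∞)
    [∀ M (ν : Index j), Decidable (res j M ν.i = ν)] :
    ∑' ν : Index j, ∑' M, (if res j M ν.i = ν then φ M ν.i * ψ ν else 0)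
      = ∑' M, ∑' i, φ M i * ψ (res j M i) := by
  rw [ENNReal.tsum_comm]
  refine tsum_congr fun M => ?_
  rw [← (res_injective M).tsum_eq]
  · simp
  · intro ν hν
    rw [Function.mem_support, ne_eq, ite_eq_right_iff, not_forall] at hν
    exact ⟨ν.i, hν.1⟩

theorem majorant_collect_le (s : ℝ) (w : Index noSites → (Fin n → ℕ) → ℂ) (v : Pt j) :
    majorant s (collect j w) v ≤ ∑' M, ∑' i, ‖w M i‖ₑ * weight s v (res j M i) := by
  classical
  rw [majorant_eq, ← tsum_res_eq]
  refine ENNReal.tsum_le_tsum fun ν => ?_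
  refine (mul_le_mul_left (enorm_tsum_le_tsum_enorm) _).trans ?_
  rw [← ENNReal.tsum_mul_right]
  refine ENNReal.tsum_le_tsum fun M => ?_
  split_ifs <;> simp

/-- The conditions on `ξ`, `y` under which the action variables are expanded. -/
structure ActionBound (ρ : ℝ) (ξ : Fin n → ℝ) (y : Fin n → ℂ) : Prop where
  pos : 0 < ρ
  le : ∀ l, ρ / 2 ≤ ξ l
  ge : ∀ l, ξ l ≤ ρ
  norm_le : ∀ l, ‖y l‖ ≤ ξ l / 8

variable {s ρ V : ℝ} {ξ : Fin n → ℝ} {v : Pt j}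

theorem tsum_actionCoeff_le (hb : ActionBound ρ ξ v.y) (hV : 0 ≤ V) (hV2 : V ^ 2 = 8 * ρ / 7)
    (M : Index noSites) :
    ∑' i, ‖actionCoeff j ξ M i‖ₑ * ∏ l, ‖v.y l‖ₑ ^ i l
      ≤ ∏ l, ENNReal.ofReal V ^ tanDeg j M l := by
  calc _ = ∑' i : Fin n → ℕ, ∏ l, (‖(halfPowCoeff (tanDeg j M l) (ξ l) (i l) : ℂ)‖ₑ
          * ‖v.y l‖ₑ ^ i l) := by
        refine tsum_congr fun i => ?_
        rw [Finset.prod_mul_distrib, actionCoeff, ← Complex.ofReal_prod]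
        congr 1
        simp only [← ofReal_norm, Complex.norm_real, norm_prod]
        exact (ENNReal.ofReal_prod_of_nonneg fun l _ => norm_nonneg _)
    _ = _ := tsum_pi_prod fun l k => ‖(halfPowCoeff (tanDeg j M l) (ξ l) k : ℂ)‖ₑ * ‖v.y l‖ₑ ^ k
    _ ≤ _ := Finset.prod_le_prod' fun l _ => tsum_halfPowCoeff_le _
        (by linarith [hb.pos, hb.le l]) (hb.ge l) (hb.norm_le l) hV hV2

theorem tsum_succ_mul_actionCoeff_le (hb : ActionBound ρ ξ v.y) (hV : 0 ≤ V)
    (hV2 : V ^ 2 = 8 * ρ / 7) (M : Index noSites) (l : Fin n) :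
    ∑' i : Fin n → ℕ, ((i l : ℝ≥0∞) + 1) * ‖actionCoeff j ξ M (i + Pi.single l 1)‖ₑ *
        ∏ l, ‖v.y l‖ₑ ^ i l
      ≤ ENNReal.ofReal (2 / ρ) * (tanDeg j M l * ∏ l, ENNReal.ofReal V ^ tanDeg j M l) := by
  let g : Fin n → ℕ → ℝ≥0∞ := fun l' k => if l' = l then
    ((k : ℝ≥0∞) + 1) * ‖(halfPowCoeff (tanDeg j M l') (ξ l') (k + 1) : ℂ)‖ₑ * ‖v.y l'‖ₑ ^ k
    else ‖(halfPowCoeff (tanDeg j M l') (ξ l') k : ℂ)‖ₑ * ‖v.y l'‖ₑ ^ k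
  calc _ = ∑' i : Fin n → ℕ, ∏ l', g l' (i l') := by
        refine tsum_congr fun i => ?_
        have h1 : ((i l : ℝ≥0∞) + 1) = ∏ l', if l' = l then (i l' : ℝ≥0∞) + 1 else 1 := by simp
        have h2 : ‖actionCoeff j ξ M (i + Pi.single l 1)‖ₑ = ∏ l',
            ‖(halfPowCoeff (tanDeg j M l') (ξ l') (if l' = l then i l' + 1 else i l') : ℂ)‖ₑ := by
          rw [actionCoeff, ← Complex.ofReal_prod]
          simp only [← ofReal_norm, Complex.norm_real, norm_prod]
          rw [ENNReal.ofReal_prod_of_nonneg fun l _ => norm_nonneg _]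
          refine Finset.prod_congr rfl fun l' _ => ?_
          by_cases hl : l' = l
          · subst hl; simp
          · simp [hl]
        rw [h1, h2, ← Finset.prod_mul_distrib, ← Finset.prod_mul_distrib]
        refine Finset.prod_congr rfl fun l' _ => ?_
        by_cases hl : l' = l <;> simp [g, hl]
    _ = _ := tsum_pi_prod g
    _ ≤ ∏ l', (if l' = l then ENNReal.ofReal (2 / ρ) * tanDeg j M l' else 1) *
          ENNReal.ofReal V ^ tanDeg j M l' := by
        refine Finset.prod_le_prod' fun l' _ => ?_
        by_cases hl : l' = l
        · simp only [g, hl, if_true]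
          rw [mul_assoc]
          exact tsum_succ_mul_halfPowCoeff_le _ hb.pos (hb.le l) (hb.ge l) (hb.norm_le l) hV hV2
        · simp only [g, hl, if_false, one_mul]
          exact tsum_halfPowCoeff_le _
            (by linarith [hb.pos, hb.le l']) (hb.ge l') (hb.norm_le l') hV hV2
    _ = _ := by
        rw [Finset.prod_mul_distrib, Finset.prod_ite_eq' Finset.univ l]
        simp [mul_assoc]

theorem tsum_actionCoeff_mul_weight_le (hj : Function.Injective j) (hb : ActionBound ρ ξ v.y)
    (hs : 0 ≤ s) (hV : 0 ≤ V) (hV2 : V ^ 2 = 8 * ρ / 7) (M : Index noSites) :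
    ∑' i, ‖actionCoeff j ξ M i‖ₑ * weight s v (res j M i)
      ≤ weight 1 (liftPt j (V * Real.exp s) 1 v) M := by
  rw [weight_liftPt hj _ (by positivity) zero_le_one, ENNReal.ofReal_one, one_pow, one_mul]
  simp only [ENNReal.ofReal_mul hV, mul_pow, Finset.prod_mul_distrib]
  refine (ENNReal.tsum_le_tsum fun i => mul_le_mul_right (weight_res_le hs v M i) _).trans ?_
  simp only [← mul_assoc]
  rw [ENNReal.tsum_mul_right, ENNReal.tsum_mul_right]
  gcongr
  exact tsum_actionCoeff_le hb hV hV2 M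

theorem tsum_succ_mul_actionCoeff_mul_weight_le (hj : Function.Injective j)
    (hb : ActionBound ρ ξ v.y)
    (hs : 0 ≤ s) (hV : 0 ≤ V) (hV2 : V ^ 2 = 8 * ρ / 7) (M : Index noSites) (l : Fin n) :
    ∑' i : Fin n → ℕ, ((i l : ℝ≥0∞) + 1) * ‖actionCoeff j ξ M (i + Pi.single l 1)‖ₑ *
        weight s v (res j M i)
      ≤ ENNReal.ofReal (2 / ρ) *
        (tanDeg j M l * weight 1 (liftPt j (V * Real.exp s) 1 v) M) := by
  rw [weight_liftPt hj _ (by positivity) zero_le_one, ENNReal.ofReal_one, one_pow, one_mul]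
  simp only [ENNReal.ofReal_mul hV, mul_pow, Finset.prod_mul_distrib]
  refine (ENNReal.tsum_le_tsum fun i => mul_le_mul_right (weight_res_le hs v M i) _).trans ?_
  simp only [← mul_assoc]
  rw [ENNReal.tsum_mul_right, ENNReal.tsum_mul_right]
  gcongr
  refine (tsum_succ_mul_actionCoeff_le hb hV hV2 M l).trans_eq ?_
  ring

end substitution

section derivatives

variable {n : ℕ} {j : Fin n → ℤ}

/-- The exponent of `z_m^σ`. -/
def Index.deg (σ : ℤˣ) (ν : Index j) (m : Site j) : ℕ := if σ = 1 then ν.α m else ν.β m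

/-- The coordinate `z_m^σ`. -/
def Pt.zs (σ : ℤˣ) (v : Pt j) (m : Site j) : ℂ := if σ = 1 then v.z m else v.zbar m

/-- The derivative with respect to `z_m^σ`. -/
def dzs (σ : ℤˣ) (c : Coeff j) (m : Site j) : Coeff j := fun ν =>
  ((ν.deg σ m : ℂ) + 1) * c (ν.addZ σ m)

theorem neg_one_ne_one_units : (-1 : ℤˣ) ≠ 1 := by decide

theorem dzs_one (c : Coeff j) (m : Site j) : dzs 1 c m = dz c m := by
  funext ν; simp [dzs, dz, Index.deg, Index.addZ]

theorem dzs_neg_one (c : Coeff j) (m : Site j) : dzs (-1) c m = dzbar c m := by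
  funext ν; simp [dzs, dzbar, Index.deg, Index.addZ]

@[simp] theorem addZ_k (σ : ℤˣ) (m : Site j) (ν : Index j) : (ν.addZ σ m).k = ν.k := by
  unfold Index.addZ; split_ifs <;> rfl

@[simp] theorem addZ_i (σ : ℤˣ) (m : Site j) (ν : Index j) : (ν.addZ σ m).i = ν.i := by
  unfold Index.addZ; split_ifs <;> rfl

theorem deg_addZ (σ σ' : ℤˣ) (m m' : Site j) (ν : Index j) :
    (ν.addZ σ m).deg σ' m' = ν.deg σ' m' + if σ' = σ ∧ m' = m then 1 else 0 := by
  rcases Int.units_eq_one_or σ with rfl | rfl <;> rcases Int.units_eq_one_or σ' with rfl | rfl <;>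
    simp [Index.addZ, Index.deg, neg_one_ne_one_units.symm,
      Finsupp.single_apply, eq_comm]

theorem Index.ext_deg {ν ν' : Index j} (hk : ν.k = ν'.k) (hi : ν.i = ν'.i)
    (h : ∀ σ m, ν.deg σ m = ν'.deg σ m) : ν = ν' := by
  ext m
  · rw [hk]
  · rw [hi]
  · simpa [Index.deg] using h 1 m
  · simpa [Index.deg, neg_one_ne_one_units] using h (-1) m

theorem addZ_injective (σ : ℤˣ) (m : Site j) : Function.Injective (Index.addZ (j := j) σ m) := by
  intro ν ν' h
  refine Index.ext_deg ?_ ?_ fun σ' m' => ?_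
  · simpa using congrArg Index.k h
  · simpa using congrArg Index.i h
  · have := congrArg (fun ν => Index.deg σ' ν m') h
    simpa only [deg_addZ, add_left_inj] using this

/-- Divide a monomial by `z_m^σ`. -/
def Index.subZ (σ : ℤˣ) (m : Site j) (ν : Index j) : Index j :=
  if σ = 1 then { ν with α := ν.α - Finsupp.single m 1 }
  else { ν with β := ν.β - Finsupp.single m 1 }

theorem addZ_subZ {σ : ℤˣ} {m : Site j} {ν : Index j} (h : ν.deg σ m ≠ 0) :
    (ν.subZ σ m).addZ σ m = ν := by
  rcases Int.units_eq_one_or σ with rfl | rfl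
  · simp only [Index.deg, if_true] at h
    simp only [Index.addZ, Index.subZ, if_true]
    congr 1
    exact tsub_add_cancel_of_le (by simpa [Nat.one_le_iff_ne_zero] using h)
  · simp only [Index.deg, neg_one_ne_one_units, if_false] at h
    simp only [Index.addZ, Index.subZ, neg_one_ne_one_units, if_false]
    congr 1
    exact tsub_add_cancel_of_le (by simpa [Nat.one_le_iff_ne_zero] using h)

theorem mem_range_addZ {σ : ℤˣ} {m : Site j} {ν : Index j} :
    ν ∈ Set.range (Index.addZ (j := j) σ m) ↔ ν.deg σ m ≠ 0 := by
  constructor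
  · rintro ⟨ν, rfl⟩
    simp [deg_addZ]
  · exact fun h => ⟨_, addZ_subZ h⟩

theorem weight_addZ (s : ℝ) (v : Pt j) (σ : ℤˣ) (m : Site j) (ν : Index j) :
    weight s v (ν.addZ σ m) = ‖v.zs σ m‖ₑ * weight s v ν := by
  have h : ∀ (A : Site j →₀ ℕ) (f : Site j → ℝ≥0∞),
      ((A + Finsupp.single m 1).prod fun m e => f m ^ e) = f m * A.prod fun m e => f m ^ e := by
    intro A f
    classical
    rw [Finsupp.prod_add_index' (by simp) (by simp [pow_add]),
      Finsupp.prod_single_index (by simp), pow_one, mul_comm]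
  rcases Int.units_eq_one_or σ with rfl | rfl
  · simp only [weight, Index.addZ, if_true, h, Pt.zs]; ring
  · simp only [weight, Index.addZ, if_false, neg_one_ne_one_units, h, Pt.zs]; ring

theorem tsum_deg_mul_weight (s : ℝ) (v : Pt j) (c : Coeff j) (σ : ℤˣ) (m : Site j) :
    ∑' ν, (ν.deg σ m : ℝ≥0∞) * ‖c ν‖ₑ * weight s v ν = ‖v.zs σ m‖ₑ * majorant s (dzs σ c m) v := by
  rw [majorant_eq, ← ENNReal.tsum_mul_left, ← (addZ_injective σ m).tsum_eq]
  · refine tsum_congr fun ν => ?_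
    rw [weight_addZ, deg_addZ, dzs, enorm_mul]
    have : ‖((ν.deg σ m : ℂ) + 1)‖ₑ = (ν.deg σ m : ℝ≥0∞) + 1 := by
      have h : ((ν.deg σ m : ℂ) + 1) = (((ν.deg σ m + 1 : ℕ) : ℝ) : ℂ) := by push_cast; rfl
      rw [h, ← ofReal_norm, Complex.norm_real, Real.norm_of_nonneg (by positivity),
        ENNReal.ofReal_natCast]
      push_cast
      rfl
    rw [this]
    simp only [and_self, if_true, Nat.cast_add, Nat.cast_one]
    ring
  · intro ν hν
    rw [mem_range_addZ]
    intro h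
    simp [h] at hν

theorem res_addZ_norSite (σ : ℤˣ) (m : Site j) (M : Index noSites) (i : Fin n → ℕ) :
    res j (M.addZ σ (norSite j m)) i = (res j M i).addZ σ m := by
  rcases Int.units_eq_one_or σ with rfl | rfl
  · ext <;> simp [Index.addZ, res]
  · ext <;> simp [Index.addZ, res]

@[simp] theorem deg_res (σ : ℤˣ) (m : Site j) (M : Index noSites) (i : Fin n → ℕ) :
    (res j M i).deg σ m = M.deg σ (norSite j m) := by
  simp [Index.deg]

@[simp] theorem tanDeg_addZ_norSite (σ : ℤˣ) (m : Site j) (M : Index noSites) :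
    tanDeg j (M.addZ σ (norSite j m)) = tanDeg j M := by
  funext l
  rcases Int.units_eq_one_or σ with rfl | rfl <;>
    simp [Index.addZ, tanDeg]

theorem tanDeg_eq (M : Index noSites) (l : Fin n) :
    tanDeg j M l = M.deg 1 (tanSite j l) + M.deg (-1) (tanSite j l) := by
  simp [tanDeg, Index.deg]

theorem sum_tanDeg_addZ_tanSite (hj : Function.Injective j) (σ : ℤˣ) (l : Fin n)
    (M : Index noSites) :
    ∑ l', tanDeg j (M.addZ σ (tanSite j l)) l' = (∑ l', tanDeg j M l') + 1 := by
  have h : ∀ l', tanDeg j (M.addZ σ (tanSite j l)) l'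
      = tanDeg j M l' + if l' = l then 1 else 0 := by
    intro l'
    simp only [tanDeg_eq, deg_addZ, (tanSite_injective hj).eq_iff]
    rcases Int.units_eq_one_or σ with rfl | rfl
    · simp; ring
    · simp [neg_one_ne_one_units.symm]; ring
  simp [h, Finset.sum_add_distrib]

theorem normalDegree_addZ_tanSite (hj : Function.Injective j) (σ : ℤˣ) (l : Fin n)
    (M : Index noSites) :
    normalDegree j (M.addZ σ (tanSite j l)) = normalDegree j M := by
  rw [normalDegree_eq hj, normalDegree_eq hj]
  rcases Int.units_eq_one_or σ with rfl | rfl <;>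
    simp [Index.addZ]

variable {s ρ V : ℝ} {ξ : Fin n → ℝ} {v : Pt j}

theorem dx_subst (F : Coeff noSites) (l : Fin n) :
    dx (subst j ξ F) l = collect j fun M i =>
      Complex.I * (((M.α (tanSite j l) : ℤ) - M.β (tanSite j l) : ℤ) : ℂ) *
        (F M * actionCoeff j ξ M i) := by
  funext ν
  simp only [dx, subst, collect, ← tsum_mul_left]
  refine tsum_congr fun M => ?_
  split_ifs with h
  · rw [← h, res_k]
  · simp

theorem dy_subst (F : Coeff noSites) (l : Fin n) :
    dy (subst j ξ F) l = collect j fun M i =>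
      F M * (((i l : ℂ) + 1) * actionCoeff j ξ M (i + Pi.single l 1)) := by
  funext ν
  simp only [dy, subst, collect, ← tsum_mul_left]
  refine tsum_congr fun M => ?_
  have : res j M (ν.i + Pi.single l 1) = { ν with i := ν.i + Pi.single l 1 } ↔
      res j M ν.i = ν := by
    simp only [Index.ext_iff, res_i, res_α, res_β, true_and]
    exact Iff.rfl
  by_cases h : res j M ν.i = ν
  · rw [if_pos h, if_pos (this.2 h)]; ring
  · rw [if_neg h, if_neg (this.not.2 h), mul_zero]

theorem dzs_subst (F : Coeff noSites) (σ : ℤˣ) (m : Site j) :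
    dzs σ (subst j ξ F) m = subst j ξ (dzs σ F (norSite j m)) := by
  funext ν
  simp only [dzs, subst, collect, ← tsum_mul_left]
  rw [← (addZ_injective σ (norSite j m)).tsum_eq]
  · refine tsum_congr fun M => ?_
    have this : res j (M.addZ σ (norSite j m)) (ν.addZ σ m).i = ν.addZ σ m ↔
        res j M ν.i = ν := by
      rw [res_addZ_norSite, addZ_i, (addZ_injective σ m).eq_iff]
    by_cases h : res j M ν.i = ν
    · rw [if_pos h, if_pos (this.2 h), ← deg_res σ m M ν.i, h, actionCoeff, actionCoeff,
        tanDeg_addZ_norSite, addZ_i]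
      ring
    · rw [if_neg h, if_neg (this.not.2 h), mul_zero]
  · intro M hM
    have h : res j M (ν.addZ σ m).i = ν.addZ σ m := by
      by_contra h
      rw [Function.mem_support, if_neg h, mul_zero] at hM
      exact hM rfl
    rw [mem_range_addZ, ← deg_res σ m M (ν.addZ σ m).i, h]
    simp [deg_addZ]

theorem majorant_subst_le (hj : Function.Injective j) (hb : ActionBound ρ ξ v.y)
    (hs : 0 ≤ s) (hV : 0 ≤ V) (hV2 : V ^ 2 = 8 * ρ / 7) (F : Coeff noSites) :
    majorant s (subst j ξ F) v ≤ majorant 1 F (liftPt j (V * Real.exp s) 1 v) := by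
  refine (majorant_collect_le _ _ _).trans ?_
  rw [majorant_eq]
  refine ENNReal.tsum_le_tsum fun M => ?_
  simp only [enorm_mul, mul_assoc, ENNReal.tsum_mul_left]
  gcongr
  exact tsum_actionCoeff_mul_weight_le hj hb hs hV hV2 M

theorem majorant_dx_subst_le (hj : Function.Injective j) (hb : ActionBound ρ ξ v.y)
    (hs : 0 ≤ s) (hV : 0 ≤ V) (hV2 : V ^ 2 = 8 * ρ / 7) (F : Coeff noSites) (l : Fin n) :
    majorant s (dx (subst j ξ F) l) v ≤
      ∑' M, (tanDeg j M l : ℝ≥0∞) * ‖F M‖ₑ * weight 1 (liftPt j (V * Real.exp s) 1 v) M := by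
  rw [dx_subst]
  refine (majorant_collect_le _ _ _).trans ?_
  refine ENNReal.tsum_le_tsum fun M => ?_
  simp only [enorm_mul, mul_assoc, ENNReal.tsum_mul_left]
  rw [← mul_assoc]
  have h : ‖Complex.I‖ₑ * ‖(((M.α (tanSite j l) : ℤ) - M.β (tanSite j l) : ℤ) : ℂ)‖ₑ
      ≤ (tanDeg j M l : ℝ≥0∞) := by
    have h1 : ‖(((M.α (tanSite j l) : ℤ) - M.β (tanSite j l) : ℤ) : ℂ)‖ ≤ (tanDeg j M l : ℝ) := by
      rw [Complex.norm_intCast, tanDeg, abs_le]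
      push_cast
      constructor <;> linarith [(Nat.cast_nonneg (M.α (tanSite j l)) : (0 : ℝ) ≤ _),
        (Nat.cast_nonneg (M.β (tanSite j l)) : (0 : ℝ) ≤ _)]
    rw [← ofReal_norm, ← ofReal_norm, Complex.norm_I, ENNReal.ofReal_one, one_mul,
      ← ENNReal.ofReal_natCast]
    exact ENNReal.ofReal_le_ofReal h1
  gcongr
  exact tsum_actionCoeff_mul_weight_le hj hb hs hV hV2 M

theorem majorant_dy_subst_le (hj : Function.Injective j) (hb : ActionBound ρ ξ v.y)
    (hs : 0 ≤ s) (hV : 0 ≤ V) (hV2 : V ^ 2 = 8 * ρ / 7) (F : Coeff noSites) (l : Fin n) :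
    majorant s (dy (subst j ξ F) l) v ≤ ENNReal.ofReal (2 / ρ) *
      ∑' M, (tanDeg j M l : ℝ≥0∞) * ‖F M‖ₑ * weight 1 (liftPt j (V * Real.exp s) 1 v) M := by
  rw [dy_subst]
  refine (majorant_collect_le _ _ _).trans ?_
  rw [← ENNReal.tsum_mul_left]
  refine ENNReal.tsum_le_tsum fun M => ?_
  have h : ∀ k : ℕ, ‖((k : ℂ) + 1)‖ₑ = (k : ℝ≥0∞) + 1 := by
    intro k
    have h : ((k : ℂ) + 1) = (((k + 1 : ℕ) : ℝ) : ℂ) := by push_cast; rfl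
    rw [h, ← ofReal_norm, Complex.norm_real, Real.norm_of_nonneg (by positivity),
      ENNReal.ofReal_natCast]
    push_cast
    rfl
  have h1 := tsum_succ_mul_actionCoeff_mul_weight_le hj hb hs hV hV2 M l
  simp only [mul_assoc] at h1
  simp only [enorm_mul, h, mul_assoc, ENNReal.tsum_mul_left]
  calc _ ≤ _ := mul_le_mul_right h1 _
    _ = _ := by ring

theorem zs_liftPt_tanSite (U t : ℝ) (v : Pt j) (σ : ℤˣ) (l : Fin n) :
    (liftPt j U t v).zs σ (tanSite j l) = U := by
  simp [Pt.zs]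

theorem tsum_tanDeg_eq {U : ℝ} (hU : 0 ≤ U) (F : Coeff noSites) (l : Fin n) :
    ∑' M, (tanDeg j M l : ℝ≥0∞) * ‖F M‖ₑ * weight 1 (liftPt j U 1 v) M =
      ENNReal.ofReal U * (majorant 1 (dzs 1 F (tanSite j l)) (liftPt j U 1 v) +
        majorant 1 (dzs (-1) F (tanSite j l)) (liftPt j U 1 v)) := by
  have hU' : ‖(U : ℂ)‖ₑ = ENNReal.ofReal U := by
    rw [← ofReal_norm, Complex.norm_real, Real.norm_of_nonneg hU]
  simp only [tanDeg_eq, Nat.cast_add, add_mul]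
  rw [ENNReal.tsum_add, tsum_deg_mul_weight, tsum_deg_mul_weight, zs_liftPt_tanSite,
    zs_liftPt_tanSite, hU', mul_add]

theorem weight_liftPt_scale (hj : Function.Injective j) {U t : ℝ} (hU : 0 ≤ U) (ht : 0 ≤ t)
    (v : Pt j) (M : Index noSites) :
    weight 1 (liftPt j (2 * U) t v) M = 2 ^ (∑ l, tanDeg j M l) *
      ENNReal.ofReal t ^ normalDegree j M * weight 1 (liftPt j U 1 v) M := by
  rw [weight_liftPt hj _ (by positivity) ht, weight_liftPt hj _ hU zero_le_one,
    ENNReal.ofReal_mul zero_le_two]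
  simp only [mul_pow, Finset.prod_mul_distrib, Finset.prod_pow_eq_pow_sum, ENNReal.ofReal_one,
    one_pow, one_mul, ENNReal.ofReal_ofNat]
  ring

variable {d : ℕ} {ε : ℝ≥0∞} {F : Coeff noSites}

theorem one_le_two_mul_pow {ε : ℝ≥0∞} {k : ℕ} (h : (2 : ℝ≥0∞)⁻¹ ^ k ≤ ε) :
    (1 : ℝ≥0∞) ≤ ε * 2 ^ k := by
  calc (1 : ℝ≥0∞) = 2⁻¹ ^ k * 2 ^ k := by
        rw [← mul_pow, ENNReal.inv_mul_cancel two_ne_zero ENNReal.ofNat_ne_top, one_pow]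
    _ ≤ _ := by gcongr

theorem majorant_dzs_tanSite_scale (hj : Function.Injective j) {U t : ℝ} (hU : 0 ≤ U) (ht : 1 ≤ t)
    (hd : NormalDegreeGE j d F) (hε : ∀ M, F M ≠ 0 → (2 : ℝ≥0∞)⁻¹ ^ (∑ l, tanDeg j M l) ≤ ε)
    (v : Pt j) (σ : ℤˣ) (l : Fin n) :
    ENNReal.ofReal t ^ d * majorant 1 (dzs σ F (tanSite j l)) (liftPt j U 1 v) ≤
      2 * ε * majorant 1 (dzs σ F (tanSite j l)) (liftPt j (2 * U) t v) := by
  rw [majorant_eq, majorant_eq, ← ENNReal.tsum_mul_left, ← ENNReal.tsum_mul_left]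
  refine ENNReal.tsum_le_tsum fun M => ?_
  by_cases hM : F (M.addZ σ (tanSite j l)) = 0
  · simp [dzs, hM]
  have h1 := hd _ hM
  have h2 := hε _ hM
  rw [normalDegree_addZ_tanSite hj] at h1
  rw [sum_tanDeg_addZ_tanSite hj] at h2
  have h3 : (1 : ℝ≥0∞) ≤ ENNReal.ofReal t := by simpa using ht
  have h4 : (1 : ℝ≥0∞) ≤ 2 * ε * 2 ^ (∑ l, tanDeg j M l) := by
    refine (one_le_two_mul_pow h2).trans_eq ?_
    rw [pow_succ]; ring
  rw [weight_liftPt_scale hj hU (by linarith)]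
  calc _ = ENNReal.ofReal t ^ d * (‖dzs σ F (tanSite j l) M‖ₑ *
          weight 1 (liftPt j U 1 v) M) := rfl
    _ ≤ (2 * ε * 2 ^ (∑ l, tanDeg j M l)) * ENNReal.ofReal t ^ normalDegree j M *
          (‖dzs σ F (tanSite j l) M‖ₑ * weight 1 (liftPt j U 1 v) M) := by
        gcongr
        calc _ ≤ ENNReal.ofReal t ^ normalDegree j M := pow_le_pow_right₀ h3 h1
          _ ≤ _ := le_mul_of_one_le_left' h4
    _ = _ := by ring

theorem majorant_dzs_norSite_scale (hj : Function.Injective j) {U t : ℝ} (hU : 0 ≤ U) (ht : 1 ≤ t)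
    (hε : ∀ M, F M ≠ 0 → (2 : ℝ≥0∞)⁻¹ ^ (∑ l, tanDeg j M l) ≤ ε)
    (v : Pt j) (σ : ℤˣ) (m : Site j) :
    majorant 1 (dzs σ F (norSite j m)) (liftPt j U 1 v) ≤
      2 * ε * majorant 1 (dzs σ F (norSite j m)) (liftPt j (2 * U) t v) := by
  rw [majorant_eq, majorant_eq, ← ENNReal.tsum_mul_left]
  refine ENNReal.tsum_le_tsum fun M => ?_
  by_cases hM : F (M.addZ σ (norSite j m)) = 0
  · simp [dzs, hM]
  have h2 := hε _ hM
  rw [tanDeg_addZ_norSite] at h2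
  have h3 : (1 : ℝ≥0∞) ≤ ENNReal.ofReal t := by simpa using ht
  have h4 : (1 : ℝ≥0∞) ≤ 2 * ε * 2 ^ (∑ l, tanDeg j M l) := by
    refine (one_le_two_mul_pow h2).trans ?_
    rw [mul_assoc]
    exact le_mul_of_one_le_left' one_le_two
  rw [weight_liftPt_scale hj hU (by linarith)]
  calc _ = 1 * (‖dzs σ F (norSite j m) M‖ₑ *
          weight 1 (liftPt j U 1 v) M) := (one_mul _).symm
    _ ≤ (2 * ε * 2 ^ (∑ l, tanDeg j M l)) * ENNReal.ofReal t ^ normalDegree j M *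
          (‖dzs σ F (norSite j m) M‖ₑ * weight 1 (liftPt j U 1 v) M) := by
        gcongr
        calc (1 : ℝ≥0∞) ≤ ENNReal.ofReal t ^ normalDegree j M := one_le_pow₀ h3
          _ ≤ _ := le_mul_of_one_le_left' h4
    _ = _ := by ring

end derivatives

section norms

variable {n : ℕ} {j : Fin n → ℤ} {a p : ℝ}

/-- The weight of a site in the norm of sequences. -/
def siteWeight (a p : ℝ) (m : ℤ) : ℝ := Real.exp (2 * a * |(m : ℝ)|) * bracket m ^ (2 * p)

theorem one_le_bracket (m : ℤ) : 1 ≤ bracket m := le_max_left _ _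

theorem one_le_siteWeight (ha : 0 ≤ a) (hp : 0 ≤ p) (m : ℤ) : 1 ≤ siteWeight a p m := by
  have h1 : 1 ≤ Real.exp (2 * a * |(m : ℝ)|) := Real.one_le_exp (by positivity)
  have h2 : 1 ≤ bracket m ^ (2 * p) := Real.one_le_rpow (one_le_bracket m) (by positivity)
  exact one_le_mul_of_one_le_of_one_le h1 h2

theorem seqNorm_sq (w : Site j → ℝ≥0∞) :
    seqNorm a p w ^ 2 = ∑' m : Site j, w m ^ 2 * ENNReal.ofReal (siteWeight a p m) := by
  rw [seqNorm, ← ENNReal.rpow_natCast, ← ENNReal.rpow_mul]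
  simp [siteWeight]

theorem seqNorm_le_of_sq {w : Site j → ℝ≥0∞} {A : ℝ≥0∞} (h : seqNorm a p w ^ 2 ≤ A ^ 2) :
    seqNorm a p w ≤ A := (ENNReal.pow_le_pow_left_iff two_ne_zero).1 h

theorem seqNorm_mono {w w' : Site j → ℝ≥0∞} (h : ∀ m, w m ≤ w' m) :
    seqNorm a p w ≤ seqNorm a p w' := by
  apply seqNorm_le_of_sq
  rw [seqNorm_sq, seqNorm_sq]
  exact ENNReal.tsum_le_tsum fun m => by gcongr; exact h m

theorem seqNorm_const_mul (c : ℝ≥0∞) (w : Site j → ℝ≥0∞) :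
    seqNorm a p (fun m => c * w m) = c * seqNorm a p w := by
  have : seqNorm a p (fun m => c * w m) ^ 2 = (c * seqNorm a p w) ^ 2 := by
    rw [mul_pow, seqNorm_sq, seqNorm_sq, ← ENNReal.tsum_mul_left]
    exact tsum_congr fun m => by ring
  exact le_antisymm ((ENNReal.pow_le_pow_left_iff two_ne_zero).1 this.le)
    ((ENNReal.pow_le_pow_left_iff two_ne_zero).1 this.ge)

theorem le_seqNorm (ha : 0 ≤ a) (hp : 0 ≤ p) (w : Site j → ℝ≥0∞) (m : Site j) :
    w m ≤ seqNorm a p w := by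
  apply (ENNReal.pow_le_pow_left_iff two_ne_zero).1
  rw [seqNorm_sq]
  refine le_trans ?_ (ENNReal.le_tsum m)
  refine le_mul_of_one_le_right' ?_
  simpa using one_le_siteWeight ha hp m

theorem seqNorm_site_sq (hj : Function.Injective j) (w : Site noSites → ℝ≥0∞) :
    seqNorm a p w ^ 2 = (∑ l, w (tanSite j l) ^ 2 * ENNReal.ofReal (siteWeight a p (j l))) +
      seqNorm a p (fun m => w (norSite j m)) ^ 2 := by
  rw [seqNorm_sq, seqNorm_sq, tsum_site hj]
  rfl

theorem seqNorm_norSite_le (hj : Function.Injective j) (w : Site noSites → ℝ≥0∞) :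
    seqNorm a p (fun m => w (norSite j m)) ≤ seqNorm a p w := by
  apply seqNorm_le_of_sq
  rw [seqNorm_site_sq hj w]
  exact le_add_self

theorem majorant_const_mul (s : ℝ) (c : Coeff j) (z : ℂ) (hz : ‖z‖ = 1) (v : Pt j) :
    majorant s (fun ν => z * c ν) v = majorant s c v := by
  have hz' : ‖z‖ₑ = 1 := by rw [← ofReal_norm, hz, ENNReal.ofReal_one]
  simp only [majorant_eq, enorm_mul, hz', one_mul]

theorem weightedNorm_hamVF (s r : ℝ) (c : Coeff j) (v : Pt j) :
    weightedNorm a p s r (fun l => majorant s ((hamVF c).x l) v)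
      (fun l => majorant s ((hamVF c).y l) v) (fun m => majorant s ((hamVF c).z m) v)
      (fun m => majorant s ((hamVF c).zbar m) v) =
    (⨆ l, majorant s (dy c l) v) / ENNReal.ofReal s +
      (∑ l, majorant s (dx c l) v) / ENNReal.ofReal (r ^ 2) +
      seqNorm a p (fun m => majorant s (dzs (-1) c m) v) / ENNReal.ofReal r +
      seqNorm a p (fun m => majorant s (dzs 1 c m) v) / ENNReal.ofReal r := by
  have h1 : ∀ l, majorant s ((hamVF c).y l) v = majorant s (dx c l) v := by
    intro l; simp [majorant_eq, hamVF]
  have h2 : ∀ m, majorant s ((hamVF c).z m) v = majorant s (dzs (-1) c m) v := fun m => by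
    rw [dzs_neg_one]; exact majorant_const_mul s (dzbar c m) (-Complex.I) (by simp) v
  have h3 : ∀ m, majorant s ((hamVF c).zbar m) v = majorant s (dzs 1 c m) v := fun m => by
    rw [dzs_one]; exact majorant_const_mul s (dz c m) Complex.I (by simp) v
  simp only [weightedNorm, h1, h2, h3]
  rfl

theorem div_ofReal_le {A E : ℝ≥0∞} {x s : ℝ} (hs : 0 < s) (h : A ≤ ENNReal.ofReal x * E) :
    A / ENNReal.ofReal s ≤ ENNReal.ofReal (x / s) * E := by
  rw [ENNReal.ofReal_div_of_pos hs, mul_comm, ← mul_div_assoc, mul_comm]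
  exact ENNReal.div_le_div_right h _

theorem majorantNorm_le {s r : ℝ} {c : Coeff j} {A : ℝ≥0∞}
    (h : ∀ v, InBall a p r v → (⨆ l, majorant s (dy c l) v) / ENNReal.ofReal s +
      (∑ l, majorant s (dx c l) v) / ENNReal.ofReal (r ^ 2) +
      seqNorm a p (fun m => majorant s (dzs (-1) c m) v) / ENNReal.ofReal r +
      seqNorm a p (fun m => majorant s (dzs 1 c m) v) / ENNReal.ofReal r ≤ A) :
    majorantNorm a p s r (hamVF c) ≤ A :=
  iSup₂_le fun v hv => (weightedNorm_hamVF s r c v).trans_le (h v hv)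

theorem seqNorm_dzs_le {s r : ℝ} (hr : 0 < r) (c : Coeff j) {v : Pt j} (hv : InBall a p r v)
    (σ : ℤˣ) : seqNorm a p (fun m => majorant s (dzs σ c m) v) ≤
      ENNReal.ofReal r * majorantNorm a p s r (hamVF c) := by
  have h : seqNorm a p (fun m => majorant s (dzs σ c m) v) / ENNReal.ofReal r ≤
      majorantNorm a p s r (hamVF c) := by
    refine le_trans ?_ (le_iSup₂_of_le v hv le_rfl)
    rw [weightedNorm_hamVF]
    rcases Int.units_eq_one_or σ with rfl | rfl
    · exact le_add_self
    · exact le_add_right le_add_self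
  rwa [ENNReal.div_le_iff (by simpa using hr) ENNReal.ofReal_ne_top, mul_comm] at h

end norms

/-- The hypotheses on the tangential sites and on the radii. -/
structure Radii {n : ℕ} (j : Fin n → ℤ) (κ : ℕ) (a p s r R ρ : ℝ) : Prop where
  inj : Function.Injective j
  kappa_eq : kappa j = κ
  one_le_kappa : 1 ≤ κ
  a_nonneg : 0 ≤ a
  half_lt_p : 1 / 2 < p
  s_pos : 0 < s
  s_lt : s < 1
  r_pos : 0 < r
  R_pos : 0 < R
  r_sq_lt : 16 * r ^ 2 < ρ
  rho_eq : ρ = (48 * n * (κ : ℝ) ^ (2 * p) * Real.exp (2 * (s + a * κ)))⁻¹ * R ^ 2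

namespace Radii

variable {n : ℕ} {j : Fin n → ℤ} {κ : ℕ} {a p s r R ρ : ℝ} (h : Radii j κ a p s r R ρ)
include h

theorem n_pos : 0 < n := by
  rcases Nat.eq_zero_or_pos n with rfl | hn
  · have := h.kappa_eq
    have h1 := h.one_le_kappa
    simp [kappa] at this
    omega
  · exact hn

theorem rho_pos : 0 < ρ := lt_of_le_of_lt (by positivity) h.r_sq_lt

theorem p_nonneg : 0 ≤ p := by linarith [h.half_lt_p]

theorem siteWeight_le (l : Fin n) :
    siteWeight a p (j l) ≤ Real.exp (2 * a * κ) * (κ : ℝ) ^ (2 * p) := by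
  have h1 : |((j l : ℤ) : ℝ)| ≤ κ := by
    have : (j l).natAbs ≤ κ := by
      rw [← h.kappa_eq]
      exact Finset.le_sup (f := fun l => (j l).natAbs) (Finset.mem_univ l)
    rw [← Int.cast_abs, Int.abs_eq_natAbs]
    exact_mod_cast this
  have h2 : (1 : ℝ) ≤ κ := by exact_mod_cast h.one_le_kappa
  have ha := h.a_nonneg
  have hp := h.p_nonneg
  have h3 : 0 ≤ bracket (j l) := zero_le_one.trans (one_le_bracket _)
  unfold siteWeight
  gcongr
  exact max_le h2 h1

end Radii

/-- The radius of the tangential variables in the majorant of the action-angle map. -/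
def tanRadius (s ρ : ℝ) : ℝ := Real.sqrt (8 * ρ / 7) * Real.exp s

theorem tanRadius_nonneg (s ρ : ℝ) : 0 ≤ tanRadius s ρ := by unfold tanRadius; positivity

namespace Radii

variable {n : ℕ} {j : Fin n → ℤ} {κ : ℕ} {a p s r R ρ : ℝ} (h : Radii j κ a p s r R ρ)
include h

theorem tanRadius_sq : tanRadius s ρ ^ 2 = 8 * ρ / 7 * Real.exp (2 * s) := by
  have := h.rho_pos
  rw [tanRadius, mul_pow, Real.sq_sqrt (by positivity), ← Real.exp_nat_mul]
  norm_num

theorem tanRadius_bound : n * (2 * tanRadius s ρ) ^ 2 * (Real.exp (2 * a * κ) * (κ : ℝ) ^ (2 * p))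
    ≤ R ^ 2 / 10 := by
  have hn : (0 : ℝ) < n := by exact_mod_cast h.n_pos
  have hκ : (0 : ℝ) < κ := by exact_mod_cast h.one_le_kappa
  have hk : (0 : ℝ) < (κ : ℝ) ^ (2 * p) := Real.rpow_pos_of_pos hκ _
  have e : Real.exp (2 * (s + a * κ)) = Real.exp (2 * s) * Real.exp (2 * a * κ) := by
    rw [← Real.exp_add]; ring_nf
  rw [mul_pow, h.tanRadius_sq, h.rho_eq, e]
  have h1 := Real.exp_pos (2 * s)
  have h2 := Real.exp_pos (2 * a * κ)
  have : n * (2 ^ 2 * (8 * ((48 * n * (κ : ℝ) ^ (2 * p) *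
      (Real.exp (2 * s) * Real.exp (2 * a * κ)))⁻¹ * R ^ 2) / 7 * Real.exp (2 * s))) *
      (Real.exp (2 * a * κ) * (κ : ℝ) ^ (2 * p)) = R ^ 2 * (2 / 21) := by
    field_simp
    ring
  rw [this]
  nlinarith [sq_nonneg R]

theorem tanRadius_le : tanRadius s ρ ≤ R / 6 := by
  have hn : (1 : ℝ) ≤ n := by exact_mod_cast h.n_pos
  have hκ : (1 : ℝ) ≤ κ := by exact_mod_cast h.one_le_kappa
  have ha := h.a_nonneg
  have hp := h.p_nonneg
  have hk : 1 ≤ (κ : ℝ) ^ (2 * p) := Real.one_le_rpow hκ (by positivity)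
  have he : 1 ≤ Real.exp (2 * a * κ) := Real.one_le_exp (by positivity)
  have h1 : (2 * tanRadius s ρ) ^ 2 ≤ R ^ 2 / 10 := by
    refine le_trans ?_ h.tanRadius_bound
    have : (1 : ℝ) ≤ n * (Real.exp (2 * a * κ) * (κ : ℝ) ^ (2 * p)) :=
      one_le_mul_of_one_le_of_one_le hn (one_le_mul_of_one_le_of_one_le he hk)
    nlinarith [sq_nonneg (2 * tanRadius s ρ)]
  have hR := h.R_pos
  refine (sq_le_sq₀ (tanRadius_nonneg s ρ) (by positivity)).1 ?_
  nlinarith [sq_nonneg R]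

theorem tanRadius_mul_le : tanRadius s ρ * r ≤ ρ := by
  have hρ := h.rho_pos
  have he : Real.exp (2 * s) ≤ 9 := by
    have h1 : Real.exp (2 * s) ≤ Real.exp 1 ^ 2 := by
      rw [← Real.exp_nat_mul]
      exact Real.exp_le_exp.2 (by push_cast; linarith [h.s_lt])
    have h2 := Real.exp_one_lt_d9
    nlinarith [Real.exp_pos 1]
  refine (sq_le_sq₀ (mul_nonneg (tanRadius_nonneg s ρ) h.r_pos.le) hρ.le).1 ?_
  rw [mul_pow, h.tanRadius_sq]
  have h1 := h.r_sq_lt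
  calc 8 * ρ / 7 * Real.exp (2 * s) * r ^ 2 ≤ 8 * ρ / 7 * 9 * (ρ / 16) := by
        gcongr; linarith
    _ ≤ ρ ^ 2 := by nlinarith

theorem one_le_scale : 1 ≤ R / (8 * r) := by
  have hn : (1 : ℝ) ≤ n := by exact_mod_cast h.n_pos
  have hr := h.r_pos
  rw [one_le_div (by positivity)]
  refine (sq_le_sq₀ (by positivity) h.R_pos.le).1 ?_
  have h1 := h.tanRadius_le
  have h2 : ρ ≤ tanRadius s ρ ^ 2 := by
    rw [h.tanRadius_sq]
    have := Real.one_le_exp (x := 2 * s) (by linarith [h.s_pos])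
    nlinarith [h.rho_pos]
  have h3 : tanRadius s ρ ^ 2 ≤ (R / 6) ^ 2 := by gcongr; exact tanRadius_nonneg _ _
  nlinarith [h.r_sq_lt]

theorem seqNorm_lt {w : Site noSites → ℝ≥0∞}
    (hw : ∀ l, w (tanSite j l) ≤ ENNReal.ofReal (2 * tanRadius s ρ))
    (hz : seqNorm a p (fun m => w (norSite j m)) ≤ ENNReal.ofReal (R / 8)) :
    seqNorm a p w < ENNReal.ofReal (R / 2) := by
  have hR := h.R_pos
  have hU := tanRadius_nonneg s ρ
  refine (ENNReal.pow_lt_pow_left_iff two_ne_zero).1 ?_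
  rw [seqNorm_site_sq h.inj]
  have h1 : ∑ l, w (tanSite j l) ^ 2 * ENNReal.ofReal (siteWeight a p (j l)) ≤
      ENNReal.ofReal (R ^ 2 / 10) := by
    calc _ ≤ ∑ _l : Fin n, ENNReal.ofReal (2 * tanRadius s ρ) ^ 2 *
          ENNReal.ofReal (Real.exp (2 * a * κ) * (κ : ℝ) ^ (2 * p)) := by
          refine Finset.sum_le_sum fun l _ => ?_
          gcongr
          · exact hw l
          · exact h.siteWeight_le l
      _ = ENNReal.ofReal (n * (2 * tanRadius s ρ) ^ 2 *
          (Real.exp (2 * a * κ) * (κ : ℝ) ^ (2 * p))) := by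
          have hn : (n : ℝ≥0∞) = ENNReal.ofReal n := by simp
          rw [Finset.sum_const, Finset.card_univ, Fintype.card_fin, nsmul_eq_mul, hn,
            ← ENNReal.ofReal_pow (by positivity), ← mul_assoc, ← ENNReal.ofReal_mul (by positivity),
            ← ENNReal.ofReal_mul (by positivity)]
      _ ≤ _ := ENNReal.ofReal_le_ofReal h.tanRadius_bound
  calc _ ≤ ENNReal.ofReal (R ^ 2 / 10) + ENNReal.ofReal (R / 8) ^ 2 := by gcongr
    _ = ENNReal.ofReal (R ^ 2 / 10 + (R / 8) ^ 2) := by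
        rw [ENNReal.ofReal_add (by positivity) (by positivity), ENNReal.ofReal_pow (by positivity)]
    _ < ENNReal.ofReal (R / 2) ^ 2 := by
        rw [← ENNReal.ofReal_pow (by positivity)]
        apply (ENNReal.ofReal_lt_ofReal_iff (by positivity)).2
        nlinarith [mul_pos hR hR]

theorem inBall_liftPt {v : Pt j} (hv : InBall a p r v) {U t : ℝ} (hU : 0 ≤ U)
    (hU2 : U ≤ 2 * tanRadius s ρ) (ht : 0 ≤ t) (ht2 : t ≤ R / (8 * r)) :
    InBall a p (R / 2) (liftPt j U t v) := by
  have hR := h.R_pos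
  have hr := h.r_pos
  have ht' : ‖(t : ℂ)‖ₑ = ENNReal.ofReal t := by
    rw [← ofReal_norm, Complex.norm_real, Real.norm_of_nonneg ht]
  have hU' : ‖(U : ℂ)‖ₑ = ENNReal.ofReal U := by
    rw [← ofReal_norm, Complex.norm_real, Real.norm_of_nonneg hU]
  have key : ∀ A : ℝ≥0∞, A ≤ ENNReal.ofReal r → ENNReal.ofReal t * A ≤ ENNReal.ofReal (R / 8) := by
    intro A hA
    calc _ ≤ ENNReal.ofReal (R / (8 * r)) * ENNReal.ofReal r := by gcongr
      _ = _ := by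
        rw [← ENNReal.ofReal_mul (by positivity)]
        congr 1
        field_simp
  refine ⟨by simpa using by positivity, h.seqNorm_lt (fun l => ?_) ?_,
    h.seqNorm_lt (fun l => ?_) ?_⟩
  · rw [liftPt_z_tanSite, hU']; exact ENNReal.ofReal_le_ofReal hU2
  · simp only [liftPt_z_norSite, enorm_mul, ht', seqNorm_const_mul]
    exact key _ hv.2.1.le
  · rw [liftPt_zbar_tanSite, hU']; exact ENNReal.ofReal_le_ofReal hU2
  · simp only [liftPt_zbar_norSite, enorm_mul, ht', seqNorm_const_mul]
    exact key _ hv.2.2.le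

theorem actionBound {ξ : Fin n → ℝ} (hξ : ξ ∈ paramSet n ρ) {v : Pt j} (hv : InBall a p r v) :
    ActionBound ρ ξ v.y where
  pos := h.rho_pos
  le l := (hξ l).1
  ge l := (hξ l).2
  norm_le l := by
    have h1 : ‖v.y l‖ ≤ ∑ l, ‖v.y l‖ :=
      Finset.single_le_sum (f := fun l => ‖v.y l‖) (fun _ _ => norm_nonneg _) (Finset.mem_univ l)
    linarith [hv.1, h.r_sq_lt, (hξ l).1]

theorem tsum_tanDeg_le {d : ℕ} {F : Coeff noSites} {ε : ℝ≥0∞} (hd : NormalDegreeGE j d F)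
    (hε : ∀ M, F M ≠ 0 → (2 : ℝ≥0∞)⁻¹ ^ (∑ l, tanDeg j M l) ≤ ε) {v : Pt j}
    (hv : InBall a p r v) (l : Fin n) :
    ∑' M, (tanDeg j M l : ℝ≥0∞) * ‖F M‖ₑ * weight 1 (liftPt j (tanRadius s ρ) 1 v) M ≤
      ENNReal.ofReal (2 * tanRadius s ρ * R / (R / (8 * r)) ^ d) *
        (ε * majorantNorm a p 1 (R / 2) (hamVF F)) := by
  have hU := tanRadius_nonneg s ρ
  have hR := h.R_pos
  have hr := h.r_pos
  have ht := h.one_le_scale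
  set U := tanRadius s ρ
  set t := R / (8 * r) with ht_def
  set Q := majorantNorm a p 1 (R / 2) (hamVF F)
  have ht0 : 0 < t ^ d := by positivity
  have hb := h.inBall_liftPt hv (U := 2 * U) (t := t) (by positivity) le_rfl (by positivity) le_rfl
  have h1 : ∀ σ, ENNReal.ofReal (t ^ d) *
      majorant 1 (dzs σ F (tanSite j l)) (liftPt j U 1 v) ≤
        ENNReal.ofReal R * (ε * Q) := by
    intro σ
    have e : ENNReal.ofReal R = 2 * ENNReal.ofReal (R / 2) := by
      rw [← ENNReal.ofReal_ofNat, ← ENNReal.ofReal_mul (by positivity)]; congr 1; ring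
    rw [ENNReal.ofReal_pow (by positivity)]
    refine (majorant_dzs_tanSite_scale h.inj hU ht hd hε v σ l).trans ?_
    calc _ ≤ 2 * ε * (ENNReal.ofReal (R / 2) * Q) := by
          gcongr
          exact (le_seqNorm h.a_nonneg h.p_nonneg (fun s => majorant 1 (dzs σ F s)
            (liftPt j (2 * U) t v)) _).trans (seqNorm_dzs_le (by positivity) F hb σ)
      _ = _ := by rw [e]; ring
  rw [tsum_tanDeg_eq hU]
  have h2 : ENNReal.ofReal (2 * U * R / t ^ d) =
      ENNReal.ofReal U * ((ENNReal.ofReal (t ^ d))⁻¹ * (2 * ENNReal.ofReal R)) := by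
    rw [← ENNReal.ofReal_inv_of_pos ht0, ← ENNReal.ofReal_ofNat, ← ENNReal.ofReal_mul (by positivity),
      ← ENNReal.ofReal_mul (by positivity), ← ENNReal.ofReal_mul (by positivity)]
    congr 1
    field_simp
  rw [h2, mul_assoc]
  gcongr
  rw [mul_assoc, ← ENNReal.mul_le_iff_le_inv (by simpa using ht0) ENNReal.ofReal_ne_top]
  calc _ = _ := mul_add _ _ _
    _ ≤ ENNReal.ofReal R * (ε * Q) + ENNReal.ofReal R * (ε * Q) := add_le_add (h1 1) (h1 (-1))
    _ = _ := by ring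

/-- The composition with the action-angle map is bounded in the majorant norms of the vector
fields. -/
theorem majorantNorm_subst_le {d : ℕ} (hd1 : d ≤ 1) {F : Coeff noSites} {ε : ℝ≥0∞}
    (hd : NormalDegreeGE j d F)
    (hε : ∀ M, F M ≠ 0 → (2 : ℝ≥0∞)⁻¹ ^ (∑ l, tanDeg j M l) ≤ ε) {ξ : Fin n → ℝ}
    (hξ : ξ ∈ paramSet n ρ) :
    majorantNorm a p s r (hamVF (subst j ξ F)) ≤
      ENNReal.ofReal ((48 + 22 * n) / s * (8 * r / R) ^ ((d : ℤ) - 2)) *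
        (ε * majorantNorm a p 1 (R / 2) (hamVF F)) := by
  refine majorantNorm_le fun v hv => ?_
  have hU := tanRadius_nonneg s ρ
  have hR := h.R_pos
  have hr := h.r_pos
  have hs := h.s_pos
  have hs1 := h.s_lt
  have hρ := h.rho_pos
  have ht := h.one_le_scale
  have hUR := h.tanRadius_le
  have hUr := h.tanRadius_mul_le
  have hb := h.actionBound hξ hv
  have hV2 : Real.sqrt (8 * ρ / 7) ^ 2 = 8 * ρ / 7 := Real.sq_sqrt (by positivity)
  have hV := Real.sqrt_nonneg (8 * ρ / 7)
  have hD := fun l => h.tsum_tanDeg_le hd hε hv l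
  have hball := h.inBall_liftPt hv (U := 2 * tanRadius s ρ) (t := R / (8 * r))
    (by positivity) le_rfl (by positivity) le_rfl
  have hx := fun l => majorant_dx_subst_le h.inj hb hs.le hV hV2 F l
  have hy := fun l => majorant_dy_subst_le h.inj hb hs.le hV hV2 F l
  have hz : ∀ σ, seqNorm a p (fun m => majorant s (dzs σ (subst j ξ F) m) v) ≤
      ENNReal.ofReal R * (ε * majorantNorm a p 1 (R / 2) (hamVF F)) := by
    intro σ
    have e : ENNReal.ofReal R = 2 * ENNReal.ofReal (R / 2) := by
      rw [← ENNReal.ofReal_ofNat, ← ENNReal.ofReal_mul (by positivity)]; congr 1; ring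
    calc _ ≤ seqNorm a p (fun m => 2 * ε * majorant 1 (dzs σ F (norSite j m))
            (liftPt j (2 * tanRadius s ρ) (R / (8 * r)) v)) := by
          refine seqNorm_mono fun m => ?_
          rw [dzs_subst]
          exact (majorant_subst_le h.inj hb hs.le hV hV2 _).trans
            (majorant_dzs_norSite_scale h.inj hU ht hε v σ m)
      _ ≤ 2 * ε * (ENNReal.ofReal (R / 2) * majorantNorm a p 1 (R / 2) (hamVF F)) := by
          rw [seqNorm_const_mul]
          gcongr
          exact (seqNorm_norSite_le h.inj (fun m => majorant 1 (dzs σ F m)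
            (liftPt j (2 * tanRadius s ρ) (R / (8 * r)) v))).trans
              (seqNorm_dzs_le (by positivity) F hball σ)
      _ = _ := by rw [e]; ring
  change ∀ l, majorant s (dx (subst j ξ F) l) v ≤
      ∑' M, (tanDeg j M l : ℝ≥0∞) * ‖F M‖ₑ * weight 1 (liftPt j (tanRadius s ρ) 1 v) M at hx
  change ∀ l, majorant s (dy (subst j ξ F) l) v ≤ ENNReal.ofReal (2 / ρ) *
      ∑' M, (tanDeg j M l : ℝ≥0∞) * ‖F M‖ₑ * weight 1 (liftPt j (tanRadius s ρ) 1 v) M at hy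
  set E := ε * majorantNorm a p 1 (R / 2) (hamVF F)
  set U := tanRadius s ρ
  set t := R / (8 * r) with ht_def
  have ht0 : 0 < t := by positivity
  have hRt : R = 8 * r * t := by rw [ht_def]; field_simp
  set D := 2 * U * R / t ^ d with hD_def
  have hD0 : 0 ≤ D := by positivity
  have hY : (⨆ l, majorant s (dy (subst j ξ F) l) v) / ENNReal.ofReal s ≤
      ENNReal.ofReal (2 / ρ * D / s) * E := by
    refine div_ofReal_le hs (iSup_le fun l => (hy l).trans ?_)
    rw [ENNReal.ofReal_mul (by positivity), mul_assoc]
    gcongr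
    exact hD l
  have hX : (∑ l, majorant s (dx (subst j ξ F) l) v) / ENNReal.ofReal (r ^ 2) ≤
      ENNReal.ofReal (n * D / r ^ 2) * E := by
    refine div_ofReal_le (by positivity) ?_
    rw [ENNReal.ofReal_mul (by positivity)]
    calc _ ≤ ∑ _l : Fin n, ENNReal.ofReal D * E :=
          Finset.sum_le_sum fun l _ => (hx l).trans (hD l)
      _ = _ := by simp [mul_assoc]
  have hZ : ∀ σ, seqNorm a p (fun m => majorant s (dzs σ (subst j ξ F) m) v) / ENNReal.ofReal r ≤
      ENNReal.ofReal (R / r) * E := by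
    exact fun σ => div_ofReal_le hr (hz σ)
  refine (add_le_add (add_le_add (add_le_add hY hX) (hZ _)) (hZ _)).trans ?_
  rw [← add_mul, ← add_mul, ← add_mul, ← ENNReal.ofReal_add (by positivity) (by positivity),
    ← ENNReal.ofReal_add (by positivity) (by positivity),
    ← ENNReal.ofReal_add (by positivity) (by positivity)]
  gcongr
  have e1 : (8 * r / R) ^ ((d : ℤ) - 2) = t ^ 2 / t ^ d := by
    have : 8 * r / R = t⁻¹ := by rw [ht_def, inv_div]
    rw [this, zpow_sub₀ (by positivity)]
    simp [div_eq_mul_inv, mul_comm]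
  have htd : t ^ d ≤ t := by
    calc t ^ d ≤ t ^ 1 := pow_le_pow_right₀ ht hd1
      _ = t := pow_one t
  rw [e1]
  have b1 : 2 / ρ * D / s ≤ 32 / s * (t ^ 2 / t ^ d) := by
    have : U / ρ ≤ 1 / r := by rw [div_le_div_iff₀ hρ hr]; linarith
    calc 2 / ρ * D / s = (U / ρ) * (4 * R / s / t ^ d) := by rw [hD_def]; field_simp; ring
      _ ≤ (1 / r) * (4 * R / s / t ^ d) := by gcongr
      _ = 32 / s * (t / t ^ d) := by rw [hRt]; field_simp; ring
      _ ≤ _ := by gcongr; nlinarith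
  have b2 : n * D / r ^ 2 ≤ 22 * n / s * (t ^ 2 / t ^ d) := by
    calc n * D / r ^ 2 = n * (2 * U * R / t ^ d) / r ^ 2 := rfl
      _ ≤ n * (2 * (R / 6) * R / t ^ d) / r ^ 2 := by gcongr
      _ = (64 / 3) * n / 1 * (t ^ 2 / t ^ d) := by rw [hRt]; field_simp; ring
      _ ≤ _ := by gcongr; norm_num
  have b3 : R / r ≤ 8 / s * (t ^ 2 / t ^ d) := by
    calc R / r = 8 / 1 * t := by rw [hRt]; field_simp
      _ ≤ 8 / s * (t ^ 2 / t ^ d) := by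
        gcongr
        rw [le_div_iff₀ (by positivity)]
        nlinarith
  calc _ ≤ 32 / s * (t ^ 2 / t ^ d) + 22 * n / s * (t ^ 2 / t ^ d) + 8 / s * (t ^ 2 / t ^ d) +
        8 / s * (t ^ 2 / t ^ d) := by gcongr
    _ = _ := by ring

end Radii

theorem summable_of_tsum_enorm_ne_top {ι : Type*} {f : ι → ℂ} (h : ∑' i, ‖f i‖ₑ ≠ ∞) :
    Summable f := by
  apply Summable.of_nnnorm
  rw [← ENNReal.tsum_coe_ne_top_iff_summable]
  exact h

theorem tsum_enorm_ne_top {ι : Type*} {f : ι → ℂ} (h : Summable f) : ∑' i, ‖f i‖ₑ ≠ ∞ :=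
  ENNReal.tsum_coe_ne_top_iff_summable.2
    (NNReal.summable_coe.1 (by simpa only [coe_nnnorm] using h.norm) : Summable fun i => ‖f i‖₊)

section points

variable {n : ℕ} {j : Fin n → ℤ}

theorem seqNorm_indicator_ne_top (a p : ℝ) (S : Finset (Site j)) :
    seqNorm a p (fun m => if m ∈ S then 1 else 0) ≠ ∞ := by
  intro h
  have h1 := seqNorm_sq (a := a) (p := p) (fun m : Site j => if m ∈ S then 1 else 0)
  rw [h, tsum_eq_sum (s := S) fun m hm => by simp [hm]] at h1
  have h2 : ∑ m ∈ S, (if m ∈ S then (1 : ℝ≥0∞) else 0) ^ 2 *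
      ENNReal.ofReal (siteWeight a p m) ≠ ∞ := by
    refine ENNReal.sum_ne_top.2 fun m hm => ?_
    simp [hm]
  exact h2 (h1.symm.trans (by simp))

theorem prod_pow_ne_zero {σ : Type*} (A : σ →₀ ℕ) (f : σ → ℝ≥0∞) (h : ∀ m ∈ A.support, f m ≠ 0)
    : (A.prod fun m e => f m ^ e) ≠ 0 :=
  Finset.prod_ne_zero_iff.2 fun m hm => pow_ne_zero _ (h m hm)

/-- A point of the ball at which a given monomial does not vanish. -/
theorem exists_inBall_weight_ne_zero (a p s : ℝ) {r : ℝ} (hr : 0 < r) (ν : Index j) :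
    ∃ v : Pt j, InBall a p r v ∧ weight s v ν ≠ 0 := by
  set C := fun S : Finset (Site j) => (seqNorm a p fun m => if m ∈ S then 1 else 0).toReal
  set S := ν.α.support
  set S' := ν.β.support
  set δ := min (r ^ 2 / (n + 1)) (r / (C S + C S' + 1))
  have hC : ∀ S, 0 ≤ C S := fun S => ENNReal.toReal_nonneg
  have hδ : 0 < δ := lt_min (by positivity) (by have := hC S; have := hC S'; positivity)
  have hδ' : ‖(δ : ℂ)‖ₑ = ENNReal.ofReal δ := by
    rw [← ofReal_norm, Complex.norm_real, Real.norm_of_nonneg hδ.le]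
  have hδ0 : ‖(δ : ℂ)‖ₑ ≠ 0 := by simp [hδ.ne']
  have key : ∀ T, C T ≤ C S + C S' → seqNorm a p (fun m => ‖if m ∈ T then (δ : ℂ) else 0‖ₑ) <
      ENNReal.ofReal r := by
    intro T hT
    have e : (fun m : Site j => ‖if m ∈ T then (δ : ℂ) else 0‖ₑ) =
        fun m => ENNReal.ofReal δ * if m ∈ T then 1 else 0 := by
      funext m; split_ifs <;> simp [hδ']
    rw [e, seqNorm_const_mul, ← ENNReal.ofReal_toReal (seqNorm_indicator_ne_top a p T),
      ← ENNReal.ofReal_mul hδ.le, ENNReal.ofReal_lt_ofReal_iff hr]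
    have h1 : 0 ≤ C S + C S' := add_nonneg (hC _) (hC _)
    calc δ * C T ≤ r / (C S + C S' + 1) * (C S + C S') := by
          gcongr
          exact min_le_right _ _
      _ < r := by
          rw [div_mul_eq_mul_div, div_lt_iff₀ (by positivity)]
          nlinarith
  refine ⟨⟨0, fun _ => δ, fun m => if m ∈ S then δ else 0, fun m => if m ∈ S' then δ else 0⟩,
    ⟨?_, key S (le_add_of_nonneg_right (hC _)), key S' (le_add_of_nonneg_left (hC _))⟩, ?_⟩
  · simp only [Complex.norm_real, Real.norm_of_nonneg hδ.le, Finset.sum_const, Finset.card_univ,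
      Fintype.card_fin, nsmul_eq_mul]
    calc n * δ ≤ n * (r ^ 2 / (n + 1)) := by gcongr; exact min_le_left _ _
      _ < r ^ 2 := by
        rw [← mul_div_assoc, div_lt_iff₀ (by positivity)]
        nlinarith [pow_pos hr 2]
  · refine mul_ne_zero (mul_ne_zero (mul_ne_zero ?_ ?_) ?_) ?_
    · simp [Real.exp_pos]
    · exact Finset.prod_ne_zero_iff.2 fun l _ => pow_ne_zero _ hδ0
    · refine prod_pow_ne_zero _ _ fun m hm => ?_
      have : m ∈ S := hm
      simp only [this, if_true]; exact hδ0
    · refine prod_pow_ne_zero _ _ fun m hm => ?_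
      have : m ∈ S' := hm
      simp only [this, if_true]; exact hδ0

theorem eq_of_res_eq {M M' : Index noSites} {i : Fin n → ℕ} (h : res j M i = res j M' i)
    (h1 : ∀ l, tanDeg j M l = 0) (h2 : ∀ l, tanDeg j M' l = 0) : M = M' := by
  refine Index.ext_deg (Subsingleton.elim _ _) (Subsingleton.elim _ _) fun σ s => ?_
  rcases site_cases (j := j) s with ⟨l, rfl⟩ | ⟨m, rfl⟩
  · have h1' := h1 l
    have h2' := h2 l
    rw [tanDeg_eq] at h1' h2'
    rcases Int.units_eq_one_or σ with rfl | rfl <;> omega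
  · rw [← deg_res σ m M i, h, deg_res]

end points

section linearity

variable {n : ℕ} (j : Fin n → ℤ)

open Classical in
/-- The terms of the series that defines a coefficient of `F ∘ Φ`. -/
def substTerm (ξ : Fin n → ℝ) (F : Coeff noSites) (ν : Index j) (M : Index noSites) : ℂ :=
  if res j M ν.i = ν then F M * actionCoeff j ξ M ν.i else 0

/-- The series that define the coefficients of `F ∘ Φ` converge. -/
def Substitutable (ξ : Fin n → ℝ) (F : Coeff noSites) : Prop :=
  ∀ ν, Summable (substTerm j ξ F ν)

variable {j} {ξ : Fin n → ℝ} {F G : Coeff noSites}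

theorem subst_apply (F : Coeff noSites) (ν : Index j) :
    subst j ξ F ν = ∑' M, substTerm j ξ F ν M := rfl

theorem substTerm_smul (c : ℂ) (F : Coeff noSites) (ν : Index j) (M : Index noSites) :
    substTerm j ξ (fun M => c * F M) ν M = c * substTerm j ξ F ν M := by
  unfold substTerm; split_ifs <;> ring

theorem substTerm_add (F G : Coeff noSites) (ν : Index j) (M : Index noSites) :
    substTerm j ξ (F + G) ν M = substTerm j ξ F ν M + substTerm j ξ G ν M := by
  unfold substTerm; split_ifs
  · simp only [Pi.add_apply]; ring
  · simp

theorem subst_smul (c : ℂ) (F : Coeff noSites) (ν : Index j) :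
    subst j ξ (fun M => c * F M) ν = c * subst j ξ F ν := by
  simp only [subst_apply, substTerm_smul, tsum_mul_left]

theorem Substitutable.subst_add (hF : Substitutable j ξ F) (hG : Substitutable j ξ G)
    (ν : Index j) : subst j ξ (F + G) ν = subst j ξ F ν + subst j ξ G ν := by
  simp only [subst_apply, substTerm_add]
  exact (hF ν).tsum_add (hG ν)

theorem Substitutable.subst_sub (hF : Substitutable j ξ F) (hG : Substitutable j ξ G)
    (ν : Index j) : subst j ξ (fun M => F M - G M) ν = subst j ξ F ν - subst j ξ G ν := by
  simp only [subst_apply]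
  rw [← (hF ν).tsum_sub (hG ν)]
  refine tsum_congr fun M => ?_
  unfold substTerm; split_ifs
  · ring
  · simp

theorem Substitutable.of_norm_le (hF : Substitutable j ξ F) (h : ∀ M, ‖G M‖ ≤ ‖F M‖) :
    Substitutable j ξ G := fun ν => by
  refine Summable.of_norm_bounded (hF ν).norm fun M => ?_
  unfold substTerm; split_ifs
  · rw [norm_mul, norm_mul]; gcongr; exact h M
  · simp

end linearity

namespace Radii

variable {n : ℕ} {j : Fin n → ℤ} {κ : ℕ} {a p s r R ρ : ℝ} (h : Radii j κ a p s r R ρ)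
include h

theorem substitutable {F : Coeff noSites} (hF : majorantNorm a p 1 (R / 2) (hamVF F) < ∞)
    {ξ : Fin n → ℝ} (hξ : ξ ∈ paramSet n ρ) : Substitutable j ξ F := by
  classical
  intro ν
  obtain ⟨v, hv, hv0⟩ := exists_inBall_weight_ne_zero (j := j) a p s h.r_pos ν
  have hb := h.actionBound hξ hv
  have hρ := h.rho_pos
  have hV2 : Real.sqrt (8 * ρ / 7) ^ 2 = 8 * ρ / 7 := Real.sq_sqrt (by positivity)
  have hV := Real.sqrt_nonneg (8 * ρ / 7)
  have hD : ∀ l, ∑' M, (tanDeg j M l : ℝ≥0∞) * ‖F M‖ₑ *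
      weight 1 (liftPt j (tanRadius s ρ) 1 v) M ≠ ∞ := fun l => by
    refine ne_top_of_le_ne_top ?_ (h.tsum_tanDeg_le (d := 0) (ε := 1) (F := F)
      (fun _ _ => Nat.zero_le _) (fun M _ => pow_le_one₀ zero_le (by simp)) hv l)
    exact ENNReal.mul_ne_top ENNReal.ofReal_ne_top (ENNReal.mul_ne_top ENNReal.one_ne_top hF.ne)
  set g0 : Index noSites → ℝ≥0∞ := fun M =>
    if ∑ l, tanDeg j M l = 0 then ‖substTerm j ξ F ν M‖ₑ else 0
  set g1 : Index noSites → ℝ≥0∞ := fun M => ∑ l, (tanDeg j M l : ℝ≥0∞) * ‖substTerm j ξ F ν M‖ₑ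
  have hg : ∀ M, ‖substTerm j ξ F ν M‖ₑ ≤ g0 M + g1 M := by
    intro M
    by_cases hM : ∑ l, tanDeg j M l = 0
    · exact le_add_right (by simp only [g0, if_pos hM, le_refl])
    · refine le_add_left ?_
      simp only [g1, ← Finset.sum_mul]
      refine le_mul_of_one_le_left' ?_
      exact_mod_cast Nat.one_le_iff_ne_zero.2 hM
  have h0 : ∑' M, g0 M ≠ ∞ := by
    by_cases hM : ∃ M, g0 M ≠ 0
    · obtain ⟨M, hM⟩ := hM
      have aux : ∀ M, g0 M ≠ 0 → res j M ν.i = ν ∧ ∀ l, tanDeg j M l = 0 := by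
        intro M hM
        have h1 : ∑ l, tanDeg j M l = 0 := by
          by_contra hc; exact hM (if_neg hc)
        refine ⟨?_, fun l => (Finset.sum_eq_zero_iff.1 h1) l (Finset.mem_univ l)⟩
        by_contra hc
        simp [g0, substTerm, hc] at hM
      rw [tsum_eq_single M]
      · simp only [g0]; split_ifs <;> simp
      · intro M' hne
        by_contra hM'
        obtain ⟨e1, e2⟩ := aux M hM
        obtain ⟨e3, e4⟩ := aux M' hM'
        exact hne (eq_of_res_eq (e3.trans e1.symm) e4 e2)
    · push Not at hM
      simp [hM]
  have h1 : ∑' M, g1 M ≠ ∞ := by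
    have h2 : (∑' M, g1 M) * weight s v ν ≤ ∑ l, ∑' M, (tanDeg j M l : ℝ≥0∞) * ‖F M‖ₑ *
        weight 1 (liftPt j (tanRadius s ρ) 1 v) M := by
      simp only [g1]
      rw [Summable.tsum_finsetSum fun _ _ => ENNReal.summable, Finset.sum_mul]
      refine Finset.sum_le_sum fun l _ => ?_
      rw [← ENNReal.tsum_mul_right]
      refine ENNReal.tsum_le_tsum fun M => ?_
      by_cases hM : res j M ν.i = ν
      · rw [substTerm, if_pos hM, enorm_mul, mul_assoc, mul_assoc, mul_assoc]
        gcongr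
        refine le_trans ?_ (tsum_actionCoeff_mul_weight_le h.inj hb h.s_pos.le hV hV2 M)
        refine le_trans ?_ (ENNReal.le_tsum ν.i)
        rw [hM]
      · rw [substTerm, if_neg hM]; simp
    have h3 : (∑' M, g1 M) * weight s v ν ≠ ∞ :=
      ne_top_of_le_ne_top (ENNReal.sum_ne_top.2 fun l _ => hD l) h2
    intro hc
    rw [hc, ENNReal.top_mul hv0] at h3
    exact h3 rfl
  refine summable_of_tsum_enorm_ne_top (ne_top_of_le_ne_top ?_ (ENNReal.tsum_le_tsum hg))
  rw [ENNReal.tsum_add]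
  exact ENNReal.add_ne_top.2 ⟨h0, h1⟩

end Radii

section expansion

variable {n : ℕ} {j : Fin n → ℤ}

theorem actionAngle_z_tanSite (hj : Function.Injective j) (ξ : Fin n → ℝ) (v : Pt j) (l : Fin n) :
    (actionAngle j ξ v).z (tanSite j l) =
      ((ξ l : ℂ) + v.y l) ^ (1 / 2 : ℂ) * Complex.exp (Complex.I * v.x l) := by
  have h : ∃ l', j l' = ((tanSite j l : Site noSites) : ℤ) := ⟨l, rfl⟩
  have hc : h.choose = l := hj h.choose_spec
  simp only [actionAngle, dif_pos h]
  rw [hc]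

theorem actionAngle_zbar_tanSite (hj : Function.Injective j) (ξ : Fin n → ℝ) (v : Pt j)
    (l : Fin n) : (actionAngle j ξ v).zbar (tanSite j l) =
      ((ξ l : ℂ) + v.y l) ^ (1 / 2 : ℂ) * Complex.exp (-(Complex.I * v.x l)) := by
  have h : ∃ l', j l' = ((tanSite j l : Site noSites) : ℤ) := ⟨l, rfl⟩
  have hc : h.choose = l := hj h.choose_spec
  simp only [actionAngle, dif_pos h]
  rw [hc]

theorem actionAngle_z_norSite (ξ : Fin n → ℝ) (v : Pt j) (m : Site j) :
    (actionAngle j ξ v).z (norSite j m) = v.z m := by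
  have := not_exists_eq_normal m
  simp [actionAngle, this]

theorem actionAngle_zbar_norSite (ξ : Fin n → ℝ) (v : Pt j) (m : Site j) :
    (actionAngle j ξ v).zbar (norSite j m) = v.zbar m := by
  have := not_exists_eq_normal m
  simp [actionAngle, this]

theorem enorm_prod_pow {σ : Type*} (A : σ →₀ ℕ) (f : σ → ℂ) :
    ‖A.prod fun m e => f m ^ e‖ₑ = A.prod fun m e => ‖f m‖ₑ ^ e := by
  simp only [Finsupp.prod, ← ofReal_norm, norm_prod, norm_pow]
  rw [ENNReal.ofReal_prod_of_nonneg fun m _ => by positivity]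
  exact Finset.prod_congr rfl fun m _ => ENNReal.ofReal_pow (norm_nonneg _) _

theorem enorm_monomial_le {s : ℝ} {v : Pt j} (hv : ∀ l, |(v.x l).im| ≤ s)
    (ν : Index j) : ‖monomial ν v‖ₑ ≤ weight s v ν := by
  rw [monomial, weight, enorm_mul, enorm_mul, enorm_mul, enorm_prod_pow, enorm_prod_pow]
  have h1 : ‖∏ l, v.y l ^ ν.i l‖ₑ = ∏ l, ‖v.y l‖ₑ ^ ν.i l := by
    simp only [← ofReal_norm, norm_prod, norm_pow]
    rw [ENNReal.ofReal_prod_of_nonneg fun m _ => by positivity]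
    exact Finset.prod_congr rfl fun m _ => ENNReal.ofReal_pow (norm_nonneg _) _
  rw [h1]
  gcongr
  rw [← ofReal_norm, Complex.norm_exp]
  apply ENNReal.ofReal_le_ofReal
  apply Real.exp_le_exp.2
  simp only [Complex.mul_re, Complex.I_re, zero_mul, Complex.I_im, one_mul, zero_sub,
    Complex.im_sum, Complex.mul_im, Complex.intCast_re, Complex.intCast_im, add_zero]
  rw [Finset.mul_sum, ← Finset.sum_neg_distrib]
  refine Finset.sum_le_sum fun l _ => ?_
  calc -((ν.k l : ℝ) * (v.x l).im) ≤ |(ν.k l : ℝ) * (v.x l).im| := neg_le_abs _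
    _ = |(v.x l).im| * |(ν.k l : ℝ)| := by rw [abs_mul, mul_comm]
    _ ≤ _ := by gcongr; exact hv l

theorem enorm_monomial_noSites (s : ℝ) (v : Pt noSites) (M : Index noSites) :
    ‖monomial M v‖ₑ = weight s v M := by
  rw [monomial, weight, enorm_mul, enorm_mul, enorm_mul, enorm_prod_pow, enorm_prod_pow]
  simp

theorem hasSum_actionCoeff_mul_monomial (hj : Function.Injective j) {ρ : ℝ} {ξ : Fin n → ℝ}
    {v : Pt j} (hb : ActionBound ρ ξ v.y) (M : Index noSites) :
    HasSum (fun i => actionCoeff j ξ M i * monomial (res j M i) v)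
      (monomial M (actionAngle j ξ v)) := by
  have h1 := hasSum_pi_prod fun l => hasSum_halfPowCoeff (tanDeg j M l)
    (x := ξ l) (y := v.y l) (by linarith [hb.pos, hb.le l])
    (by linarith [hb.pos, hb.le l, hb.norm_le l])
  have h2 := h1.mul_right (Complex.exp (Complex.I * ∑ l, ((res j M 0).k l : ℂ) * v.x l) *
    (((restrict j M.α).prod fun m e => v.z m ^ e) * (restrict j M.β).prod fun m e => v.zbar m ^ e))
  have e : monomial M (actionAngle j ξ v) = (∏ l, (((ξ l : ℂ) + v.y l) ^ (1 / 2 : ℂ)) ^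
      tanDeg j M l) * (Complex.exp (Complex.I * ∑ l, ((res j M 0).k l : ℂ) * v.x l) *
    (((restrict j M.α).prod fun m e => v.z m ^ e) *
      (restrict j M.β).prod fun m e => v.zbar m ^ e)) := by
    rw [monomial, prod_site hj M.α (fun m e => (actionAngle j ξ v).z m ^ e) (by simp),
      prod_site hj M.β (fun m e => (actionAngle j ξ v).zbar m ^ e) (by simp)]
    simp only [Finset.univ_eq_empty, Finset.sum_empty, Finset.prod_empty, mul_zero,
      Complex.exp_zero, one_mul, actionAngle_z_tanSite hj, actionAngle_zbar_tanSite hj,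
      actionAngle_z_norSite, actionAngle_zbar_norSite, mul_pow, Finset.prod_mul_distrib,
      tanDeg, pow_add, ← Complex.exp_nat_mul, ← Complex.exp_sum]
    have e2 : Complex.exp (Complex.I * ∑ l, ((res j M 0).k l : ℂ) * v.x l) =
        Complex.exp (∑ l, (M.α (tanSite j l) : ℂ) * (Complex.I * v.x l)) *
          Complex.exp (∑ l, (M.β (tanSite j l) : ℂ) * -(Complex.I * v.x l)) := by
      rw [← Complex.exp_add, ← Finset.sum_add_distrib, Finset.mul_sum]
      congr 1
      refine Finset.sum_congr rfl fun l _ => ?_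
      rw [res_k]
      push_cast
      ring
    rw [e2]
    ring
  rw [e]
  refine hasSum_of_eq h2 fun i => ?_
  rw [monomial, Finset.prod_mul_distrib, actionCoeff, res_α, res_β, res_i]
  simp only [res_k]
  ring

theorem norm_cpow_half_sq (w : ℂ) : ‖w ^ (1 / 2 : ℂ)‖ ^ 2 = ‖w‖ := by
  rw [← norm_pow, ← Complex.cpow_nat_mul]
  norm_num

end expansion

namespace Radii

variable {n : ℕ} {j : Fin n → ℤ} {κ : ℕ} {a p s r R ρ : ℝ} (h : Radii j κ a p s r R ρ)
include h

theorem norm_actionAngle_le {ξ : Fin n → ℝ} (hξ : ξ ∈ paramSet n ρ) {v : Pt j}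
    (hv : InDomain a p s r v) (l : Fin n) (z : ℂ) (hz : |z.re| ≤ s) :
    ‖((ξ l : ℂ) + v.y l) ^ (1 / 2 : ℂ) * Complex.exp z‖ₑ ≤
      ENNReal.ofReal (2 * tanRadius s ρ) := by
  have hb := h.actionBound hξ hv.2
  have hρ := h.rho_pos
  rw [← ofReal_norm, norm_mul, Complex.norm_exp]
  apply ENNReal.ofReal_le_ofReal
  have h1 : ‖((ξ l : ℂ) + v.y l) ^ (1 / 2 : ℂ)‖ ≤ Real.sqrt (8 * ρ / 7) := by
    apply Real.le_sqrt_of_sq_le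
    rw [norm_cpow_half_sq]
    refine (norm_add_le _ _).trans ?_
    rw [Complex.norm_real, Real.norm_of_nonneg (by linarith [hb.le l])]
    linarith [hb.norm_le l, hb.ge l]
  have h2 : Real.exp z.re ≤ Real.exp s := Real.exp_le_exp.2 ((le_abs_self _).trans hz)
  calc _ ≤ Real.sqrt (8 * ρ / 7) * Real.exp s := by gcongr
    _ = tanRadius s ρ := rfl
    _ ≤ _ := by linarith [tanRadius_nonneg s ρ]

theorem inDomain_actionAngle {ξ : Fin n → ℝ} (hξ : ξ ∈ paramSet n ρ) {v : Pt j}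
    (hv : InDomain a p s r v) : InDomain a p 1 (R / 2) (actionAngle j ξ v) := by
  have hR := h.R_pos
  have hrR : r ≤ R / 8 := by
    have h1 := h.one_le_scale
    rw [one_le_div (by linarith [h.r_pos])] at h1
    linarith
  refine ⟨fun l => l.elim0, by simpa using by positivity, h.seqNorm_lt (fun l => ?_) ?_,
    h.seqNorm_lt (fun l => ?_) ?_⟩
  · rw [actionAngle_z_tanSite h.inj]
    exact h.norm_actionAngle_le hξ hv l _ (by simpa using (hv.1 l).le)
  · simp only [actionAngle_z_norSite]
    exact hv.2.2.1.le.trans (ENNReal.ofReal_le_ofReal hrR)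
  · rw [actionAngle_zbar_tanSite h.inj]
    exact h.norm_actionAngle_le hξ hv l _ (by simpa using (hv.1 l).le)
  · simp only [actionAngle_zbar_norSite]
    exact hv.2.2.2.le.trans (ENNReal.ofReal_le_ofReal hrR)

theorem hasExpansion_subst {F : Pt noSites → ℂ} {Fc : Coeff noSites}
    (hF : HasExpansion a p 1 (R / 2) F Fc) {ξ : Fin n → ℝ} (hξ : ξ ∈ paramSet n ρ) :
    HasExpansion a p s r (fun v => F (actionAngle j ξ v)) (subst j ξ Fc) := by
  classical
  intro v hv
  have hb := h.actionBound hξ hv.2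
  have hρ := h.rho_pos
  have hU := tanRadius_nonneg s ρ
  have hV2 : Real.sqrt (8 * ρ / 7) ^ 2 = 8 * ρ / 7 := Real.sq_sqrt (by positivity)
  have hV := Real.sqrt_nonneg (8 * ρ / 7)
  have hfin : ∑' M, ‖Fc M‖ₑ * weight 1 (liftPt j (tanRadius s ρ) 1 v) M ≠ ∞ := by
    have h1 := tsum_enorm_ne_top (hF (liftPt j (tanRadius s ρ) 1 v) ⟨fun l => l.elim0,
      h.inBall_liftPt hv.2 hU (by linarith) zero_le_one h.one_le_scale⟩).summable
    simpa only [enorm_mul, enorm_monomial_noSites 1] using h1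
  set φ : Index j × Index noSites → ℂ := fun x => substTerm j ξ Fc x.1 x.2 * monomial x.1 v
    with hφ
  have hs : Summable φ := by
    refine summable_of_tsum_enorm_ne_top (ne_top_of_le_ne_top hfin ?_)
    rw [ENNReal.tsum_prod']
    calc _ = ∑' ν : Index j, ∑' M, (if res j M ν.i = ν then ‖Fc M * actionCoeff j ξ M ν.i‖ₑ *
            ‖monomial ν v‖ₑ else 0) := by
          refine tsum_congr fun ν => tsum_congr fun M => ?_
          simp only [hφ, substTerm, enorm_mul]
          split_ifs <;> simp
      _ = ∑' M, ∑' i, ‖Fc M * actionCoeff j ξ M i‖ₑ * ‖monomial (res j M i) v‖ₑ :=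
          tsum_res_eq (fun M i => ‖Fc M * actionCoeff j ξ M i‖ₑ) (fun ν => ‖monomial ν v‖ₑ)
      _ ≤ _ := by
          refine ENNReal.tsum_le_tsum fun M => ?_
          simp only [enorm_mul, mul_assoc, ENNReal.tsum_mul_left]
          gcongr
          refine le_trans (ENNReal.tsum_le_tsum fun i => ?_)
            (tsum_actionCoeff_mul_weight_le h.inj hb h.s_pos.le hV hV2 M)
          gcongr
          exact enorm_monomial_le (fun l => (hv.1 l).le) _
  have h1 : ∑' x, φ x = F (actionAngle j ξ v) := by
    rw [← (hF _ (h.inDomain_actionAngle hξ hv)).tsum_eq, ← (Equiv.prodComm _ _).tsum_eq]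
    refine ((Equiv.prodComm _ _).summable_iff.2 hs).tsum_prod.trans ?_
    refine tsum_congr fun M => ?_
    rw [← (hasSum_actionCoeff_mul_monomial h.inj hb M).tsum_eq, ← tsum_mul_left,
      ← (res_injective (j := j) M).tsum_eq]
    · refine tsum_congr fun i => ?_
      simp [hφ, substTerm, mul_assoc]
    · intro ν hν
      by_contra hc
      have : res j M ν.i ≠ ν := fun he => hc ⟨ν.i, he⟩
      simp [hφ, substTerm, this] at hν
  change HasSum _ (F (actionAngle j ξ v))
  rw [← h1]
  refine hasSum_of_eq (hs.hasSum.prod_fiberwise fun ν => (hs.prod_factor ν).hasSum) fun ν => ?_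
  rw [subst_apply, ← tsum_mul_right]

end Radii

section norms

variable {n : ℕ} {j : Fin n → ℤ} {a p s r : ℝ}

theorem seqNorm_eq_rpow (w : Site j → ℝ≥0∞) : seqNorm a p w =
    (∑' m : Site j, (w m * ENNReal.ofReal (siteWeight a p m) ^ (1 / 2 : ℝ)) ^ (2 : ℝ)) ^
      (1 / 2 : ℝ) := by
  rw [seqNorm]
  congr 1
  refine tsum_congr fun m => ?_
  rw [ENNReal.mul_rpow_of_nonneg _ _ zero_le_two, ← ENNReal.rpow_mul]
  norm_num
  rfl

theorem seqNorm_add_le (w w' : Site j → ℝ≥0∞) :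
    seqNorm a p (fun m => w m + w' m) ≤ seqNorm a p w + seqNorm a p w' := by
  let _ : MeasurableSpace (Site j) := ⊤
  have : MeasurableSingletonClass (Site j) := ⟨fun _ => trivial⟩
  have h := ENNReal.lintegral_Lp_add_le (μ := (MeasureTheory.Measure.count : MeasureTheory.Measure (Site j)))
    (f := fun m => w m * ENNReal.ofReal (siteWeight a p m) ^ (1 / 2 : ℝ))
    (g := fun m => w' m * ENNReal.ofReal (siteWeight a p m) ^ (1 / 2 : ℝ)) (p := 2)
    (Measurable.aemeasurable fun _ _ => trivial) (Measurable.aemeasurable fun _ _ => trivial) one_le_two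
  simp only [MeasureTheory.lintegral_count] at h
  simp only [seqNorm_eq_rpow, add_mul]
  exact h

theorem majorant_mono {c c' : Coeff j} (h : ∀ ν, ‖c ν‖ ≤ ‖c' ν‖) (v : Pt j) :
    majorant s c v ≤ majorant s c' v := by
  rw [majorant_eq, majorant_eq]
  refine ENNReal.tsum_le_tsum fun ν => ?_
  gcongr
  rw [← ofReal_norm, ← ofReal_norm]
  exact ENNReal.ofReal_le_ofReal (h ν)

theorem majorant_add_le (c c' : Coeff j) (v : Pt j) :
    majorant s (c + c') v ≤ majorant s c v + majorant s c' v := by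
  rw [majorant_eq, majorant_eq, majorant_eq, ← ENNReal.tsum_add]
  refine ENNReal.tsum_le_tsum fun ν => ?_
  rw [← add_mul]
  gcongr
  exact enorm_add_le _ _

theorem majorant_smul (z : ℂ) (c : Coeff j) (v : Pt j) :
    majorant s (fun ν => z * c ν) v = ‖z‖ₑ * majorant s c v := by
  simp only [majorant_eq, enorm_mul, mul_assoc, ENNReal.tsum_mul_left]

theorem le_majorantNorm {c : Coeff j} {v : Pt j} (hv : InBall a p r v) :
    (⨆ l, majorant s (dy c l) v) / ENNReal.ofReal s +
      (∑ l, majorant s (dx c l) v) / ENNReal.ofReal (r ^ 2) +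
      seqNorm a p (fun m => majorant s (dzs (-1) c m) v) / ENNReal.ofReal r +
      seqNorm a p (fun m => majorant s (dzs 1 c m) v) / ENNReal.ofReal r ≤
        majorantNorm a p s r (hamVF c) :=
  (weightedNorm_hamVF s r c v).symm.trans_le (le_iSup₂_of_le v hv le_rfl)

theorem majorantNorm_mono {c c' : Coeff j} (h : ∀ ν, ‖c ν‖ ≤ ‖c' ν‖) :
    majorantNorm a p s r (hamVF c) ≤ majorantNorm a p s r (hamVF c') := by
  refine majorantNorm_le fun v hv => le_trans ?_ (le_majorantNorm hv)
  have hz : ∀ σ m, majorant s (dzs σ c m) v ≤ majorant s (dzs σ c' m) v := fun σ m =>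
    majorant_mono (fun ν => by
      rw [dzs, dzs, norm_mul, norm_mul]
      exact mul_le_mul_of_nonneg_left (h _) (norm_nonneg _)) v
  have hx : ∀ l, majorant s (dx c l) v ≤ majorant s (dx c' l) v := fun l =>
    majorant_mono (fun ν => by
      rw [dx, dx, norm_mul, norm_mul (Complex.I * _)]
      exact mul_le_mul_of_nonneg_left (h _) (norm_nonneg _)) v
  have hy : ∀ l, majorant s (dy c l) v ≤ majorant s (dy c' l) v := fun l =>
    majorant_mono (fun ν => by
      rw [dy, dy, norm_mul, norm_mul]
      exact mul_le_mul_of_nonneg_left (h _) (norm_nonneg _)) v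
  gcongr
  · exact hy _
  · exact hx _
  · exact seqNorm_mono (hz _)
  · exact seqNorm_mono (hz _)

theorem majorantNorm_add_le (c c' : Coeff j) : majorantNorm a p s r (hamVF (c + c')) ≤
    majorantNorm a p s r (hamVF c) + majorantNorm a p s r (hamVF c') := by
  refine majorantNorm_le fun v hv => le_trans ?_ (add_le_add (le_majorantNorm hv)
    (le_majorantNorm hv))
  have hz : ∀ σ, seqNorm a p (fun m => majorant s (dzs σ (c + c') m) v) ≤
      seqNorm a p (fun m => majorant s (dzs σ c m) v) +
        seqNorm a p (fun m => majorant s (dzs σ c' m) v) := fun σ => by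
    refine le_trans (seqNorm_mono fun m => ?_) (seqNorm_add_le _ _)
    have e : dzs σ (c + c') m = dzs σ c m + dzs σ c' m := by
      funext ν; simp only [dzs, Pi.add_apply, mul_add]
    rw [e]
    exact majorant_add_le _ _ _
  have hx : ∑ l, majorant s (dx (c + c') l) v ≤
      ∑ l, majorant s (dx c l) v + ∑ l, majorant s (dx c' l) v := by
    rw [← Finset.sum_add_distrib]
    refine Finset.sum_le_sum fun l _ => ?_
    have e : dx (c + c') l = dx c l + dx c' l := by
      funext ν; simp only [dx, Pi.add_apply, mul_add]
    rw [e]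
    exact majorant_add_le _ _ _
  have hy : ⨆ l, majorant s (dy (c + c') l) v ≤
      (⨆ l, majorant s (dy c l) v) + ⨆ l, majorant s (dy c' l) v := by
    refine iSup_le fun l => le_trans ?_ (add_le_add (le_iSup _ l) (le_iSup _ l))
    have e : dy (c + c') l = dy c l + dy c' l := by
      funext ν; simp only [dy, Pi.add_apply, mul_add]
    rw [e]
    exact majorant_add_le _ _ _
  calc _ ≤ ((⨆ l, majorant s (dy c l) v) + ⨆ l, majorant s (dy c' l) v) / ENNReal.ofReal s +
      (∑ l, majorant s (dx c l) v + ∑ l, majorant s (dx c' l) v) / ENNReal.ofReal (r ^ 2) +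
      (seqNorm a p (fun m => majorant s (dzs (-1) c m) v) +
        seqNorm a p (fun m => majorant s (dzs (-1) c' m) v)) / ENNReal.ofReal r +
      (seqNorm a p (fun m => majorant s (dzs 1 c m) v) +
        seqNorm a p (fun m => majorant s (dzs 1 c' m) v)) / ENNReal.ofReal r := by
        gcongr
        · exact hz _
        · exact hz _
    _ = _ := by simp only [ENNReal.add_div]; ring

theorem majorantNorm_smul_le (z : ℂ) (c : Coeff j) :
    majorantNorm a p s r (hamVF fun ν => z * c ν) ≤ ‖z‖ₑ * majorantNorm a p s r (hamVF c) := by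
  refine majorantNorm_le fun v hv => le_trans ?_ (mul_le_mul_right (le_majorantNorm hv) _)
  have hz : ∀ σ m, majorant s (dzs σ (fun ν => z * c ν) m) v = ‖z‖ₑ * majorant s (dzs σ c m) v :=
    fun σ m => by
      rw [← majorant_smul]; congr 1; funext ν; simp only [dzs]; ring
  have hx : ∀ l, majorant s (dx (fun ν => z * c ν) l) v = ‖z‖ₑ * majorant s (dx c l) v :=
    fun l => by
      rw [← majorant_smul]; congr 1; funext ν; simp only [dx]; ring
  have hy : ∀ l, majorant s (dy (fun ν => z * c ν) l) v = ‖z‖ₑ * majorant s (dy c l) v :=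
    fun l => by
      rw [← majorant_smul]; congr 1; funext ν; simp only [dy]; ring
  simp only [hz, hx, hy, seqNorm_const_mul, ← ENNReal.mul_iSup, ← Finset.mul_sum, mul_div_assoc,
    mul_add, le_refl]

end norms

section mulZ

variable {n : ℕ} {j : Fin n → ℤ} {ξ : Fin n → ℝ}

theorem mulZ_eq (σ : ℤˣ) (m : Site j) (g : Coeff j) (ν : Index j) :
    mulZ σ m g ν = if ν.deg σ m = 0 then 0 else g (ν.subZ σ m) := by
  rcases Int.units_eq_one_or σ with rfl | rfl
  · simp [mulZ, Index.deg, Index.subZ]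
  · simp [mulZ, Index.deg, Index.subZ]

theorem mulZ_addZ (σ : ℤˣ) (m : Site j) (g : Coeff j) (ν : Index j) :
    mulZ σ m g (ν.addZ σ m) = g ν := by
  have h : (ν.addZ σ m).deg σ m ≠ 0 := by simp [deg_addZ]
  rw [mulZ_eq, if_neg h, addZ_injective σ m (addZ_subZ h)]

theorem mulZ_of_deg_eq_zero {σ : ℤˣ} {m : Site j} {ν : Index j} (h : ν.deg σ m = 0)
    (g : Coeff j) : mulZ σ m g ν = 0 := by
  rw [mulZ_eq, if_pos h]

theorem exists_of_mulZ_ne_zero {σ : ℤˣ} {m : Site j} {g : Coeff j} {ν : Index j}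
    (h : mulZ σ m g ν ≠ 0) : ∃ ν', ν = ν'.addZ σ m ∧ g ν' ≠ 0 := by
  have h0 : ν.deg σ m ≠ 0 := fun h0 => h (mulZ_of_deg_eq_zero h0 g)
  refine ⟨ν.subZ σ m, (addZ_subZ h0).symm, ?_⟩
  rwa [mulZ_eq, if_neg h0] at h

theorem mulZ_congr {σ : ℤˣ} {m : Site j} {g g' : Coeff j} {ν : Index j}
    (h : ∀ ν', ν = ν'.addZ σ m → g ν' = g' ν') : mulZ σ m g ν = mulZ σ m g' ν := by
  by_cases h0 : ν.deg σ m = 0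
  · rw [mulZ_of_deg_eq_zero h0, mulZ_of_deg_eq_zero h0]
  · rw [mulZ_eq, mulZ_eq, if_neg h0, if_neg h0, h _ (addZ_subZ h0).symm]

theorem substTerm_ne_zero {F : Coeff noSites} {ν : Index j} {M : Index noSites}
    (h : substTerm j ξ F ν M ≠ 0) : res j M ν.i = ν ∧ F M ≠ 0 := by
  unfold substTerm at h
  split_ifs at h with h1
  · exact ⟨h1, left_ne_zero_of_mul h⟩
  · exact absurd rfl h

theorem exists_of_subst_ne_zero {F : Coeff noSites} {ν : Index j} (h : subst j ξ F ν ≠ 0) :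
    ∃ M, res j M ν.i = ν ∧ F M ≠ 0 := by
  by_contra hc
  push Not at hc
  apply h
  rw [subst_apply]
  refine (tsum_congr fun M => ?_).trans tsum_zero
  by_contra hM
  exact (substTerm_ne_zero hM).2 (hc M (substTerm_ne_zero hM).1)

theorem substTerm_mulZ_addZ (σ : ℤˣ) (m : Site j) (G : Coeff noSites) (ν : Index j)
    (M : Index noSites) : substTerm j ξ (mulZ σ (norSite j m) G) (ν.addZ σ m)
      (M.addZ σ (norSite j m)) = substTerm j ξ G ν M := by
  have this : res j (M.addZ σ (norSite j m)) (ν.addZ σ m).i = ν.addZ σ m ↔ res j M ν.i = ν := by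
    rw [res_addZ_norSite, addZ_i, (addZ_injective σ m).eq_iff]
  unfold substTerm
  by_cases h : res j M ν.i = ν
  · rw [if_pos h, if_pos (this.2 h), mulZ_addZ, actionCoeff, actionCoeff, tanDeg_addZ_norSite,
      addZ_i]
  · rw [if_neg h, if_neg (this.not.2 h)]

theorem substTerm_mulZ_support (σ : ℤˣ) (m : Site j) (G : Coeff noSites) (ν : Index j)
    (M : Index noSites) (hM : M ∉ Set.range (Index.addZ (j := noSites) σ (norSite j m))) :
    substTerm j ξ (mulZ σ (norSite j m) G) ν M = 0 := by
  rw [mem_range_addZ, not_not] at hM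
  unfold substTerm
  rw [mulZ_of_deg_eq_zero hM, zero_mul, ite_self]

theorem substTerm_mulZ_eq_zero {σ : ℤˣ} {m : Site j} {ν : Index j} (h : ν.deg σ m = 0)
    (G : Coeff noSites) (M : Index noSites) :
    substTerm j ξ (mulZ σ (norSite j m) G) ν M = 0 := by
  by_contra hc
  obtain ⟨h1, h2⟩ := substTerm_ne_zero hc
  exact h2 (mulZ_of_deg_eq_zero (by rw [← deg_res σ m M ν.i, h1, h]) G)

theorem subst_mulZ (σ : ℤˣ) (m : Site j) (G : Coeff noSites) :
    subst j ξ (mulZ σ (norSite j m) G) = mulZ σ m (subst j ξ G) := by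
  funext ν
  by_cases h0 : ν.deg σ m = 0
  · rw [mulZ_of_deg_eq_zero h0, subst_apply]
    simp only [substTerm_mulZ_eq_zero h0, tsum_zero]
  · obtain ⟨ν, rfl⟩ := mem_range_addZ.2 h0
    rw [mulZ_addZ, subst_apply, subst_apply, ← (addZ_injective σ (norSite j m)).tsum_eq]
    · exact tsum_congr fun M => substTerm_mulZ_addZ σ m G ν M
    · exact fun M hM => by
        by_contra hc
        exact hM (substTerm_mulZ_support σ m G _ M hc)

theorem Substitutable.mulZ {G : Coeff noSites} (hG : Substitutable j ξ G) (σ : ℤˣ) (m : Site j) :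
    Substitutable j ξ (mulZ σ (norSite j m) G) := by
  intro ν
  by_cases h0 : ν.deg σ m = 0
  · have : substTerm j ξ (QuasiToplitz.mulZ σ (norSite j m) G) ν = fun _ => 0 :=
      funext fun M => substTerm_mulZ_eq_zero h0 G M
    rw [this]
    exact summable_zero
  · obtain ⟨ν, rfl⟩ := mem_range_addZ.2 h0
    rw [← (addZ_injective σ (norSite j m)).summable_iff
      fun M hM => substTerm_mulZ_support σ m G _ M hM]
    exact (hG ν).congr fun M => (substTerm_mulZ_addZ σ m G ν M).symm

theorem Substitutable.sub {F G : Coeff noSites} (hF : Substitutable j ξ F)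
    (hG : Substitutable j ξ G) : Substitutable j ξ (fun M => F M - G M) := fun ν => by
  refine ((hF ν).sub (hG ν)).congr fun M => ?_
  unfold substTerm; split_ifs
  · ring
  · simp

theorem Substitutable.smul {F : Coeff noSites} (hF : Substitutable j ξ F) (c : ℂ) :
    Substitutable j ξ (fun M => c * F M) := fun ν =>
  ((hF ν).mul_left c).congr fun M => (substTerm_smul c F ν M).symm

end mulZ

section cutoff

/-- The conditions on the cut-off `N`. -/
structure Cutoff (b L : ℝ) (κ N : ℕ) (μ μ' : ℝ) : Prop where
  one_le : 1 ≤ N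
  low : 12 * (N : ℝ) ^ L < N
  kappa_lt : (κ : ℝ) < N
  gap : (N : ℝ) ^ b < (μ' - μ) * (N : ℝ) ^ L
  le_two_pow : (N : ℝ) ≤ 2 ^ ((N : ℝ) ^ b / κ)

theorem le_two_rpow_of_le {b : ℝ} {κ N₀ N : ℕ} (hκ : 1 ≤ κ) (h0 : 1 ≤ N₀)
    (h : (N₀ : ℝ) * (2 : ℝ) ^ (-((N₀ : ℝ) ^ b / (2 * κ)) + 1) < 1) (hN : N₀ ≤ N) :
    (N : ℝ) ≤ 2 ^ ((N : ℝ) ^ b / κ) := by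
  have hκ' : (1 : ℝ) ≤ κ := by exact_mod_cast hκ
  have h0' : (1 : ℝ) ≤ N₀ := by exact_mod_cast h0
  have hN' : (N₀ : ℝ) ≤ N := by exact_mod_cast hN
  have hl2 : 0 < Real.log 2 := Real.log_pos one_lt_two
  set x₀ := Real.log N₀
  set x := Real.log N
  set c := Real.log 2 / (2 * κ)
  have hc : 0 < c := by positivity
  have hc2 : c < Real.log 2 := by
    rw [div_lt_iff₀ (by positivity)]; nlinarith
  have hx0 : 0 ≤ x₀ := Real.log_nonneg h0'
  have hx : x₀ ≤ x := Real.log_le_log (by linarith) hN'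
  have e0 : (N₀ : ℝ) ^ b = Real.exp (b * x₀) := by
    rw [Real.rpow_def_of_pos (by linarith), mul_comm]
  have e : (N : ℝ) ^ b = Real.exp (b * x) := by
    rw [Real.rpow_def_of_pos (by linarith), mul_comm]
  have h1 : x₀ + Real.log 2 < c * Real.exp (b * x₀) := by
    have := Real.log_lt_log (by positivity) h
    rw [Real.log_one, Real.log_mul (by positivity) (by positivity), Real.log_rpow two_pos, e0]
      at this
    have e2 : c * Real.exp (b * x₀) = Real.exp (b * x₀) / (2 * κ) * Real.log 2 := by
      simp only [c]; ring
    rw [e2]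
    linarith
  have hx0' : 0 < x₀ := by
    rcases hx0.eq_or_lt with h' | h'
    · rw [← h', mul_zero, Real.exp_zero] at h1
      linarith
    · exact h'
  have hxpos : 0 < x := hx0'.trans_le hx
  have h2 : Real.exp (b * x₀) ≤ (1 - x₀ / x) + x₀ / x * Real.exp (b * x) := by
    have h3 := convexOn_exp.2 (Set.mem_univ 0) (Set.mem_univ (b * x))
      (show 0 ≤ 1 - x₀ / x by rw [sub_nonneg, div_le_one hxpos]; exact hx)
      (show 0 ≤ x₀ / x by positivity) (by ring)
    simp only [smul_eq_mul, mul_zero, zero_add, Real.exp_zero, mul_one] at h3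
    have ex : b * x₀ = x₀ / x * (b * x) := by field_simp
    rw [ex]
    exact h3
  have h3 : x ≤ c * Real.exp (b * x) := by
    have h4 : x₀ + Real.log 2 < c * ((1 - x₀ / x) + x₀ / x * Real.exp (b * x)) :=
      h1.trans_le (by gcongr)
    have h5 : x₀ < x₀ / x * (c * Real.exp (b * x)) := by
      have : 0 ≤ c * (x₀ / x) := by positivity
      nlinarith
    rw [div_mul_eq_mul_div, lt_div_iff₀ hxpos] at h5
    exact (le_of_mul_le_mul_left h5.le hx0')
  rw [← Real.log_le_log_iff (by linarith) (by positivity), Real.log_rpow two_pos, e]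
  refine h3.trans ?_
  have e2 : c * Real.exp (b * x) = Real.exp (b * x) / κ * Real.log 2 * (1 / 2) := by
    simp only [c]; field_simp
  rw [e2]
  have : 0 ≤ Real.exp (b * x) / κ * Real.log 2 := by positivity
  linarith

theorem cutoff_of_le {b L : ℝ} (hb : 0 < b) (hbL : b < L) (hL : L < 1) {κ N₀ N : ℕ} {μ μ' : ℝ}
    (hκ : 1 ≤ κ) (h0 : 1 ≤ N₀)
    (h1 : 12 * (N₀ : ℝ) ^ (L - 1) + 2 * κ * (N₀ : ℝ) ^ (b - 1) < 1)
    (h2 : (N₀ : ℝ) ^ b < (μ' - μ) * (N₀ : ℝ) ^ L)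
    (h3 : (N₀ : ℝ) * (2 : ℝ) ^ (-((N₀ : ℝ) ^ b / (2 * κ)) + 1) < 1) (hN : N₀ ≤ N) :
    Cutoff b L κ N μ μ' := by
  have h0' : (0 : ℝ) < N₀ := by exact_mod_cast h0
  have hN' : (N₀ : ℝ) ≤ N := by exact_mod_cast hN
  have hNpos : (0 : ℝ) < N := h0'.trans_le hN'
  have h1N : (1 : ℝ) ≤ N := by exact_mod_cast h0.trans hN
  have hκ0 : (0 : ℝ) < κ := by exact_mod_cast hκ
  have mono : ∀ e : ℝ, e ≤ 0 → (N : ℝ) ^ e ≤ (N₀ : ℝ) ^ e := fun e he =>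
    Real.rpow_le_rpow_of_nonpos h0' hN' he
  have hA : 12 * (N : ℝ) ^ (L - 1) < 1 := by
    have := mono (L - 1) (by linarith)
    have : 0 ≤ 2 * κ * (N₀ : ℝ) ^ (b - 1) := by positivity
    linarith
  have hB : 2 * κ * (N : ℝ) ^ (b - 1) < 1 := by
    have := mono (b - 1) (by linarith)
    have h4 : 0 ≤ 12 * (N₀ : ℝ) ^ (L - 1) := by positivity
    have : 2 * κ * (N : ℝ) ^ (b - 1) ≤ 2 * κ * (N₀ : ℝ) ^ (b - 1) := by gcongr
    linarith
  refine ⟨h0.trans hN, ?_, ?_, ?_, le_two_rpow_of_le hκ h0 h3 hN⟩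
  · rw [Real.rpow_sub hNpos, Real.rpow_one, ← mul_div_assoc, div_lt_one hNpos] at hA
    exact hA
  · rw [Real.rpow_sub hNpos, Real.rpow_one, ← mul_div_assoc, div_lt_one hNpos] at hB
    have : 1 ≤ (N : ℝ) ^ b := Real.one_le_rpow h1N hb.le
    nlinarith
  · have h4 : (N₀ : ℝ) ^ (b - L) < μ' - μ := by
      rw [Real.rpow_sub h0', div_lt_iff₀ (by positivity)]; exact h2
    have h5 := (mono (b - L) (by linarith)).trans_lt h4
    rwa [Real.rpow_sub hNpos, div_lt_iff₀ (by positivity)] at h5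

end cutoff

section low

variable {n : ℕ} {j : Fin n → ℤ} {b L : ℝ} {N : ℕ} {μ : ℝ}

theorem Index.Low.abs_lt {ν : Index j} (h : ν.Low b L N μ) {σ : ℤˣ} {m : Site j}
    (hm : ν.deg σ m ≠ 0) : |((m : ℤ) : ℝ)| < μ * (N : ℝ) ^ L := by
  have key : ∀ A : Site j →₀ ℕ, A m ≠ 0 →
      |((m : ℤ) : ℝ)| ≤ A.sum fun m e => |((m : ℤ) : ℝ)| * e := by
    intro A hA
    refine le_trans ?_ (Finset.single_le_sum (f := fun m : Site j => |((m : ℤ) : ℝ)| * A m)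
      (fun _ _ => by positivity) (Finsupp.mem_support_iff.2 hA))
    refine le_mul_of_one_le_right (abs_nonneg _) ?_
    exact_mod_cast Nat.one_le_iff_ne_zero.2 hA
  have h0 : ∀ A : Site j →₀ ℕ, 0 ≤ A.sum fun m e => |((m : ℤ) : ℝ)| * (e : ℝ) :=
    fun A => Finset.sum_nonneg fun _ _ => by positivity
  have h1 := h.1
  have h2 := h0 ν.α
  have h3 := h0 ν.β
  rcases Int.units_eq_one_or σ with rfl | rfl
  · have := key ν.α (by simpa [Index.deg] using hm)
    linarith
  · have := key ν.β (by simpa [Index.deg] using hm)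
    linarith

end low

section toplitz

variable {n : ℕ} {j : Fin n → ℤ} {κ : ℕ} {a p s r R ρ b L : ℝ} {N : ℕ} {θ μ μ' : ℝ}
  {ξ : Fin n → ℝ}

/-- The terms of the sum that defines a Töplitz function. -/
def toplitzTerm (N : ℕ) (θ : ℝ) (g : ℤˣ → ℤˣ → ℤˣ → ℤ → Coeff j)
    (q : (Site j × Site j) × (ℤˣ × ℤˣ)) : Coeff j := fun ν =>
  if θ * N < |((q.1.1 : ℤ) : ℝ)| ∧ θ * N < |((q.1.2 : ℤ) : ℝ)| then
    mulZ q.2.1 q.1.1 (mulZ q.2.2 q.1.2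
      (g q.2.1 q.2.2 (siteSign q.1.1)
        ((q.2.1 : ℤ) * (q.1.1 : ℤ) + (q.2.2 : ℤ) * (q.1.2 : ℤ)))) ν
  else 0

theorem exists_of_toplitzTerm_ne_zero {g : ℤˣ → ℤˣ → ℤˣ → ℤ → Coeff j}
    {q : (Site j × Site j) × (ℤˣ × ℤˣ)} {ν : Index j} (h : toplitzTerm N θ g q ν ≠ 0) :
    (θ * N < |((q.1.1 : ℤ) : ℝ)| ∧ θ * N < |((q.1.2 : ℤ) : ℝ)|) ∧
      ∃ ν₀, ν = (ν₀.addZ q.2.2 q.1.2).addZ q.2.1 q.1.1 ∧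
        g q.2.1 q.2.2 (siteSign q.1.1)
          ((q.2.1 : ℤ) * (q.1.1 : ℤ) + (q.2.2 : ℤ) * (q.1.2 : ℤ)) ν₀ ≠ 0 := by
  unfold toplitzTerm at h
  split_ifs at h with hc
  · refine ⟨hc, ?_⟩
    obtain ⟨ν₁, rfl, h1⟩ := exists_of_mulZ_ne_zero h
    obtain ⟨ν₀, rfl, h0⟩ := exists_of_mulZ_ne_zero h1
    exact ⟨ν₀, rfl, h0⟩
  · exact absurd rfl h

/-- The pairs of normal sites and signs that occur in a monomial. -/
def pairs (ν : Index j) : Finset ((Site j × Site j) × (ℤˣ × ℤˣ)) :=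
  ((ν.α.support ∪ ν.β.support) ×ˢ (ν.α.support ∪ ν.β.support)) ×ˢ Finset.univ

theorem mem_pairs {ν : Index j} {q : (Site j × Site j) × (ℤˣ × ℤˣ)}
    (h1 : ν.deg q.2.1 q.1.1 ≠ 0) (h2 : ν.deg q.2.2 q.1.2 ≠ 0) : q ∈ pairs ν := by
  have key : ∀ σ (m : Site j), ν.deg σ m ≠ 0 → m ∈ ν.α.support ∪ ν.β.support := by
    intro σ m h
    rw [Finset.mem_union, Finsupp.mem_support_iff, Finsupp.mem_support_iff]
    unfold Index.deg at h
    split_ifs at h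
    · exact Or.inl h
    · exact Or.inr h
  simp only [pairs, Finset.mem_product, Finset.mem_univ, and_true]
  exact ⟨key _ _ h1, key _ _ h2⟩

theorem deg_addZ_addZ_ne_zero (ν₀ : Index j) (σ σ' : ℤˣ) (m m' : Site j) :
    ((ν₀.addZ σ' m').addZ σ m).deg σ m ≠ 0 ∧ ((ν₀.addZ σ' m').addZ σ m).deg σ' m' ≠ 0 := by
  constructor <;> simp [deg_addZ]

theorem finsum_toplitzTerm (g : ℤˣ → ℤˣ → ℤˣ → ℤ → Coeff j) (ν : Index j) :
    ∑ᶠ q, toplitzTerm N θ g q ν = ∑ q ∈ pairs ν, toplitzTerm N θ g q ν := by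
  refine finsum_eq_sum_of_support_subset _ fun q hq => ?_
  obtain ⟨-, ν₀, rfl, -⟩ := exists_of_toplitzTerm_ne_zero hq
  obtain ⟨h1, h2⟩ := deg_addZ_addZ_ne_zero ν₀ q.2.1 q.2.2 q.1.1 q.1.2
  exact mem_pairs h1 h2

/-- A pair of normal sites among all the sites. -/
def norPair (q : (Site j × Site j) × (ℤˣ × ℤˣ)) :
    (Site noSites × Site noSites) × (ℤˣ × ℤˣ) :=
  ((norSite j q.1.1, norSite j q.1.2), q.2)

theorem norPair_injective : Function.Injective (norPair (j := j)) := by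
  rintro ⟨⟨m, m'⟩, σ⟩ ⟨⟨m₁, m₁'⟩, σ₁⟩ h
  simp only [norPair, Prod.mk.injEq, norSite_inj] at h
  simp [h]

theorem exists_norSite (hκ : kappa j = κ) (hN : (κ : ℝ) < N) (hθ : 1 < θ) {m : Site noSites}
    (hm : θ * N < |((m : ℤ) : ℝ)|) : ∃ m', m = norSite j m' := by
  rcases site_cases (j := j) m with ⟨l, rfl⟩ | h
  · exfalso
    have h1 : |((j l : ℤ) : ℝ)| ≤ κ := by
      have : (j l).natAbs ≤ κ := by
        rw [← hκ]
        exact Finset.le_sup (f := fun l => (j l).natAbs) (Finset.mem_univ l)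
      rw [← Int.cast_abs, Int.abs_eq_natAbs]
      exact_mod_cast this
    rw [coe_tanSite] at hm
    have : (0 : ℝ) ≤ N := by positivity
    nlinarith
  · exact h

theorem finsum_toplitzTerm_res (hκ : kappa j = κ) (hN : (κ : ℝ) < N) (hθ : 1 < θ)
    (G : ℤˣ → ℤˣ → ℤˣ → ℤ → Coeff noSites) {ν : Index j} {M : Index noSites}
    (hM : res j M ν.i = ν) :
    ∑ᶠ q, toplitzTerm N θ G q M = ∑ q ∈ pairs ν, toplitzTerm N θ G (norPair q) M := by
  classical
  rw [finsum_eq_sum_of_support_subset (s := (pairs ν).image norPair)]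
  · exact Finset.sum_image fun _ _ _ _ h => norPair_injective h
  · rintro ⟨⟨m, m'⟩, σ, σ'⟩ hq
    obtain ⟨⟨h1, h2⟩, M₀, hM₀, -⟩ := exists_of_toplitzTerm_ne_zero hq
    obtain ⟨m, rfl⟩ := exists_norSite hκ hN hθ h1
    obtain ⟨m', rfl⟩ := exists_norSite hκ hN hθ h2
    obtain ⟨h3, h4⟩ := deg_addZ_addZ_ne_zero M₀ σ σ' (norSite j m) (norSite j m')
    simp only at hM₀
    rw [← hM₀, ← deg_res σ m M ν.i, hM] at h3
    rw [← hM₀, ← deg_res σ' m' M ν.i, hM] at h4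
    rw [Finset.coe_image]
    exact ⟨((m, m'), (σ, σ')), mem_pairs h3 h4, rfl⟩

theorem toplitzTerm_norPair_eq (G : ℤˣ → ℤˣ → ℤˣ → ℤ → Coeff noSites)
    (hG : ∀ σ σ' ς h, Substitutable j ξ (G σ σ' ς h)) (q : (Site j × Site j) × (ℤˣ × ℤˣ)) :
    Substitutable j ξ (toplitzTerm N θ G (norPair q)) ∧
      subst j ξ (toplitzTerm N θ G (norPair q)) =
        toplitzTerm N θ (fun σ σ' ς h => subst j ξ (G σ σ' ς h)) q := by
  by_cases hc : θ * N < |((q.1.1 : ℤ) : ℝ)| ∧ θ * N < |((q.1.2 : ℤ) : ℝ)|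
  · have e : toplitzTerm N θ G (norPair q) = mulZ q.2.1 (norSite j q.1.1)
        (mulZ q.2.2 (norSite j q.1.2) (G q.2.1 q.2.2 (siteSign q.1.1)
          ((q.2.1 : ℤ) * (q.1.1 : ℤ) + (q.2.2 : ℤ) * (q.1.2 : ℤ)))) := by
      funext ν
      exact if_pos hc
    rw [e]
    refine ⟨((hG _ _ _ _).mulZ _ _).mulZ _ _, ?_⟩
    rw [subst_mulZ, subst_mulZ]
    funext ν
    exact (if_pos hc).symm
  · have e : toplitzTerm N θ G (norPair q) = fun _ => 0 := by
      funext ν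
      exact if_neg hc
    rw [e]
    have h0 : substTerm j ξ (fun _ => 0) = fun _ _ => 0 := by
      funext ν M; simp [substTerm]
    constructor
    · intro ν
      rw [h0]
      exact summable_zero
    · funext ν
      rw [subst_apply, h0, tsum_zero]
      exact (if_neg hc).symm

theorem subst_toplitz (hκ : kappa j = κ) (hN : (κ : ℝ) < N) (hθ : 1 < θ)
    {F : Coeff noSites} {G : ℤˣ → ℤˣ → ℤˣ → ℤ → Coeff noSites}
    (hF : ∀ M, F M = ∑ᶠ q, toplitzTerm N θ G q M)
    (hG : ∀ σ σ' ς h, Substitutable j ξ (G σ σ' ς h)) (ν : Index j) :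
    subst j ξ F ν =
      ∑ q ∈ pairs ν, toplitzTerm N θ (fun σ σ' ς h => subst j ξ (G σ σ' ς h)) q ν := by
  have h1 : ∀ M, substTerm j ξ F ν M =
      ∑ q ∈ pairs ν, substTerm j ξ (toplitzTerm N θ G (norPair q)) ν M := by
    intro M
    unfold substTerm
    by_cases hM : res j M ν.i = ν
    · simp only [if_pos hM]
      rw [hF, finsum_toplitzTerm_res hκ hN hθ G hM, Finset.sum_mul]
    · simp only [if_neg hM, Finset.sum_const_zero]
  rw [subst_apply]
  simp only [h1]
  rw [Summable.tsum_finsetSum fun q _ => (toplitzTerm_norPair_eq G hG q).1 ν]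
  refine Finset.sum_congr rfl fun q _ => ?_
  rw [← subst_apply, (toplitzTerm_norPair_eq G hG q).2]

open Classical in
/-- The projection on the `(N, μ)`-low momentum monomials of momentum `-h`. -/
def lowProj (b L : ℝ) (N : ℕ) (μ : ℝ) (h : ℤ) (c : Coeff j) : Coeff j := fun ν =>
  if ν.LowWith b L N μ h then c ν else 0

theorem norm_lowProj_le (h : ℤ) (c : Coeff j) (ν : Index j) :
    ‖lowProj b L N μ h c ν‖ ≤ ‖c ν‖ := by
  unfold lowProj; split_ifs <;> simp

theorem norm_bilinearProj_le (c : Coeff j) (ν : Index j) :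
    ‖bilinearProj b L N θ μ c ν‖ ≤ ‖c ν‖ := by
  unfold bilinearProj; split_ifs <;> simp

/-- In a monomial `𝔪 z_m^σ z_{m'}^{σ'}` with `𝔪` of low momentum and `m`, `m'` large, the factor
`𝔪` is determined by the monomial. -/
theorem low_part_unique {ν₀ ν₁ : Index j} {m m' m₁ m₁' : Site j} {σ σ' σ₁ σ₁' : ℤˣ} {B : ℝ}
    (h0 : ∀ σ x, ν₀.deg σ x ≠ 0 → |((x : ℤ) : ℝ)| ≤ B)
    (h1 : ∀ σ x, ν₁.deg σ x ≠ 0 → |((x : ℤ) : ℝ)| ≤ B)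
    (hm : B < |((m : ℤ) : ℝ)|) (hm' : B < |((m' : ℤ) : ℝ)|)
    (hm₁ : B < |((m₁ : ℤ) : ℝ)|) (hm₁' : B < |((m₁' : ℤ) : ℝ)|)
    (h : (ν₀.addZ σ' m').addZ σ m = (ν₁.addZ σ₁' m₁').addZ σ₁ m₁) : ν₀ = ν₁ := by
  refine Index.ext_deg ?_ ?_ fun τ x => ?_
  · simpa using congrArg Index.k h
  · simpa using congrArg Index.i h
  · by_cases hx : |((x : ℤ) : ℝ)| ≤ B
    · have ne : ∀ y : Site j, B < |((y : ℤ) : ℝ)| → x ≠ y := by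
        rintro y hy rfl
        linarith
      have := congrArg (fun ν => Index.deg τ ν x) h
      simpa only [deg_addZ, ne _ hm, ne _ hm', ne _ hm₁, ne _ hm₁', and_false, if_false,
        add_zero] using this
    · have e0 : ν₀.deg τ x = 0 := by
        by_contra hc; exact hx (h0 τ x hc)
      have e1 : ν₁.deg τ x = 0 := by
        by_contra hc; exact hx (h1 τ x hc)
      rw [e0, e1]

theorem deg_ne_zero_abs_le (hc : Cutoff b L κ N μ μ') (hθ : 1 < θ) (hμ : μ < 6) {ν : Index j}
    (h : ν.Low b L N μ) {σ : ℤˣ} {m : Site j} (hm : ν.deg σ m ≠ 0) :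
    |((m : ℤ) : ℝ)| ≤ θ * N := by
  have h1 := h.abs_lt hm
  have h2 := hc.low
  have h3 : (0 : ℝ) ≤ (N : ℝ) ^ L := by positivity
  have h4 : (0 : ℝ) ≤ N := by positivity
  nlinarith

theorem lowWith_of_subst_ne_zero (hj : Function.Injective j) (hc : Cutoff b L κ N μ μ')
    (hθ : 1 < θ) (hμ : μ < 6) (hμ' : μ' < 6) {G : Coeff noSites} {h : ℤ}
    (hG : ∀ M, G M ≠ 0 → M.LowWith b L N μ' h) {ν₁ : Index j} (h1 : subst j ξ G ν₁ ≠ 0)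
    {m m' : Site j} {σ σ' : ℤˣ} (hm : θ * N < |((m : ℤ) : ℝ)|) (hm' : θ * N < |((m' : ℤ) : ℝ)|)
    (hB : ((ν₁.addZ σ' m').addZ σ m).Bilinear b L N θ μ) : ν₁.LowWith b L N μ h := by
  obtain ⟨M, hM, hGM⟩ := exists_of_subst_ne_zero h1
  have hlow := hG M hGM
  obtain ⟨m₀, m₀', σ₀, σ₀', ν₀, hm₀, hm₀', hν₀, he⟩ := hB
  have hcases : ∀ σ x, ν₁.deg σ x ≠ 0 → |((x : ℤ) : ℝ)| ≤ θ * N := by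
    intro σ x hx
    rw [← hM, deg_res] at hx
    have h1 := hlow.1.abs_lt hx
    have h2 := hc.low
    have h3 : (0 : ℝ) ≤ (N : ℝ) ^ L := by positivity
    have h4 : (0 : ℝ) ≤ N := by positivity
    rw [coe_norSite] at h1
    nlinarith
  have e : ν₁ = ν₀ := low_part_unique hcases
    (fun σ x hx => deg_ne_zero_abs_le hc hθ hμ hν₀.1 hx) hm hm' hm₀ hm₀' he
  refine ⟨e ▸ hν₀.1, ?_⟩
  rw [← hM, momentum_res hj]
  exact hlow.2

theorem bilinearProj_subst_toplitz (hj : Function.Injective j) (hκ : kappa j = κ)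
    (hc : Cutoff b L κ N μ μ') (hθ : 1 < θ) (hμ : μ < 6) (hμ' : μ' < 6)
    {F : Coeff noSites} {G : ℤˣ → ℤˣ → ℤˣ → ℤ → Coeff noSites}
    (hF : ∀ M, F M = ∑ᶠ q, toplitzTerm N θ G q M)
    (hG : ∀ σ σ' ς h, Substitutable j ξ (G σ σ' ς h))
    (hlow : ∀ σ σ' ς h M, G σ σ' ς h M ≠ 0 → M.LowWith b L N μ' h) (ν : Index j) :
    bilinearProj b L N θ μ (subst j ξ F) ν = ∑ᶠ q, toplitzTerm N θ
      (fun σ σ' ς h => lowProj b L N μ h (subst j ξ (G σ σ' ς h))) q ν := by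
  rw [finsum_toplitzTerm]
  unfold bilinearProj
  split_ifs with hB
  · rw [subst_toplitz hκ hc.kappa_lt hθ hF hG]
    refine Finset.sum_congr rfl fun q _ => ?_
    unfold toplitzTerm
    split_ifs with hq
    · refine mulZ_congr fun ν₂ h2 => mulZ_congr fun ν₁ h1 => ?_
      subst h1 h2
      unfold lowProj
      beta_reduce
      split_ifs with hl
      · rfl
      · by_contra hne
        exact hl (lowWith_of_subst_ne_zero hj hc hθ hμ hμ' (hlow _ _ _ _) hne hq.1 hq.2 hB)
    · rfl
  · symm
    refine Finset.sum_eq_zero fun q _ => ?_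
    by_contra hne
    obtain ⟨hq, ν₀, he, h0⟩ := exists_of_toplitzTerm_ne_zero hne
    refine hB ⟨q.1.1, q.1.2, q.2.1, q.2.2, ν₀, hq.1, hq.2, ?_, he⟩
    unfold lowProj at h0
    split_ifs at h0 with hl
    · exact hl
    · exact absurd rfl h0

/-- A monomial of moderate degree in the tangential variables is bilinear, for a larger cut-off, if
its pull-back is. -/
theorem bilinear_of_res (hj : Function.Injective j) (hκ : kappa j = κ)
    (hc : Cutoff b L κ N μ μ') {M : Index noSites} {i : Fin n → ℕ}
    (hB : (res j M i).Bilinear b L N θ μ)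
    (hM : (κ : ℝ) * (∑ l, tanDeg j M l : ℕ) ≤ (N : ℝ) ^ b) : M.Bilinear b L N θ μ' := by
  obtain ⟨m, m', σ, σ', ν₀, hm, hm', hν₀, he⟩ := hB
  obtain ⟨h3, -⟩ := deg_addZ_addZ_ne_zero ν₀ σ σ' m m'
  rw [← he, deg_res] at h3
  obtain ⟨M₁, rfl⟩ := mem_range_addZ.2 h3
  rw [res_addZ_norSite] at he
  have he₁ := addZ_injective σ m he
  have h4 : M₁.deg σ' (norSite j m') ≠ 0 := by
    rw [← deg_res σ' m' M₁ i, he₁]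
    simp [deg_addZ]
  obtain ⟨M₀, rfl⟩ := mem_range_addZ.2 h4
  rw [res_addZ_norSite] at he₁
  have he₀ := addZ_injective σ' m' he₁
  rw [tanDeg_addZ_norSite, tanDeg_addZ_norSite] at hM
  refine ⟨norSite j m, norSite j m', σ, σ', M₀, hm, hm', ⟨⟨?_, ?_⟩, ?_⟩, rfl⟩
  · have h1 := hν₀.1.1
    rw [← he₀, res_α, res_β] at h1
    rw [sum_site hj M₀.α (fun m e => |((m : ℤ) : ℝ)| * (e : ℝ)) (by simp),
      sum_site hj M₀.β (fun m e => |((m : ℤ) : ℝ)| * (e : ℝ)) (by simp)]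
    simp only [coe_norSite, coe_tanSite]
    have h2 : (∑ l, |((j l : ℤ) : ℝ)| * (M₀.α (tanSite j l) : ℝ)) +
        ∑ l, |((j l : ℤ) : ℝ)| * (M₀.β (tanSite j l) : ℝ) ≤
          (κ : ℝ) * (∑ l, tanDeg j M₀ l : ℕ) := by
      rw [← Finset.sum_add_distrib, Nat.cast_sum, Finset.mul_sum]
      refine Finset.sum_le_sum fun l _ => ?_
      have h1 : |((j l : ℤ) : ℝ)| ≤ κ := by
        have : (j l).natAbs ≤ κ := by
          rw [← hκ]
          exact Finset.le_sup (f := fun l => (j l).natAbs) (Finset.mem_univ l)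
        rw [← Int.cast_abs, Int.abs_eq_natAbs]
        exact_mod_cast this
      rw [tanDeg, Nat.cast_add, ← mul_add]
      gcongr
    have h3 := hc.gap
    linarith
  · have : (0 : ℝ) < N := by exact_mod_cast hc.one_le
    simpa using Real.rpow_pos_of_pos this b
  · rw [← momentum_res hj M₀ i, he₀]
    exact hν₀.2

theorem inv_two_pow_le (hc : Cutoff b L κ N μ μ') (hκ : 1 ≤ κ) {k : ℕ}
    (hk : (N : ℝ) ^ b < κ * k) : (2 : ℝ≥0∞)⁻¹ ^ k ≤ (N : ℝ≥0∞)⁻¹ := by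
  have hκ' : (0 : ℝ) < κ := by exact_mod_cast hκ
  have h1 : (N : ℝ) ≤ 2 ^ k := by
    refine hc.le_two_pow.trans ?_
    rw [← Real.rpow_natCast]
    refine Real.rpow_le_rpow_of_exponent_le one_le_two ?_
    rw [div_le_iff₀ hκ']
    linarith
  have h2 : N ≤ 2 ^ k := by exact_mod_cast h1
  rw [← ENNReal.inv_pow]
  exact ENNReal.inv_le_inv' (by exact_mod_cast h2)

end toplitz

section constant

theorem hamNorm_unit {a p s r : ℝ} (f : Unit → Coeff noSites) :
    hamNorm a p s r Set.univ f = majorantNorm a p s r (hamVF (f ())) := by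
  unfold hamNorm
  exact le_antisymm (iSup₂_le fun u _ => le_rfl) (le_iSup₂_of_le () (Set.mem_univ _) le_rfl)

/-- The constant in the bound of the composition with the action-angle map. -/
def substConst (n d : ℕ) (s r R : ℝ) : ℝ≥0∞ :=
  ENNReal.ofReal ((48 + 22 * n) / s * (8 * r / R) ^ ((d : ℤ) - 2))

theorem substConst_ne_top (n d : ℕ) (s r R : ℝ) : substConst n d s r R ≠ ∞ :=
  ENNReal.ofReal_ne_top

theorem substConst_ne_zero {n d : ℕ} {s r R : ℝ} (hs : 0 < s) (hr : 0 < r) (hR : 0 < R) :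
    substConst n d s r R ≠ 0 := by
  simp only [substConst, ne_eq, ENNReal.ofReal_eq_zero, not_le]
  positivity

end constant

section toplitz

variable {n : ℕ} {j : Fin n → ℤ} {κ : ℕ} {a p s r R ρ b L : ℝ} {N : ℕ} {θ μ μ' : ℝ} {d : ℕ}

theorem normalDegreeGE_of_toplitz (h : Radii j κ a p s r R ρ) (hc : Cutoff b L κ N μ μ')
    (hθ : 1 < θ) (hd : d ≤ 1) {F : Coeff noSites} {G : ℤˣ → ℤˣ → ℤˣ → ℤ → Coeff noSites}
    (hF : ∀ M, F M = ∑ᶠ q, toplitzTerm N θ G q M) : NormalDegreeGE j d F := by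
  intro M hM
  refine hd.trans ?_
  rw [hF] at hM
  obtain ⟨q, hq⟩ : ∃ q, toplitzTerm N θ G q M ≠ 0 := by
    by_contra hcon
    push Not at hcon
    exact hM (by simp only [hcon, finsum_zero])
  obtain ⟨⟨h1, -⟩, M₀, hM₀, -⟩ := exists_of_toplitzTerm_ne_zero hq
  obtain ⟨m, hm⟩ := exists_norSite h.kappa_eq hc.kappa_lt hθ h1
  have h2 := (deg_addZ_addZ_ne_zero M₀ q.2.1 q.2.2 q.1.1 q.1.2).1
  rw [← hM₀, hm] at h2
  rw [normalDegree_eq h.inj]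
  have key : ∀ A : Site noSites →₀ ℕ, A (norSite j m) ≠ 0 → 1 ≤ (restrict j A).degree := by
    intro A hA
    exact (Nat.one_le_iff_ne_zero.2 hA).trans (Finsupp.le_degree m (restrict j A))
  unfold Index.deg at h2
  split_ifs at h2
  · exact le_add_right (key _ h2)
  · exact le_add_left (key _ h2)

namespace Radii

theorem hamNorm_le_of_norm_le (h : Radii j κ a p s r R ρ) (hd1 : d ≤ 1) {F : Coeff noSites}
    (hd : NormalDegreeGE j d F) {f : (Fin n → ℝ) → Coeff j}
    (hf : ∀ ξ ν, ‖f ξ ν‖ ≤ ‖subst j ξ F ν‖) :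
    hamNorm a p s r (paramSet n ρ) f ≤
      substConst n d s r R * majorantNorm a p 1 (R / 2) (hamVF F) := by
  refine iSup₂_le fun ξ hξ => (majorantNorm_mono (hf ξ)).trans ?_
  have := h.majorantNorm_subst_le hd1 (ε := 1) hd (fun M _ => pow_le_one₀ zero_le (by simp)) hξ
  rwa [one_mul] at this

theorem mRegular_of_norm_le (h : Radii j κ a p s r R ρ) {F : Coeff noSites}
    (hF : majorantNorm a p 1 (R / 2) (hamVF F) < ∞) {f : (Fin n → ℝ) → Coeff j}
    (hf : ∀ ξ ν, ‖f ξ ν‖ ≤ ‖subst j ξ F ν‖) : MRegular a p s r (paramSet n ρ) f :=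
  (h.hamNorm_le_of_norm_le (d := 0) zero_le_one (fun _ _ => Nat.zero_le _) hf).trans_lt
    (ENNReal.mul_lt_top (substConst_ne_top _ _ _ _ _).lt_top hF)

theorem conservesMomentum_of_norm_le (h : Radii j κ a p s r R ρ) {F : Coeff noSites}
    (hF : ∀ M, F M ≠ 0 → M.momentum = 0) {f : (Fin n → ℝ) → Coeff j}
    (hf : ∀ ξ ν, ‖f ξ ν‖ ≤ ‖subst j ξ F ν‖) : ConservesMomentum (paramSet n ρ) f := by
  intro ξ _ ν hν
  have h1 : subst j ξ F ν ≠ 0 := fun h0 => hν (by simpa [h0] using hf ξ ν)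
  obtain ⟨M, hM, hFM⟩ := exists_of_subst_ne_zero h1
  rw [← hM, momentum_res h.inj]
  exact hF M hFM

theorem isToplitz_subst (h : Radii j κ a p s r R ρ) (hc : Cutoff b L κ N μ μ') (hθ : 1 < θ)
    (hμ : μ < 6) (hμ' : μ' < 6) {Ft : Unit → Coeff noSites}
    (hFt : IsToplitz a p b L 1 (R / 2) N θ μ' Set.univ Ft) :
    IsToplitz a p b L s r N θ μ (paramSet n ρ)
      fun ξ => bilinearProj b L N θ μ (subst j ξ (Ft ())) := by
  obtain ⟨⟨hreg, hmom⟩, G, hG, hGF⟩ := hFt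
  have hreg' : majorantNorm a p 1 (R / 2) (hamVF (Ft ())) < ∞ := by
    rw [← hamNorm_unit]; exact hreg
  have hGreg : ∀ σ σ' ς k, majorantNorm a p 1 (R / 2) (hamVF (G σ σ' ς k ())) < ∞ := by
    intro σ σ' ς k
    rw [← hamNorm_unit]
    exact (hG σ σ' ς k).1
  refine ⟨⟨h.mRegular_of_norm_le hreg' fun _ _ => norm_bilinearProj_le _ _,
    h.conservesMomentum_of_norm_le (hmom () (Set.mem_univ _))
      fun _ _ => norm_bilinearProj_le _ _⟩,
    fun σ σ' ς k ξ => lowProj b L N μ k (subst j ξ (G σ σ' ς k ())), fun σ σ' ς k =>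
    ⟨h.mRegular_of_norm_le (hGreg σ σ' ς k) fun _ _ => norm_lowProj_le _ _ _, ?_⟩, ?_⟩
  · intro ξ _ ν hν
    unfold lowProj at hν
    beta_reduce at hν
    split_ifs at hν with hl
    · exact hl
    · exact absurd rfl hν
  · intro ξ hξ ν
    exact bilinearProj_subst_toplitz h.inj h.kappa_eq hc hθ hμ hμ'
      (G := fun σ σ' ς k => G σ σ' ς k ()) (fun M => hGF () (Set.mem_univ _) M)
      (fun σ σ' ς k => h.substitutable (hGreg σ σ' ς k) hξ)
      (fun σ σ' ς k M hM => (hG σ σ' ς k).2 () (Set.mem_univ _) M hM) ν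

open Classical in
theorem hamNorm_defect_subst_le (h : Radii j κ a p s r R ρ) (hc : Cutoff b L κ N μ μ')
    (hd1 : d ≤ 1) {Fc : Coeff noSites}
    (hFc : majorantNorm a p 1 (R / 2) (hamVF Fc) < ∞) (hd : NormalDegreeGE j d Fc)
    {Ft : Unit → Coeff noSites} (hFt : majorantNorm a p 1 (R / 2) (hamVF (Ft ())) < ∞)
    (hdt : NormalDegreeGE j d (Ft ())) :
    hamNorm a p s r (paramSet n ρ) (defect b L N θ μ (fun ξ => subst j ξ Fc)
        fun ξ => bilinearProj b L N θ μ (subst j ξ (Ft ()))) ≤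
      substConst n d s r R *
        (hamNorm a p 1 (R / 2) Set.univ (defect b L N θ μ' (fun _ => Fc) Ft) +
          majorantNorm a p 1 (R / 2) (hamVF Fc)) := by
  have hN0 : (N : ℝ≥0∞) ≠ 0 := by
    have := hc.one_le
    exact_mod_cast (by omega : N ≠ 0)
  rw [hamNorm_unit]
  set Fd : Coeff noSites := defect b L N θ μ' (fun _ => Fc) Ft () with hFd
  set Fh : Coeff noSites := fun M => if (N : ℝ) ^ b < κ * (∑ l, tanDeg j M l : ℕ) ∧
    ¬ M.Bilinear b L N θ μ' then Fc M else 0 with hFh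
  have hFh_le : ∀ M, ‖Fh M‖ ≤ ‖Fc M‖ := by
    intro M
    simp only [hFh]
    split_ifs <;> simp
  refine iSup₂_le fun ξ hξ => ?_
  have s1 := h.substitutable hFc hξ
  have s2 := h.substitutable hFt hξ
  have s3 : Substitutable j ξ Fd :=
    ((s1.of_norm_le fun M => norm_bilinearProj_le Fc M).sub s2).smul N
  have s4 : Substitutable j ξ fun M => (N : ℂ) * Fh M := (s1.of_norm_le hFh_le).smul N
  have hle : ∀ ν, ‖defect b L N θ μ (fun ξ => subst j ξ Fc)
      (fun ξ => bilinearProj b L N θ μ (subst j ξ (Ft ()))) ξ ν‖ ≤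
        ‖(subst j ξ Fd + subst j ξ fun M => (N : ℂ) * Fh M) ν‖ := by
    intro ν
    by_cases hB : ν.Bilinear b L N θ μ
    · refine (congrArg norm ?_).le
      simp only [defect, bilinearProj, if_pos hB, Pi.add_apply]
      rw [← s1.subst_sub s2, ← subst_smul, ← s3.subst_add s4, subst_apply, subst_apply]
      refine tsum_congr fun M => ?_
      unfold substTerm
      by_cases hM : res j M ν.i = ν
      · rw [if_pos hM, if_pos hM]
        congr 1
        simp only [Pi.add_apply, hFd, defect, hFh, bilinearProj]
        by_cases hMB : M.Bilinear b L N θ μ'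
        · simp [hMB]
        · have hk : (N : ℝ) ^ b < κ * (∑ l, tanDeg j M l : ℕ) := by
            by_contra hk
            exact hMB (bilinear_of_res (i := ν.i) h.inj h.kappa_eq hc (by rw [hM]; exact hB)
              (not_lt.1 hk))
          rw [if_neg hMB, if_pos ⟨hk, hMB⟩]
          ring
      · rw [if_neg hM, if_neg hM]
    · simp [defect, bilinearProj, if_neg hB]
  refine (majorantNorm_mono hle).trans ((majorantNorm_add_le _ _).trans ?_)
  rw [mul_add]
  refine add_le_add ?_ ?_
  · have hdd : NormalDegreeGE j d Fd := by
      intro M hM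
      by_cases h1 : Fc M = 0
      · refine hdt M fun h2 => hM ?_
        simp [hFd, defect, bilinearProj, h1, h2]
      · exact hd M h1
    have := h.majorantNorm_subst_le hd1 (ε := 1) hdd
      (fun M _ => pow_le_one₀ zero_le (by simp)) hξ
    rwa [one_mul] at this
  · have hFh0 : ∀ M, (N : ℂ) * Fh M ≠ 0 → (N : ℝ) ^ b < κ * (∑ l, tanDeg j M l : ℕ) ∧
        Fc M ≠ 0 := by
      intro M hM
      have h1 := right_ne_zero_of_mul hM
      simp only [hFh] at h1
      split_ifs at h1 with h2
      · exact ⟨h2.1, h1⟩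
      · exact absurd rfl h1
    refine (h.majorantNorm_subst_le hd1 (ε := (N : ℝ≥0∞)⁻¹) (fun M hM => hd M (hFh0 M hM).2)
      (fun M hM => inv_two_pow_le hc h.one_le_kappa (hFh0 M hM).1) hξ).trans ?_
    refine mul_le_mul_right ?_ _
    have hNe : ‖(N : ℂ)‖ₑ = (N : ℝ≥0∞) := by
      rw [← ofReal_norm, Complex.norm_natCast, ENNReal.ofReal_natCast]
    calc _ ≤ (N : ℝ≥0∞)⁻¹ * (N * majorantNorm a p 1 (R / 2) (hamVF Fc)) := by
          gcongr
          refine (majorantNorm_smul_le _ _).trans ?_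
          rw [hNe]
          gcongr
          exact majorantNorm_mono hFh_le
      _ = _ := by
          rw [← mul_assoc, ENNReal.inv_mul_cancel hN0 (ENNReal.natCast_ne_top N), one_mul]

/-- The composition with the action-angle map is bounded in the quasi-Töplitz semi-norms. -/
theorem qtNorm_subst_le (h : Radii j κ a p s r R ρ) {N₀ : ℕ}
    (hc : ∀ N, N₀ ≤ N → Cutoff b L κ N μ μ') (hθ : 1 < θ) (hμ : μ < 6) (hμ' : μ' < 6)
    (hd1 : d ≤ 1) {Fc : Coeff noSites}
    (hFc : majorantNorm a p 1 (R / 2) (hamVF Fc) < ∞) (hd : NormalDegreeGE j d Fc) :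
    qtNorm a p b L s r N₀ θ μ (paramSet n ρ) (fun ξ => subst j ξ Fc) ≤
      2 * substConst n d s r R *
        qtNorm a p b L 1 (R / 2) N₀ θ μ' (Set.univ : Set Unit) (fun _ => Fc) := by
  have hC0 := substConst_ne_zero (n := n) (d := d) h.s_pos h.r_pos h.R_pos
  have hC1 := substConst_ne_top n d s r R
  set C := substConst n d s r R
  refine iSup₂_le fun N hN => ?_
  have hcN := hc N hN
  refine le_trans ?_ (mul_le_mul_right (le_iSup₂ (f := fun (N : ℕ) (_ : N₀ ≤ N) =>
    ⨅ (ft : Unit → Coeff noSites) (_ : IsToplitz a p b L 1 (R / 2) N θ μ' Set.univ ft),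
      max (hamNorm a p 1 (R / 2) Set.univ fun _ => Fc) (max (hamNorm a p 1 (R / 2) Set.univ ft)
        (hamNorm a p 1 (R / 2) Set.univ (defect b L N θ μ' (fun _ => Fc) ft)))) N hN) _)
  have h2C0 : 2 * C ≠ 0 := mul_ne_zero two_ne_zero hC0
  have h2C1 : 2 * C ≠ ∞ := ENNReal.mul_ne_top ENNReal.ofNat_ne_top hC1
  rw [ENNReal.mul_iInf_of_ne h2C0 h2C1]
  refine le_iInf fun Ft => ?_
  rw [ENNReal.mul_iInf_of_ne h2C0 h2C1]
  refine le_iInf fun hFt => ?_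
  refine iInf₂_le_of_le _ (h.isToplitz_subst hcN hθ hμ hμ' hFt) ?_
  have hFtn : majorantNorm a p 1 (R / 2) (hamVF (Ft ())) < ∞ := by
    rw [← hamNorm_unit]; exact hFt.1.1
  have hdt : NormalDegreeGE j d (Ft ()) := by
    obtain ⟨-, G, -, hG⟩ := hFt
    exact normalDegreeGE_of_toplitz h hcN hθ hd1 (G := fun σ σ' ς k => G σ σ' ς k ())
      fun M => hG () (Set.mem_univ _) M
  have b3 := h.hamNorm_defect_subst_le (θ := θ) hcN hd1 hFc hd hFtn hdt
  set X := max (hamNorm a p 1 (R / 2) Set.univ fun _ : Unit => Fc)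
    (max (hamNorm a p 1 (R / 2) Set.univ Ft)
      (hamNorm a p 1 (R / 2) Set.univ (defect b L N θ μ' (fun _ => Fc) Ft))) with hX
  have hX1 : majorantNorm a p 1 (R / 2) (hamVF Fc) ≤ X := by
    rw [← hamNorm_unit fun _ => Fc]; exact le_max_left _ _
  have hX2 : majorantNorm a p 1 (R / 2) (hamVF (Ft ())) ≤ X := by
    rw [← hamNorm_unit]; exact (le_max_left _ _).trans (le_max_right _ _)
  have hX3 : hamNorm a p 1 (R / 2) Set.univ (defect b L N θ μ' (fun _ => Fc) Ft) ≤ X :=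
    (le_max_right _ _).trans (le_max_right _ _)
  have hC : C * X ≤ 2 * C * X := by
    rw [mul_assoc]; exact le_mul_of_one_le_left' one_le_two
  refine max_le ?_ (max_le ?_ ?_)
  · exact ((h.hamNorm_le_of_norm_le hd1 hd fun _ _ => le_rfl).trans
      (mul_le_mul_right hX1 _)).trans hC
  · exact ((h.hamNorm_le_of_norm_le hd1 hdt fun _ _ => norm_bilinearProj_le _ _).trans
      (mul_le_mul_right hX2 _)).trans hC
  · refine b3.trans ?_
    calc _ ≤ C * (X + X) := by gcongr
      _ = _ := by ring

end Radii

end toplitz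

end QuasiToplitz

end

/-- `F` has no parameters and no `(x, y)`-variables: its norms do not depend on `s` (taken to be
`1`) and are those of the constant family on a one-point parameter set. -/
theorem proposition6p2 (n κ : ℕ) :
    ∃ c : ℝ, 0 < c ∧
      ∀ (j : Fin n → ℤ), Function.Injective j → QuasiToplitz.kappa j = κ → 1 ≤ κ →
      ∀ (a p b L : ℝ), 0 ≤ a → 1 / 2 < p → 0 < b → b < L → L < 1 →
      ∀ (s r R ρ : ℝ), 0 < s → s < 1 → 0 < r → 0 < R →
        16 * r ^ 2 < ρ →
        ρ = (48 * n * (κ : ℝ) ^ (2 * p) * Real.exp (2 * (s + a * κ)))⁻¹ * R ^ 2 →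
      ∀ (N₀ : ℕ) (θ μ μ' : ℝ), 1 ≤ N₀ →
        1 < θ → θ < 6 → 1 < μ → μ < 6 → 1 < μ' → μ' < 6 →
        12 * (N₀ : ℝ) ^ (L - 1) + 2 * κ * (N₀ : ℝ) ^ (b - 1) < 1 →
        (N₀ : ℝ) ^ b < (μ' - μ) * (N₀ : ℝ) ^ L →
        (N₀ : ℝ) * (2 : ℝ) ^ (-((N₀ : ℝ) ^ b / (2 * κ)) + 1) < 1 →
      ∀ (d : ℕ), d = 0 ∨ d = 1 →
      ∀ (F : QuasiToplitz.Pt QuasiToplitz.noSites → ℂ)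
        (Fc : QuasiToplitz.Coeff QuasiToplitz.noSites),
        QuasiToplitz.HasExpansion a p 1 (R / 2) F Fc →
        QuasiToplitz.IsQuasiToplitz a p b L 1 (R / 2) N₀ θ μ' (Set.univ : Set Unit)
          (fun _ => Fc) →
        QuasiToplitz.NormalDegreeGE j d Fc →
        ∃ fc : (Fin n → ℝ) → QuasiToplitz.Coeff j,
          (∀ ξ ∈ QuasiToplitz.paramSet n ρ,
            QuasiToplitz.HasExpansion a p s r
              (fun v => F (QuasiToplitz.actionAngle j ξ v)) (fc ξ)) ∧
          QuasiToplitz.IsQuasiToplitz a p b L s r N₀ θ μ (QuasiToplitz.paramSet n ρ) fc ∧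
          QuasiToplitz.qtNorm a p b L s r N₀ θ μ (QuasiToplitz.paramSet n ρ) fc ≤
            ENNReal.ofReal (c / s * (8 * r / R) ^ ((d : ℤ) - 2)) *
              QuasiToplitz.qtNorm a p b L 1 (R / 2) N₀ θ μ' (Set.univ : Set Unit)
                (fun _ => Fc) := by

  refine ⟨2 * (48 + 22 * n), by positivity, ?_⟩
  intro j hj hκ hκ1 a p b L ha hp hb hbL hL s r R ρ hs hs1 hr hR h16 hρ N₀ θ μ μ' hN₀ hθ _ _ hμ _
    hμ' hN1 hN2 hN3 d hd F Fc hF hFq hFd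
  have h : QuasiToplitz.Radii j κ a p s r R ρ := ⟨hj, hκ, hκ1, ha, hp, hs, hs1, hr, hR, h16, hρ⟩
  have hd1 : d ≤ 1 := by omega
  have hFc : QuasiToplitz.majorantNorm a p 1 (R / 2) (QuasiToplitz.hamVF Fc) < ∞ := by
    rw [← QuasiToplitz.hamNorm_unit fun _ => Fc]; exact hFq.1.1
  have hbound := h.qtNorm_subst_le (N₀ := N₀) (b := b) (L := L) (θ := θ) (μ := μ) (μ' := μ')
    (fun N hN => QuasiToplitz.cutoff_of_le hb hbL hL hκ1 hN₀ hN1 hN2 hN3 hN) hθ hμ hμ' hd1 hFc hFd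
  have hC : 2 * QuasiToplitz.substConst n d s r R =
      ENNReal.ofReal (2 * (48 + 22 * n) / s * (8 * r / R) ^ ((d : ℤ) - 2)) := by
    rw [QuasiToplitz.substConst, ← ENNReal.ofReal_ofNat, ← ENNReal.ofReal_mul (by norm_num)]
    congr 1
    ring
  rw [hC] at hbound
  refine ⟨fun ξ => QuasiToplitz.subst j ξ Fc, fun ξ hξ => h.hasExpansion_subst hF hξ,
    ⟨⟨h.mRegular_of_norm_le hFc fun _ _ => le_rfl,
      h.conservesMomentum_of_norm_le (hFq.1.2 () (Set.mem_univ _)) fun _ _ => le_rfl⟩,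
      hbound.trans_lt (ENNReal.mul_lt_top ENNReal.ofReal_lt_top hFq.2)⟩, hbound⟩
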